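/- Let $G$ be a finite abelian subgroup of $\mathrm{SL}(n,\mathbb{C})$ of order $r$. Choose linear coordinates on $\mathbb{C}^n$ in which all elements of $G$ are diagonal, and a primitive $r$-th root of unity $\varepsilon$. For $g=\mathrm{diag}(\varepsilon^{a_1},\dots,\varepsilon^{a_n})\in G$ with $0\le a_i<r$ put $\hat g=\tfrac1r(a_1,\dots,a_n)$ and $\mathrm{age}(g)=\tfrac1r(a_1+\dots+a_n)$; $g$ is called junior if $\mathrm{age}(g)=1$. Let $N=\mathbb{Z}^n+\sum_{g\in G}\mathbb{Z}\hat g\subset\mathbb{R}^n$, let $M$ be the dual lattice, and let $\sigma=\mathrm{Cone}(e_1,\dots,e_n)$, so that $\mathbb{C}^n/G$ is the affine toric variety $U_{\sigma,N}=\mathrm{Spec}\,\mathbb{C}[\sigma^\vee\cap M]$. Let $\Xi$ be a smooth fan with respect to $N$ that refines $\sigma$, and suppose that the toric morphism $\phi:X_\Xi\to\mathbb{C}^n/G$ is crepant, $K_{X_\Xi}=\phi^*K_{\mathbb{C}^n/G}$. For $g\in G$ let $\rho_g=\mathrm{Cone}(\hat g)$ and let $\Xi_g$ be the fan of all faces of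 the maximal cones of $\Xi$ that contain $\rho_g$ as a face; if $\rho_g\in\Xi$, let $E_g=V(\rho_g)\subset X_\Xi$ be the closure of the torus orbit of $\rho_g$, with its reduced structure. For every junior element $g\in G$: 1. $\rho_g\in\Xi$, and $E_g$ is normally embedded in $X_\Xi$: there are an open neighbourhood $U_0$ of the zero section in the total space of the normal bundle $\mathcal N_{E_g/X_\Xi}$ and an isomorphism of $U_0$ (as a variety over $\mathbb C$, hence biholomorphic) onto an open neighbourhood of $E_g$ in $X_\Xi$ that is the identity on the zero section. 2. The natural morphism $X_{\Xi_g}\to X_\Xi$ is an open immersion, and there is an isomorphism $\mathrm{tot}(\omega_{E_g})\cong X_{\Xi_g}$ of varieties over $\mathbb{C}$, from the total space of the canonical bundle of $E_g$, which maps the zero section identically to $E_g$. 3. The total space of $\omega_{E_g}$ is isomorphic over $E_g$, compatibly with the zero sections, to the total space of the normal bundle $\mathcal N_{E_g/X_\Xi}$. Moreover, if $G$ is nontrivial, then $X_\Xi=\bigcup_{g\ \text{junior}}X_{\Xi_g}$. -/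

import Mathlib

/-! ### Lattices, cones and fans -/

namespace Toric

open AlgebraicGeometry CategoryTheory CategoryTheory.Limits

noncomputable section

section Cones

variable {V : Type} [AddCommGroup V] [Module ℝ V]

/-- The lattice `M` dual to the lattice `N` in the real vector space `V`. -/
def dualLattice (N : Submodule ℤ V) : AddSubgroup (Module.Dual ℝ V) where
  carrier := {m | ∀ u ∈ N, ∃ k : ℤ, m u = k}
  zero_mem' u _ := ⟨0, by simp⟩
  add_mem' {a b} ha hb u hu := by
    obtain ⟨k, hk⟩ := ha u hu
    obtain ⟨l, hl⟩ := hb u hu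
    exact ⟨k + l, by simp [hk, hl]⟩
  neg_mem' {a} ha u hu := by
    obtain ⟨k, hk⟩ := ha u hu
    exact ⟨-k, by simp [hk]⟩

/-- The semigroup `τ^∨ ∩ M` of a cone `τ`. -/
def dualMonoid (N : Submodule ℤ V) (τ : PointedCone ℝ V) : AddSubmonoid (Module.Dual ℝ V) where
  carrier := {m | m ∈ dualLattice N ∧ ∀ v ∈ τ, 0 ≤ m v}
  zero_mem' := ⟨zero_mem _, by simp⟩
  add_mem' {a b} ha hb :=
    ⟨add_mem ha.1 hb.1, fun v hv => by simpa using add_nonneg (ha.2 v hv) (hb.2 v hv)⟩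

lemma dualMonoid_anti (N : Submodule ℤ V) {τ η : PointedCone ℝ V} (h : τ ≤ η) :
    dualMonoid N η ≤ dualMonoid N τ :=
  fun _ hm => ⟨hm.1, fun v hv => hm.2 v (h hv)⟩

/-- The slice `τ ∩ m^⊥`; it is a face of `τ` when `m ∈ τ^∨`. -/
def slice (τ : PointedCone ℝ V) (m : Module.Dual ℝ V) : PointedCone ℝ V :=
  τ ⊓ PointedCone.ofSubmodule (LinearMap.ker m)

lemma mem_slice {τ : PointedCone ℝ V} {m : Module.Dual ℝ V} {v : V} :
    v ∈ slice τ m ↔ v ∈ τ ∧ m v = 0 := Iff.rfl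

/-- `τ` is a face of `η`: it is cut out of `η` by some `m ∈ η^∨ ∩ M`.  (For the rational polyhedral
cones used below, all faces are cut out by lattice elements `m`.) -/
def IsFace (N : Submodule ℤ V) (τ η : PointedCone ℝ V) : Prop :=
  ∃ m ∈ dualMonoid N η, τ = slice η m

/-- `τ` is generated by finitely many elements of the lattice `N`. -/
def IsRationalPolyhedral (N : Submodule ℤ V) (τ : PointedCone ℝ V) : Prop :=
  ∃ s : Finset V, (∀ u ∈ s, u ∈ N) ∧ τ = PointedCone.hull ℝ (s : Set V)

/-- `τ` contains no line. -/
def IsStronglyConvex (τ : PointedCone ℝ V) : Prop := ∀ v ∈ τ, -v ∈ τ → v = 0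

/-- `τ` is smooth: it is generated by a part of a `ℤ`-basis of the lattice `N`. -/
def IsSmoothCone (N : Submodule ℤ V) (τ : PointedCone ℝ V) : Prop :=
  ∃ (ι : Type) (b : Module.Basis ι ℤ N) (s : Set ι),
    τ = PointedCone.hull ℝ ((fun i => (b i : V)) '' s)

/-- `u` is the ray generator of the ray `ρ`: the primitive element of `N` that spans `ρ`. -/
def IsRayGenerator (N : Submodule ℤ V) (ρ : PointedCone ℝ V) (u : V) : Prop :=
  ρ = PointedCone.hull ℝ {u} ∧ u ∈ N ∧ u ≠ 0 ∧ ∀ t : ℝ, 0 < t → t • u ∈ N → 1 ≤ t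

/-- A fan in `V = N_ℝ` with respect to the lattice `N`. -/
structure Fan (N : Submodule ℤ V) where
  /-- the cones of the fan -/
  cones : Set (PointedCone ℝ V)
  finite : cones.Finite
  rational : ∀ τ ∈ cones, IsRationalPolyhedral N τ
  stronglyConvex : ∀ τ ∈ cones, IsStronglyConvex τ
  face_mem : ∀ η ∈ cones, ∀ τ, IsFace N τ η → τ ∈ cones
  inf_isFace : ∀ τ ∈ cones, ∀ η ∈ cones, IsFace N (τ ⊓ η) η

variable {N : Submodule ℤ V}

/-- In a fan, a cone that is contained in another one is a face of it. -/
lemma Fan.isFace_of_le (Ξ : Fan N) {τ η : PointedCone ℝ V} (hτ : τ ∈ Ξ.cones) (hη : η ∈ Ξ.cones)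
    (h : τ ≤ η) : IsFace N τ η := by
  simpa [inf_eq_left.mpr h] using Ξ.inf_isFace τ hτ η hη

/-- The fan is smooth. -/
def Fan.IsSmooth (Ξ : Fan N) : Prop := ∀ τ ∈ Ξ.cones, IsSmoothCone N τ

/-- The fan `Ξ` refines the cone `σ` (that is, the fan of all faces of `σ`): the union of its cones
is `σ`. -/
def Fan.Refines (Ξ : Fan N) (σ : PointedCone ℝ V) : Prop :=
  (∀ τ ∈ Ξ.cones, τ ≤ σ) ∧ ∀ v ∈ σ, ∃ τ ∈ Ξ.cones, v ∈ τ

/-- The set `Ξ(n)` of the cones of full dimension. -/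
def Fan.maxCones (Ξ : Fan N) : Set (PointedCone ℝ V) :=
  {η ∈ Ξ.cones | Submodule.span ℝ (η : Set V) = ⊤}

/-- The fan `Ξ_ρ` that consists of all the faces of the cones `η ∈ Ξ(n)` having `ρ` as a face. -/
def Fan.starFan (Ξ : Fan N) (ρ : PointedCone ℝ V) : Fan N where
  cones := {τ | ∃ η ∈ Ξ.maxCones, IsFace N ρ η ∧ IsFace N τ η}
  finite := Ξ.finite.subset fun τ ⟨η, hη, _, h⟩ => Ξ.face_mem η hη.1 τ h
  rational τ := fun ⟨η, hη, _, h⟩ => Ξ.rational τ (Ξ.face_mem η hη.1 τ h)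
  stronglyConvex τ := fun ⟨η, hη, _, h⟩ => Ξ.stronglyConvex τ (Ξ.face_mem η hη.1 τ h)
  face_mem := by
    rintro τ ⟨η, hη, hρ, h⟩ τ' h'
    have hτ := Ξ.face_mem η hη.1 τ h
    refine ⟨η, hη, hρ, Ξ.isFace_of_le (Ξ.face_mem τ hτ τ' h') hη.1 ?_⟩
    obtain ⟨m, -, rfl⟩ := h
    obtain ⟨m', -, rfl⟩ := h'
    exact inf_le_left.trans inf_le_left
  inf_isFace := by
    rintro τ ⟨η, hη, -, h⟩ τ' ⟨η', hη', -, h'⟩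
    exact Ξ.inf_isFace τ (Ξ.face_mem η hη.1 τ h) τ' (Ξ.face_mem η' hη'.1 τ' h')

lemma Fan.starFan_subset (Ξ : Fan N) (ρ : PointedCone ℝ V) :
    (Ξ.starFan ρ).cones ⊆ Ξ.cones :=
  fun τ ⟨η, hη, _, h⟩ => Ξ.face_mem η hη.1 τ h

end Cones

/-! ### Toric varieties -/

section Variety

variable {V : Type} [AddCommGroup V] [Module ℝ V] {N : Submodule ℤ V}

/-- The semigroup algebra `ℂ[τ^∨ ∩ M]`. -/
abbrev coordRing (N : Submodule ℤ V) (τ : PointedCone ℝ V) : Type :=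
  AddMonoidAlgebra ℂ (dualMonoid N τ)

/-- The inclusion `ℂ[η^∨ ∩ M] → ℂ[τ^∨ ∩ M]` for `τ ⊆ η`. -/
def coordMap (N : Submodule ℤ V) {τ η : PointedCone ℝ V} (h : τ ≤ η) :
    coordRing N η →ₐ[ℂ] coordRing N τ :=
  AddMonoidAlgebra.mapDomainAlgHom ℂ ℂ (AddSubmonoid.inclusion (dualMonoid_anti N h))

lemma coordMap_single {τ η : PointedCone ℝ V} (h : τ ≤ η) (m : dualMonoid N η) (c : ℂ) :
    coordMap N h (AddMonoidAlgebra.single m c) =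
      AddMonoidAlgebra.single (AddSubmonoid.inclusion (dualMonoid_anti N h) m) c := by
  simp [coordMap]

lemma coordMap_injective {τ η : PointedCone ℝ V} (h : τ ≤ η) :
    Function.Injective (coordMap N h) :=
  AddMonoidAlgebra.mapDomain_injective (AddSubmonoid.inclusion_injective _)

lemma exists_add_nsmul_mem {η : PointedCone ℝ V} (hη : IsRationalPolyhedral N η)
    {m : Module.Dual ℝ V} (hm : m ∈ dualMonoid N η) {x : Module.Dual ℝ V}
    (hx : x ∈ dualMonoid N (slice η m)) : ∃ k : ℕ, x + k • m ∈ dualMonoid N η := by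
  obtain ⟨s, hs, rfl⟩ := hη
  have key : ∀ u ∈ s, ∃ k : ℕ, ∀ l ≥ k, 0 ≤ x u + l * m u := by
    intro u hu
    have hu' : u ∈ PointedCone.hull ℝ (s : Set V) := Submodule.subset_span hu
    rcases (hm.2 u hu').eq_or_lt with h0 | h0
    · refine ⟨0, fun l _ => ?_⟩
      rw [← h0]
      simpa using hx.2 u (mem_slice.2 ⟨hu', h0.symm⟩)
    · obtain ⟨k, hk⟩ := exists_nat_gt (-(x u) / m u)
      refine ⟨k, fun l hl => ?_⟩
      rw [div_lt_iff₀ h0] at hk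
      have : (k : ℝ) * m u ≤ l * m u :=
        mul_le_mul_of_nonneg_right (by exact_mod_cast hl) h0.le
      linarith
  choose! k hk using key
  refine ⟨s.sup k, add_mem hx.1 (nsmul_mem hm.1 _), fun v hv => ?_⟩
  have : ∀ u ∈ (s : Set V), 0 ≤ (x + s.sup k • m) u := fun u hu => by
    simpa using hk u hu _ (Finset.le_sup hu)
  induction hv using Submodule.span_induction with
  | mem u hu => exact this u hu
  | zero => simp
  | add a b _ _ ha hb => rw [map_add]; exact add_nonneg ha hb
  | smul c a _ ha =>
    have : (x + s.sup k • m) (c • a) = (c : ℝ) * (x + s.sup k • m) a := by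
      change (x + s.sup k • m) ((c : ℝ) • a) = _
      rw [map_smul, smul_eq_mul]
    rw [this]
    exact mul_nonneg c.2 ha

/-- If `τ` is the face of `η` cut out by `m`, then `ℂ[τ^∨ ∩ M]` is the localization of
`ℂ[η^∨ ∩ M]` at the character `χ^m`. -/
lemma isLocalization_coordMap {τ η : PointedCone ℝ V} (hη : IsRationalPolyhedral N η)
    {m : Module.Dual ℝ V} (hm : m ∈ dualMonoid N η) (hτ : τ = slice η m) (h : τ ≤ η) :
    letI := (coordMap N h).toRingHom.toAlgebra
    IsLocalization.Away (AddMonoidAlgebra.single (⟨m, hm⟩ : dualMonoid N η) (1 : ℂ))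
      (coordRing N τ) := by
  let := (coordMap N h).toRingHom.toAlgebra
  have halg : ∀ a, algebraMap (coordRing N η) (coordRing N τ) a = coordMap N h a := fun _ => rfl
  have hneg : -m ∈ dualMonoid N τ := by
    refine ⟨neg_mem hm.1, fun v hv => ?_⟩
    rw [hτ] at hv
    simp [(mem_slice.1 hv).2]
  have hpow : ∀ k : ℕ, (AddMonoidAlgebra.single (⟨m, hm⟩ : dualMonoid N η) (1 : ℂ)) ^ k =
      AddMonoidAlgebra.single (k • (⟨m, hm⟩ : dualMonoid N η)) 1 := fun k => by
    rw [AddMonoidAlgebra.single_pow, one_pow]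
  refine (isLocalization_iff _ _).2 ⟨fun y => ?_, fun z => ?_, fun {x y} hxy => ?_⟩
  · obtain ⟨_, k, rfl⟩ := y
    rw [map_pow]
    refine IsUnit.pow _ (IsUnit.of_mul_eq_one (AddMonoidAlgebra.single (⟨-m, hneg⟩ :
      dualMonoid N τ) (1 : ℂ)) ?_)
    rw [halg, coordMap_single, AddMonoidAlgebra.single_mul_single, AddMonoidAlgebra.one_def]
    congr 1
    · ext; simp
    · simp
  · suffices H : ∃ k : ℕ, ∃ a : coordRing N η, z * coordMap N h
        (AddMonoidAlgebra.single (k • (⟨m, hm⟩ : dualMonoid N η)) 1) = coordMap N h a by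
      obtain ⟨k, a, ha⟩ := H
      exact ⟨⟨a, ⟨_, k, rfl⟩⟩, by simpa only [halg, hpow] using ha⟩
    induction z using AddMonoidAlgebra.induction_on with
    | of x =>
      obtain ⟨x, hx⟩ := x
      obtain ⟨k, hk⟩ := exists_add_nsmul_mem hη hm (hτ ▸ hx)
      refine ⟨k, AddMonoidAlgebra.single ⟨_, hk⟩ 1, ?_⟩
      rw [coordMap_single, coordMap_single]
      simp only [AddMonoidAlgebra.of_apply, toAdd_ofAdd, AddMonoidAlgebra.single_mul_single]
      congr 1
      simp
    | add z w hz hw =>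
      obtain ⟨k, a, ha⟩ := hz
      obtain ⟨l, b, hb⟩ := hw
      refine ⟨k + l, a * AddMonoidAlgebra.single (l • (⟨m, hm⟩ : dualMonoid N η)) 1 +
        b * AddMonoidAlgebra.single (k • (⟨m, hm⟩ : dualMonoid N η)) 1, ?_⟩
      rw [map_add, map_mul, map_mul, ← ha, ← hb, ← hpow, ← hpow, ← hpow, pow_add]
      simp only [map_mul]
      ring
    | smul c z hz =>
      obtain ⟨k, a, ha⟩ := hz
      exact ⟨k, c • a, by rw [smul_mul_assoc, ha, map_smul]⟩
  · exact ⟨1, by simpa using coordMap_injective h (by simpa [halg] using hxy)⟩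

namespace Fan

variable (Ξ : Fan N)

/-- The cones of the fan, as a partially ordered set. -/
abbrev Cone : Type := {τ : PointedCone ℝ V // τ ∈ Ξ.cones}

/-- The diagram of the affine toric varieties `U_τ = Spec ℂ[τ^∨ ∩ M]` of the cones of the fan. -/
def diagram : Ξ.Cone ⥤ Scheme.{0} where
  obj τ := Spec (.of (coordRing N τ.1))
  map {τ η} f := Spec.map (CommRingCat.ofHom (coordMap N f.le).toRingHom)
  map_id τ := by
    rw [← Spec.map_id]
    congr 1
    refine CommRingCat.hom_ext (RingHom.ext fun x => ?_)
    change coordMap N le_rfl x = x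
    induction x using AddMonoidAlgebra.induction_on with
    | of x => simp [coordMap_single]; rfl
    | add z w hz hw => rw [map_add, hz, hw]
    | smul c z hz => rw [map_smul, hz]
  map_comp {τ η ξ} f g := by
    rw [← Spec.map_comp]
    congr 1
    refine CommRingCat.hom_ext (RingHom.ext fun x => ?_)
    change coordMap N (f ≫ g).le x = coordMap N f.le (coordMap N g.le x)
    induction x using AddMonoidAlgebra.induction_on with
    | of x => simp [coordMap_single]; rfl
    | add z w hz hw => simp only [map_add, hz, hw]
    | smul c z hz => simp only [map_smul, hz]

lemma exists_eq_slice {τ η : Ξ.Cone} (h : τ ≤ η) :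
    ∃ m, ∃ hm : m ∈ dualMonoid N η.1, τ.1 = slice η.1 m ∧
      IsOpenImmersion (Ξ.diagram.map (homOfLE h)) ∧
      Set.range (Ξ.diagram.map (homOfLE h)) =
        (PrimeSpectrum.basicOpen (AddMonoidAlgebra.single (⟨m, hm⟩ : dualMonoid N η.1) (1 : ℂ)) :
          Set (PrimeSpectrum (coordRing N η.1))) := by
  obtain ⟨m, hm, hτ⟩ := Ξ.isFace_of_le τ.2 η.2 h
  let := (coordMap N (show τ.1 ≤ η.1 from h)).toRingHom.toAlgebra
  have := isLocalization_coordMap (Ξ.rational _ η.2) hm hτ h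
  refine ⟨m, hm, hτ, IsOpenImmersion.of_isLocalization
    (AddMonoidAlgebra.single (⟨m, hm⟩ : dualMonoid N η.1) (1 : ℂ)), ?_⟩
  exact PrimeSpectrum.localization_away_comap_range (coordRing N τ.1)
    (AddMonoidAlgebra.single (⟨m, hm⟩ : dualMonoid N η.1) (1 : ℂ))

instance isOpenImmersion_diagram_map {τ η : Ξ.Cone} (f : τ ⟶ η) :
    IsOpenImmersion (Ξ.diagram.map f) :=
  (Ξ.exists_eq_slice f.le).choose_spec.choose_spec.2.1

instance isLocallyDirected_diagram : (Ξ.diagram ⋙ Scheme.forget).IsLocallyDirected where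
  cond {i j k} fi fj xi xj hx := by
    obtain ⟨m, hm, hi, -, ri⟩ := Ξ.exists_eq_slice fi.le
    obtain ⟨m', hm', hj, -, rj⟩ := Ξ.exists_eq_slice fj.le
    let l : Ξ.Cone := ⟨i.1 ⊓ j.1, Ξ.face_mem _ j.2 _ (Ξ.inf_isFace _ i.2 _ j.2)⟩
    have hli : l ≤ i := inf_le_left (a := i.1)
    have hlj : l ≤ j := inf_le_right (a := i.1)
    have hx' : Ξ.diagram.map fi xi = Ξ.diagram.map fj xj := hx
    have hl : l.1 = slice k.1 (m + m') := by
      ext v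
      change v ∈ i.1 ∧ v ∈ j.1 ↔ _
      rw [hi, hj, mem_slice, mem_slice, mem_slice]
      constructor
      · rintro ⟨⟨h1, h2⟩, -, h3⟩
        exact ⟨h1, by simp [h2, h3]⟩
      · rintro ⟨h1, h2⟩
        have a := hm.2 v h1
        have b := hm'.2 v h1
        rw [LinearMap.add_apply] at h2
        exact ⟨⟨h1, by linarith⟩, h1, by linarith⟩
    have hlk : l ≤ k := hli.trans fi.le
    let := (coordMap N (show l.1 ≤ k.1 from hlk)).toRingHom.toAlgebra
    have := isLocalization_coordMap (Ξ.rational _ k.2) (add_mem hm hm') hl hlk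
    have hr : Set.range (Ξ.diagram.map (homOfLE hlk)) = _ :=
      PrimeSpectrum.localization_away_comap_range (coordRing N l.1)
        (AddMonoidAlgebra.single (⟨m + m', add_mem hm hm'⟩ : dualMonoid N k.1) (1 : ℂ))
    have e : (AddMonoidAlgebra.single (⟨m + m', add_mem hm hm'⟩ : dualMonoid N k.1) (1 : ℂ)) =
        AddMonoidAlgebra.single ⟨m, hm⟩ 1 * AddMonoidAlgebra.single ⟨m', hm'⟩ 1 := by
      rw [AddMonoidAlgebra.single_mul_single, one_mul]
      rfl
    rw [e, PrimeSpectrum.basicOpen_mul] at hr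
    have hmem : Ξ.diagram.map fi xi ∈ Set.range (Ξ.diagram.map (homOfLE hlk)) := by
      rw [hr]
      refine ⟨?_, ?_⟩
      · have : Ξ.diagram.map fi xi ∈ Set.range (Ξ.diagram.map (homOfLE fi.le)) := ⟨xi, rfl⟩
        rw [ri] at this
        exact this
      · have : Ξ.diagram.map fi xi ∈ Set.range (Ξ.diagram.map (homOfLE fj.le)) := ⟨xj, hx'.symm⟩
        rw [rj] at this
        exact this
    obtain ⟨x, hx1⟩ := hmem
    refine ⟨l, homOfLE hli, homOfLE hlj, x, ?_, ?_⟩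
    · apply (Ξ.diagram.map fi).isOpenEmbedding.injective
      change Ξ.diagram.map fi (Ξ.diagram.map (homOfLE hli) x) = _
      rw [← Scheme.Hom.comp_apply, ← Functor.map_comp]
      exact hx1
    · apply (Ξ.diagram.map fj).isOpenEmbedding.injective
      change Ξ.diagram.map fj (Ξ.diagram.map (homOfLE hlj) x) = _
      rw [← Scheme.Hom.comp_apply, ← Functor.map_comp]
      exact hx1.trans hx'

/-- The toric variety `X_Ξ` of the fan: the affine toric varieties `U_τ`, `τ ∈ Ξ`, glued along the
open immersions `U_τ → U_η` for `τ ≼ η`. -/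
def toricVariety : Scheme.{0} := colimit Ξ.diagram

/-- The open immersion `U_τ → X_Ξ`. -/
def chart (τ : Ξ.Cone) : Spec (.of (coordRing N τ.1)) ⟶ Ξ.toricVariety := colimit.ι Ξ.diagram τ

lemma chart_comp {τ η : Ξ.Cone} (f : τ ⟶ η) : Ξ.diagram.map f ≫ Ξ.chart η = Ξ.chart τ :=
  colimit.w Ξ.diagram f

/-- The structure morphism `X_Ξ → Spec ℂ`. -/
def structureMap : Ξ.toricVariety ⟶ Spec (.of ℂ) :=
  colimit.desc Ξ.diagram
    { pt := Spec (.of ℂ)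
      ι :=
        { app := fun τ => Spec.map (CommRingCat.ofHom (algebraMap ℂ (coordRing N τ.1)))
          naturality := fun τ η f => by
            change Spec.map _ ≫ Spec.map _ = Spec.map _ ≫ 𝟙 _
            rw [Category.comp_id, ← Spec.map_comp]
            congr 1
            ext x : 2
            exact (coordMap N f.le).commutes x } }

/-- The morphism `X_Θ → X_Ξ` for a subfan `Θ ⊆ Ξ`, the inclusion `U_τ ⊆ X_Ξ` on each chart. -/
def subfanMap {Θ Ξ : Fan N} (h : Θ.cones ⊆ Ξ.cones) : Θ.toricVariety ⟶ Ξ.toricVariety :=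
  colimit.desc Θ.diagram
    { pt := Ξ.toricVariety
      ι :=
        { app := fun τ => Ξ.chart ⟨τ.1, h τ.2⟩
          naturality := fun τ η f => by
            refine Eq.trans ?_ (Category.comp_id _).symm
            exact Ξ.chart_comp (τ := ⟨τ.1, h τ.2⟩) (η := ⟨η.1, h η.2⟩) (homOfLE f.le) } }

/-- The torus orbit `O(τ)`, as the closed subset of `U_τ` in which all the characters `χ^m` with
`m ∈ τ^∨ ∩ M`, `m ∉ τ^⊥`, vanish. -/
def orbit (τ : Ξ.Cone) : Set (Spec (.of (coordRing N τ.1))) :=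
  PrimeSpectrum.zeroLocus (R := coordRing N τ.1)
    {f | ∃ m : dualMonoid N τ.1, (∃ v ∈ τ.1, m.1 v ≠ 0) ∧ f = AddMonoidAlgebra.single m 1}

/-- The ideal sheaf of the orbit closure `V(τ) ⊆ X_Ξ` with its reduced structure. -/
def orbitIdeal (τ : Ξ.Cone) : Ξ.toricVariety.IdealSheafData :=
  Scheme.IdealSheafData.vanishingIdeal
    ⟨closure (Ξ.chart τ '' Ξ.orbit τ), isClosed_closure⟩

end Fan

end Variety

/-! ### Total spaces of bundles as relative spectra -/

section RelSpec

open Scheme.AffineZariskiSite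

variable {X : Scheme.{0}} {F : X.AffineZariskiSiteᵒᵖ ⥤ CommRingCat.{0}}
  {α : (toOpensFunctor X).op ⋙ X.presheaf ⟶ F}

/-- The relative spectrum `Spec_X F` of a quasi-coherent algebra `F`, given by its values on the
affine open subsets of `X`.  Quasi-coherence means `F(D(f)) = F(U)[1/f]` for `f ∈ Γ(X, U)`. -/
def relSpec (h : α.Coequifibered) : Scheme.{0} := (relativeGluingData h).glued

/-- The projection `Spec_X F → X`. -/
def relSpecMap (h : α.Coequifibered) : relSpec h ⟶ X := (relativeGluingData h).toBase

instance (h : α.Coequifibered) :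
    ((relativeGluingData h).functor ⋙ Scheme.forget).IsLocallyDirected :=
  Scheme.Cover.RelativeGluingData.instIsLocallyDirectedI₀CompFunctorForgetOfIsThin ..

/-- The open immersion `Spec F(U) → Spec_X F` for `U ⊆ X` open and affine. -/
def relSpecChart (h : α.Coequifibered) (U : X.AffineZariskiSite) :
    Spec (F.obj (.op U)) ⟶ relSpec h :=
  colimit.ι (relativeGluingData h).functor U

lemma relSpecChart_comp (h : α.Coequifibered) {U W : X.AffineZariskiSite} (i : U ⟶ W) :
    Spec.map (F.map i.op) ≫ relSpecChart h W = relSpecChart h U :=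
  colimit.w (relativeGluingData h).functor i

lemma relSpecLift_compat (h : α.Coequifibered) {T : Scheme.{0}} (f : T ⟶ X)
    (β : ∀ U : X.AffineZariskiSite, F.obj (.op U) ⟶ Γ(T, f ⁻¹ᵁ U.toOpens))
    (hβ : ∀ {U W : X.AffineZariskiSite} (i : U ⟶ W), F.map i.op ≫ β U =
      β W ≫ T.presheaf.map (homOfLE (f.preimage_mono (toOpens_mono i.le))).op)
    {U W : X.AffineZariskiSite} (i : U ⟶ W) (t : pullback f U.1.ι ⟶ pullback f W.1.ι)
    (ht : t ≫ pullback.fst f W.1.ι = pullback.fst f U.1.ι) :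
    t ≫ (pullbackRestrictIsoRestrict f W.1).hom ≫ (f ⁻¹ᵁ W.1).toSpecΓ ≫
      Spec.map (β W) ≫ relSpecChart h W =
    (pullbackRestrictIsoRestrict f U.1).hom ≫ (f ⁻¹ᵁ U.1).toSpecΓ ≫
      Spec.map (β U) ≫ relSpecChart h U := by
  have key : t ≫ (pullbackRestrictIsoRestrict f W.1).hom =
      (pullbackRestrictIsoRestrict f U.1).hom ≫
        T.homOfLE (f.preimage_mono (toOpens_mono i.le)) := by
    rw [← cancel_mono (Scheme.Opens.ι _)]
    simp [ht]
  rw [reassoc_of% key, ← Scheme.Opens.toSpecΓ_SpecMap_presheaf_map_assoc,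
    ← Spec.map_comp_assoc, ← hβ i, Spec.map_comp_assoc, relSpecChart_comp]

/-- The morphism `T → Spec_X F` that belongs to a morphism `f : T → X` and homomorphisms
`F(U) → Γ(T, f⁻¹(U))` compatible with restrictions. -/
def relSpecLift (h : α.Coequifibered) {T : Scheme.{0}} (f : T ⟶ X)
    (β : ∀ U : X.AffineZariskiSite, F.obj (.op U) ⟶ Γ(T, f ⁻¹ᵁ U.toOpens))
    (hβ : ∀ {U W : X.AffineZariskiSite} (i : U ⟶ W), F.map i.op ≫ β U =
      β W ≫ T.presheaf.map (homOfLE (f.preimage_mono (toOpens_mono i.le))).op) :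
    T ⟶ relSpec h :=
  Scheme.OpenCover.glueMorphismsOfLocallyDirected ((directedCover X).pullback₁ f)
    (fun U => (pullbackRestrictIsoRestrict f _).hom ≫ (f ⁻¹ᵁ U.1).toSpecΓ ≫
      Spec.map (β U) ≫ relSpecChart h U)
    (fun {U W} i => relSpecLift_compat h f β hβ (U := U) (W := W) i _
      (Scheme.Cover.trans_map ((directedCover X).pullback₁ f) i))

end RelSpec

section Sym

variable {A B C : Type} [CommRing A] [CommRing B] [CommRing C]
  {M M' : Type} [AddCommGroup M] [Module A M] [AddCommGroup M'] [Module B M']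

/-- The homomorphism `Sym_A M → Sym_B M'` induced by `φ : A → B` and a `φ`-linear `g : M → M'`. -/
def symMap (φ : A →+* B) (g : M →+ M') (hg : ∀ (a : A) (x : M), g (a • x) = φ a • g x) :
    SymmetricAlgebra A M →+* SymmetricAlgebra B M' :=
  letI : Algebra A (SymmetricAlgebra B M') :=
    ((algebraMap B (SymmetricAlgebra B M')).comp φ).toAlgebra
  (SymmetricAlgebra.lift (R := A) (A := SymmetricAlgebra B M')
    { toFun := fun x => SymmetricAlgebra.ι B M' (g x)
      map_add' := fun x y => by rw [map_add, map_add]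
      map_smul' := fun a x => by
        rw [hg, map_smul, Algebra.smul_def, Algebra.smul_def]
        rfl }).toRingHom

variable (φ : A →+* B) (g : M →+ M') (hg : ∀ (a : A) (x : M), g (a • x) = φ a • g x)

@[simp] lemma symMap_algebraMap (a : A) :
    symMap φ g hg (algebraMap A _ a) = algebraMap B _ (φ a) := by
  let : Algebra A (SymmetricAlgebra B M') :=
    ((algebraMap B (SymmetricAlgebra B M')).comp φ).toAlgebra
  exact AlgHom.commutes _ a

@[simp] lemma symMap_ι (x : M) :
    symMap φ g hg (SymmetricAlgebra.ι A M x) = SymmetricAlgebra.ι B M' (g x) := by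
  let : Algebra A (SymmetricAlgebra B M') :=
    ((algebraMap B (SymmetricAlgebra B M')).comp φ).toAlgebra
  exact SymmetricAlgebra.lift_ι_apply _ x

lemma sym_hom_ext {f g : SymmetricAlgebra A M →+* C}
    (h₁ : ∀ a, f (algebraMap A _ a) = g (algebraMap A _ a))
    (h₂ : ∀ x, f (SymmetricAlgebra.ι A M x) = g (SymmetricAlgebra.ι A M x)) : f = g := by
  refine RingHom.ext fun x => ?_
  induction x using SymmetricAlgebra.induction with
  | algebraMap a => exact h₁ a
  | ι x => exact h₂ x
  | mul a b ha hb => rw [map_mul, map_mul, ha, hb]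
  | add a b ha hb => rw [map_add, map_add, ha, hb]

end Sym

section Bundles

open Scheme.AffineZariskiSite

/-- The restriction homomorphism `Γ(X, W) → Γ(X, U)` for affine open subsets `U ⊆ W`. -/
abbrev res {X : Scheme.{0}} {U W : X.AffineZariskiSite} (h : U ≤ W) :
    Γ(X, W.toOpens) →+* Γ(X, U.toOpens) :=
  (X.presheaf.map (homOfLE (toOpens_mono h)).op).hom

/-- An `𝒪_X`-algebra `R` together with an `R`-module, given by their values on the affine open
subsets of `X` and the restriction maps.  The ring `R(U)` is `Γ(T, t⁻¹(U))` or is mapped to it, for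
the scheme `t : T → X` over which the module lives. -/
structure ModuleOver {X T : Scheme.{0}} (t : T ⟶ X) where
  /-- the rings `R(U)` -/
  ring : X.AffineZariskiSite → Type
  [commRing : ∀ U, CommRing (ring U)]
  /-- the restriction maps of `R` -/
  ringRes : ∀ {U W : X.AffineZariskiSite}, U ≤ W → (ring W →+* ring U)
  ringRes_id : ∀ (U : X.AffineZariskiSite) (r : ring U), ringRes (le_refl U) r = r
  ringRes_comp : ∀ {U W Z : X.AffineZariskiSite} (h : U ≤ W) (h' : W ≤ Z) (r : ring Z),
    ringRes h (ringRes h' r) = ringRes (h.trans h') r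
  /-- the structure homomorphisms `Γ(X, U) → R(U)` -/
  str : ∀ U : X.AffineZariskiSite, Γ(X, U.toOpens) →+* ring U
  str_res : ∀ {U W : X.AffineZariskiSite} (h : U ≤ W) (a : Γ(X, W.toOpens)),
    str U (res h a) = ringRes h (str W a)
  /-- the homomorphisms `R(U) → Γ(T, t⁻¹(U))` -/
  toSections : ∀ U : X.AffineZariskiSite, ring U →+* Γ(T, t ⁻¹ᵁ U.toOpens)
  toSections_res : ∀ {U W : X.AffineZariskiSite} (h : U ≤ W) (r : ring W),
    toSections U (ringRes h r) =
      T.presheaf.map (homOfLE (t.preimage_mono (toOpens_mono h))).op (toSections W r)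
  /-- the modules `M(U)` -/
  mod : X.AffineZariskiSite → Type
  [addCommGroup : ∀ U, AddCommGroup (mod U)]
  [module : ∀ U, Module (ring U) (mod U)]
  /-- the restriction maps of `M` -/
  modRes : ∀ {U W : X.AffineZariskiSite}, U ≤ W → (mod W →+ mod U)
  modRes_id : ∀ (U : X.AffineZariskiSite) (x : mod U), modRes (le_refl U) x = x
  modRes_comp : ∀ {U W Z : X.AffineZariskiSite} (h : U ≤ W) (h' : W ≤ Z) (x : mod Z),
    modRes h (modRes h' x) = modRes (h.trans h') x
  modRes_smul : ∀ {U W : X.AffineZariskiSite} (h : U ≤ W) (r : ring W) (x : mod W),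
    modRes h (r • x) = ringRes h r • modRes h x

attribute [instance] ModuleOver.commRing ModuleOver.addCommGroup ModuleOver.module

namespace ModuleOver

variable {X T : Scheme.{0}} {t : T ⟶ X} (M : ModuleOver t)

/-- The homomorphism `Sym_{R(W)} M(W) → Sym_{R(U)} M(U)` for `U ⊆ W`. -/
def symRes {U W : X.AffineZariskiSite} (h : U ≤ W) :
    CommRingCat.of (SymmetricAlgebra (M.ring W) (M.mod W)) ⟶
      CommRingCat.of (SymmetricAlgebra (M.ring U) (M.mod U)) :=
  CommRingCat.ofHom (symMap (M.ringRes h) (M.modRes h) (M.modRes_smul h))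

/-- The algebra `U ↦ Sym_{R(U)} M(U)`. -/
def sym : X.AffineZariskiSiteᵒᵖ ⥤ CommRingCat.{0} where
  obj U := .of (SymmetricAlgebra (M.ring U.unop) (M.mod U.unop))
  map f := M.symRes f.unop.le
  map_id U := CommRingCat.hom_ext (sym_hom_ext
    (fun a => (symMap_algebraMap _ _ (M.modRes_smul _) a).trans
      (congrArg _ (M.ringRes_id _ a)))
    (fun x => (symMap_ι _ _ (M.modRes_smul _) x).trans (congrArg _ (M.modRes_id _ x))))
  map_comp {U W Z} f g := CommRingCat.hom_ext (sym_hom_ext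
    (fun a => by
      simp only [symRes, CommRingCat.hom_ofHom, CommRingCat.hom_comp, RingHom.comp_apply,
        symMap_algebraMap, M.ringRes_comp])
    (fun x => by
      simp only [symRes, CommRingCat.hom_ofHom, CommRingCat.hom_comp, RingHom.comp_apply,
        symMap_ι, M.modRes_comp]))

/-- The structure homomorphism `Γ(X, U) → Sym_{R(U)} M(U)`. -/
def symStrHom (U : X.AffineZariskiSite) :
    Γ(X, U.toOpens) ⟶ CommRingCat.of (SymmetricAlgebra (M.ring U) (M.mod U)) :=
  CommRingCat.ofHom ((algebraMap (M.ring U) (SymmetricAlgebra (M.ring U) (M.mod U))).comp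
    (M.str U))

/-- The structure homomorphisms `Γ(X, U) → Sym_{R(U)} M(U)`, as a natural transformation. -/
def symStr : (toOpensFunctor X).op ⋙ X.presheaf ⟶ M.sym where
  app U := M.symStrHom U.unop
  naturality U W f := CommRingCat.hom_ext (RingHom.ext fun a => by
    change algebraMap _ _ (M.str W.unop (res f.unop.le a)) =
      symMap (M.ringRes f.unop.le) (M.modRes f.unop.le) (M.modRes_smul f.unop.le)
        (algebraMap _ _ (M.str U.unop a))
    rw [symMap_algebraMap]
    exact congrArg _ (M.str_res f.unop.le a))

/-- The homomorphism `Sym_{R(U)} M(U) → R(U) → Γ(T, t⁻¹(U))` that is zero on `M(U)`. -/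
def symZero (U : X.AffineZariskiSite) :
    CommRingCat.of (SymmetricAlgebra (M.ring U) (M.mod U)) ⟶ Γ(T, t ⁻¹ᵁ U.toOpens) :=
  CommRingCat.ofHom ((M.toSections U).comp
    (SymmetricAlgebra.algebraMapInv (R := M.ring U) (M := M.mod U)).toRingHom)

lemma symRes_symZero {U W : X.AffineZariskiSite} (h : U ≤ W) :
    M.symRes h ≫ M.symZero U =
      M.symZero W ≫ T.presheaf.map (homOfLE (t.preimage_mono (toOpens_mono h))).op := by
  refine CommRingCat.hom_ext (sym_hom_ext (fun a => ?_) fun x => ?_)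
  · change M.toSections U (SymmetricAlgebra.algebraMapInv
        (symMap (M.ringRes h) (M.modRes h) (M.modRes_smul h) (algebraMap _ _ a))) =
      T.presheaf.map _ (M.toSections W (SymmetricAlgebra.algebraMapInv (algebraMap _ _ a)))
    rw [symMap_algebraMap, AlgHom.commutes, AlgHom.commutes]
    exact M.toSections_res h a
  · change M.toSections U (SymmetricAlgebra.algebraMapInv
        (symMap (M.ringRes h) (M.modRes h) (M.modRes_smul h) (SymmetricAlgebra.ι _ _ x))) =
      T.presheaf.map _ (M.toSections W (SymmetricAlgebra.algebraMapInv (SymmetricAlgebra.ι _ _ x)))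
    rw [symMap_ι, SymmetricAlgebra.algebraMapInv_ι, SymmetricAlgebra.algebraMapInv_ι,
      map_zero, map_zero, map_zero]

/-- The module is quasi-coherent, in the form that its symmetric algebra is. -/
def IsQuasiCoherent : Prop := M.symStr.Coequifibered

variable {M}

/-- The total space `Spec_X Sym M`; its sections are the linear forms on `M`, so for a vector
bundle `E` with the module of sections `L` it is the total space of `E` when `M` is the dual
of `L`. -/
def tot (h : M.IsQuasiCoherent) : Scheme.{0} := relSpec h

/-- The projection of the total space to `X`. -/
def totMap (h : M.IsQuasiCoherent) : tot h ⟶ X := relSpecMap h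

/-- The zero section of the total space. -/
def zeroSection (h : M.IsQuasiCoherent) : T ⟶ tot h :=
  relSpecLift h t M.symZero (fun i => M.symRes_symZero i.le)

end ModuleOver

/-! ### The canonical bundle -/

section Canonical

variable {Y : Scheme.{0}} (s : Y ⟶ Spec (.of ℂ)) (d : ℕ)

/-- The ring `Γ(Y, U)` of a scheme `s : Y → Spec ℂ`, as an algebra over `ℂ`. -/
def Fn (_ : Y ⟶ Spec (.of ℂ)) (U : Y.AffineZariskiSite) : Type := Γ(Y, U.toOpens)

instance (U : Y.AffineZariskiSite) : CommRing (Fn s U) :=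
  inferInstanceAs (CommRing Γ(Y, U.toOpens))

instance (U : Y.AffineZariskiSite) : Algebra ℂ (Fn s U) :=
  RingHom.toAlgebra (S := Fn s U)
    ((Scheme.ΓSpecIso (.of ℂ)).inv ≫ s.appLE ⊤ U.toOpens le_top).hom

/-- The restriction homomorphism of functions. -/
def fnRes {U W : Y.AffineZariskiSite} (h : U ≤ W) : Fn s W →+* Fn s U := res h

lemma res_self {U : Y.AffineZariskiSite} (r : Γ(Y, U.toOpens)) : res (le_refl U) r = r := by
  change (Y.presheaf.map (𝟙 _)).hom r = r
  rw [Y.presheaf.map_id]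
  rfl

lemma res_res {U W Z : Y.AffineZariskiSite} (h : U ≤ W) (h' : W ≤ Z) (r : Γ(Y, Z.toOpens)) :
    res h (res h' r) = res (h.trans h') r := by
  rw [← RingHom.comp_apply, ← CommRingCat.hom_comp, ← Functor.map_comp]
  rfl

lemma fnRes_self {U : Y.AffineZariskiSite} (r : Fn s U) : fnRes s (le_refl U) r = r :=
  res_self (Y := Y) r

lemma fnRes_fnRes {U W Z : Y.AffineZariskiSite} (h : U ≤ W) (h' : W ≤ Z) (r : Fn s Z) :
    fnRes s h (fnRes s h' r) = fnRes s (h.trans h') r :=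
  res_res (Y := Y) h h' r

/-- The module `Γ(U, ω_Y) = ⋀^d Ω_{Γ(Y, U)/ℂ}` of the differential forms of degree `d` on the
affine open set `U`. -/
abbrev Forms (U : Y.AffineZariskiSite) : Type := ⋀[Fn s U]^d Ω[Fn s U⁄ℂ]

/-- The form `da₁ ∧ ⋯ ∧ da_d`. -/
def form {U : Y.AffineZariskiSite} (a : Fin d → Fn s U) : Forms s d U :=
  exteriorPower.ιMulti (Fn s U) d fun i => KaehlerDifferential.D ℂ (Fn s U) (a i)

/-- The linear maps `Γ(W, ω_Y) → Γ(Y, W)`, as a module over `Γ(Y, U)` for `W ⊆ U`. -/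
def FormsDual (U : Y.AffineZariskiSite) (W : {W : Y.AffineZariskiSite // W ≤ U}) : Type :=
  Forms s d W.1 →ₗ[Fn s W.1] Fn s W.1

instance (U : Y.AffineZariskiSite) (W : {W : Y.AffineZariskiSite // W ≤ U}) :
    AddCommGroup (FormsDual s d U W) :=
  inferInstanceAs (AddCommGroup (Forms s d W.1 →ₗ[Fn s W.1] Fn s W.1))

instance (U : Y.AffineZariskiSite) (W : {W : Y.AffineZariskiSite // W ≤ U}) :
    Module (Fn s U) (FormsDual s d U W) :=
  Module.compHom (Forms s d W.1 →ₗ[Fn s W.1] Fn s W.1) (fnRes s W.2)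

/-- The value of an element of `FormsDual` on a form. -/
def FormsDual.eval {U : Y.AffineZariskiSite} {W : {W : Y.AffineZariskiSite // W ≤ U}}
    (φ : FormsDual s d U W) (x : Forms s d W.1) : Fn s W.1 :=
  (show Forms s d W.1 →ₗ[Fn s W.1] Fn s W.1 from φ) x

variable {s d} in
lemma FormsDual.ext {U : Y.AffineZariskiSite} {W : {W : Y.AffineZariskiSite // W ≤ U}}
    {φ ψ : FormsDual s d U W} (h : ∀ x, φ.eval s d x = ψ.eval s d x) : φ = ψ :=
  LinearMap.ext h

lemma FormsDual.zero_eval {U : Y.AffineZariskiSite} {W : {W : Y.AffineZariskiSite // W ≤ U}}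
    (x : Forms s d W.1) : (0 : FormsDual s d U W).eval s d x = 0 :=
  LinearMap.zero_apply _

lemma FormsDual.add_eval {U : Y.AffineZariskiSite} {W : {W : Y.AffineZariskiSite // W ≤ U}}
    (φ ψ : FormsDual s d U W) (x : Forms s d W.1) :
    (φ + ψ).eval s d x = φ.eval s d x + ψ.eval s d x :=
  LinearMap.add_apply _ _ _

lemma FormsDual.smul_eval {U : Y.AffineZariskiSite} {W : {W : Y.AffineZariskiSite // W ≤ U}}
    (r : Fn s U) (φ : FormsDual s d U W) (x : Forms s d W.1) :
    (r • φ).eval s d x = fnRes s W.2 r * φ.eval s d x :=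
  rfl

/-- The sections over `U` of the dual `ℋom(ω_Y, 𝒪_Y)` of the sheaf of forms of degree `d`:
the families of linear maps `φ_W : Γ(W, ω_Y) → Γ(Y, W)` that commute with restriction.  As the forms
`da₁ ∧ ⋯ ∧ da_d` generate, it suffices to say this for them. -/
def dualForms (U : Y.AffineZariskiSite) :
    Submodule (Fn s U) (∀ W : {W : Y.AffineZariskiSite // W ≤ U}, FormsDual s d U W) where
  carrier := {φ | ∀ (W W' : {W : Y.AffineZariskiSite // W ≤ U}) (h : W'.1 ≤ W.1)
    (a : Fin d → Fn s W.1), (φ W').eval s d (form s d fun i => fnRes s h (a i)) =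
      fnRes s h ((φ W).eval s d (form s d a))}
  zero_mem' W W' h a := by
    rw [Pi.zero_apply, Pi.zero_apply, FormsDual.zero_eval, FormsDual.zero_eval, map_zero]
  add_mem' {φ ψ} hφ hψ W W' h a := by
    rw [Pi.add_apply, Pi.add_apply, FormsDual.add_eval, FormsDual.add_eval, map_add,
      hφ W W' h a, hψ W W' h a]
  smul_mem' r φ hφ W W' h a := by
    rw [Pi.smul_apply, Pi.smul_apply, FormsDual.smul_eval, FormsDual.smul_eval, map_mul,
      hφ W W' h a, fnRes_fnRes]

/-- The restriction map of the dual of the sheaf of forms. -/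
def dualFormsRes {U W : Y.AffineZariskiSite} (h : U ≤ W) : dualForms s d W →+ dualForms s d U where
  toFun φ := ⟨fun Z => φ.1 ⟨Z.1, Z.2.trans h⟩,
    fun Z Z' hZ a => φ.2 ⟨Z.1, Z.2.trans h⟩ ⟨Z'.1, Z'.2.trans h⟩ hZ a⟩
  map_zero' := rfl
  map_add' _ _ := rfl

lemma dualFormsRes_smul {U W : Y.AffineZariskiSite} (h : U ≤ W) (r : Fn s W)
    (φ : dualForms s d W) :
    dualFormsRes s d h (r • φ) = fnRes s h r • dualFormsRes s d h φ := by
  refine Subtype.ext (funext fun Z => FormsDual.ext fun y => ?_)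
  change fnRes s (Z.2.trans h) r * _ = fnRes s Z.2 (fnRes s h r) * _
  rw [fnRes_fnRes]
  rfl

/-- The dual of the sheaf `ω_Y = ⋀^d Ω_{Y/ℂ}` of forms of degree `d` on the scheme `Y` over `ℂ`.
For `Y` smooth of dimension `d` this is the dual of the canonical sheaf, so that the total space
of `dualCanonical` is the total space of the canonical bundle. -/
def dualCanonical : ModuleOver (𝟙 Y) where
  ring U := Fn s U
  ringRes h := fnRes s h
  ringRes_id _ r := fnRes_self s r
  ringRes_comp h h' r := fnRes_fnRes s h h' r
  str _ := RingHom.id _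
  str_res _ _ := rfl
  toSections _ := RingHom.id _
  toSections_res _ _ := rfl
  mod U := dualForms s d U
  modRes h := dualFormsRes s d h
  modRes_id _ _ := rfl
  modRes_comp _ _ _ := rfl
  modRes_smul h r x := dualFormsRes_smul s d h r x

end Canonical

/-! ### The normal bundle -/

section Normal

variable {X : Scheme.{0}} (I : X.IdealSheafData)

/-- The ideal of `Γ(X, U)` defined by an ideal sheaf. -/
def idealAt (U : X.AffineZariskiSite) : Ideal Γ(X, U.toOpens) := I.ideal ⟨U.1, U.2⟩

lemma idealAt_le {U W : X.AffineZariskiSite} (h : U ≤ W) :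
    idealAt I W ≤ (idealAt I U).comap (res h) :=
  I.ideal_le_comap_ideal (U := ⟨U.1, U.2⟩) (V := ⟨W.1, W.2⟩) (toOpens_mono h)

lemma subschemeι_app_eq_zero (U : X.AffineZariskiSite) (a : Γ(X, U.toOpens))
    (ha : a ∈ idealAt I U) : (I.subschemeι.app U.toOpens).hom a = 0 :=
  (I.ker_subschemeι_app ⟨U.1, U.2⟩).ge ha

/-- The homomorphism `I(W)/I(W)² → I(U)/I(U)²` for `U ⊆ W`. -/
def conormalRes {U W : X.AffineZariskiSite} (h : U ≤ W) :
    (idealAt I W).Cotangent →+ (idealAt I U).Cotangent :=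
  (Ideal.mapCotangent (R := ℤ) (idealAt I W) (idealAt I U)
    (RingHom.toIntAlgHom (res h)) (idealAt_le I h)).toAddMonoidHom

lemma conormalRes_mk {U W : X.AffineZariskiSite} (h : U ≤ W) (x : idealAt I W) :
    conormalRes I h ((idealAt I W).toCotangent x) =
      (idealAt I U).toCotangent ⟨res h x.1, idealAt_le I h x.2⟩ :=
  Ideal.mapCotangent_toCotangent _ _ _ _ _

/-- The conormal sheaf `I/I²` of the closed subscheme of `X` defined by the ideal sheaf `I`, with the
values `I(U)/I(U)²` over `Γ(X, U)/I(U)` for `U ⊆ X` open and affine.  Its total space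
`Spec Sym(I/I²)` is the normal bundle. -/
def conormal : ModuleOver I.subschemeι where
  ring U := Γ(X, U.toOpens) ⧸ idealAt I U
  ringRes {U W} h := Ideal.quotientMap _ (res h) (idealAt_le I h)
  ringRes_id U r := by
    obtain ⟨r, rfl⟩ := Ideal.Quotient.mk_surjective r
    rw [Ideal.quotientMap_mk, res_self]
  ringRes_comp h h' r := by
    obtain ⟨r, rfl⟩ := Ideal.Quotient.mk_surjective r
    rw [Ideal.quotientMap_mk, Ideal.quotientMap_mk, Ideal.quotientMap_mk, res_res]
  str U := Ideal.Quotient.mk (idealAt I U)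
  str_res h a := (Ideal.quotientMap_mk).symm
  toSections U := Ideal.Quotient.lift _ (I.subschemeι.app U.toOpens).hom
    (subschemeι_app_eq_zero I U)
  toSections_res {U W} h r := by
    obtain ⟨r, rfl⟩ := Ideal.Quotient.mk_surjective r
    rw [Ideal.quotientMap_mk, Ideal.Quotient.lift_mk, Ideal.Quotient.lift_mk]
    exact congr($(I.subschemeι.naturality (homOfLE (toOpens_mono h)).op) r)
  mod U := (idealAt I U).Cotangent
  modRes h := conormalRes I h
  modRes_id U x := by
    obtain ⟨x, rfl⟩ := Ideal.toCotangent_surjective _ x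
    rw [conormalRes_mk]
    exact congrArg _ (Subtype.ext (res_self x.1))
  modRes_comp {U W Z} h h' x := by
    obtain ⟨x, rfl⟩ := Ideal.toCotangent_surjective _ x
    rw [conormalRes_mk, conormalRes_mk, conormalRes_mk]
    exact congrArg _ (Subtype.ext (res_res h h' x.1))
  modRes_smul {U W} h r x := by
    obtain ⟨r, rfl⟩ := Ideal.Quotient.mk_surjective r
    obtain ⟨x, rfl⟩ := Ideal.toCotangent_surjective _ x
    change conormalRes I h (r • (idealAt I W).toCotangent x) =
      (res h r) • conormalRes I h ((idealAt I W).toCotangent x)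
    rw [← map_smul, conormalRes_mk, conormalRes_mk, ← map_smul]
    exact congrArg _ (Subtype.ext (map_mul (res h) r x.1))

end Normal

end Bundles

/-! ### Normally embedded closed subschemes -/

/-- The closed subscheme `E` with the ideal sheaf `I` is normally embedded in the scheme
`s : X → Spec ℂ`: there are an open neighbourhood `U₀` of the zero section `E → N_{E/X}` in the total
space of the normal bundle and an open immersion `j : U₀ → X` over `ℂ` (that is, an isomorphism of
`U₀` onto an open neighbourhood of `E`) which is the identity on `E`. -/
def IsNormallyEmbedded {X : Scheme.{0}} (s : X ⟶ Spec (.of ℂ)) (I : X.IdealSheafData) : Prop :=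
  ∃ (h : (conormal I).IsQuasiCoherent) (U₀ : (ModuleOver.tot h).Opens)
    (z₀ : I.subscheme ⟶ U₀.toScheme) (j : U₀.toScheme ⟶ X),
    z₀ ≫ U₀.ι = ModuleOver.zeroSection h ∧ IsOpenImmersion j ∧ z₀ ≫ j = I.subschemeι ∧
      j ≫ s = U₀.ι ≫ ModuleOver.totMap h ≫ s

/-! ### Torus-invariant divisors and crepant resolutions -/

section Crepant

variable {V : Type} [AddCommGroup V] [Module ℝ V]

/-- The ray generators of a set of cones. -/
def rayGenerators (N : Submodule ℤ V) (S : Set (PointedCone ℝ V)) : Set V :=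
  {u | ∃ ρ ∈ S, IsRayGenerator N ρ u}

/-- The torus-invariant divisors `∑ a_ρ D_ρ` of the toric variety whose cones are given. -/
abbrev TorusDivisor (N : Submodule ℤ V) (S : Set (PointedCone ℝ V)) : Type :=
  rayGenerators N S → ℤ

/-- The canonical divisor `-∑ D_ρ` of a toric variety. -/
def canonicalDivisor (N : Submodule ℤ V) (S : Set (PointedCone ℝ V)) : TorusDivisor N S :=
  fun _ => -1

/-- The divisor `div(χ^m) = ∑ ⟨m, u_ρ⟩ D_ρ` of the character `χ^m`, `m ∈ M`. -/
def charDivisor (N : Submodule ℤ V) (S : Set (PointedCone ℝ V)) (m : Module.Dual ℝ V) :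
    TorusDivisor N S :=
  fun u => ⌊m u.1⌋

/-- The toric morphism `φ : X_Ξ → U_σ` of a refinement is crepant, `K_{X_Ξ} = φ^* K_{U_σ}`: for some
`m ∈ M` the canonical divisor of `U_σ` is `div(χ^{-m})`, and the canonical divisor of `X_Ξ` is the
pullback of this divisor, which is the divisor of `χ^{-m}` on `X_Ξ`. -/
def IsCrepant {N : Submodule ℤ V} (Ξ : Fan N) (σ : PointedCone ℝ V) : Prop :=
  ∃ m ∈ dualLattice N,
    canonicalDivisor N {τ | IsFace N τ σ} = charDivisor N {τ | IsFace N τ σ} (-m) ∧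
      canonicalDivisor N Ξ.cones = charDivisor N Ξ.cones (-m)

end Crepant

/-! ### Finite abelian subgroups of `SL(n, ℂ)` -/

section Group

variable {n : ℕ}

/-- The matrix of `g` in the coordinates given by `P`. -/
def conj (P : GL (Fin n) ℂ) (g : Matrix.SpecialLinearGroup (Fin n) ℂ) :
    Matrix (Fin n) (Fin n) ℂ :=
  (P : Matrix (Fin n) (Fin n) ℂ) * (g : Matrix (Fin n) (Fin n) ℂ) *
    ((P⁻¹ : GL (Fin n) ℂ) : Matrix (Fin n) (Fin n) ℂ)

variable (G : Subgroup (Matrix.SpecialLinearGroup (Fin n) ℂ)) (P : GL (Fin n) ℂ) (ε : ℂ)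

/-- The fractional expression `ĝ = (a₁, …, a_n)/r` of `g = diag(ε^{a₁}, …, ε^{a_n})`, where
`r = |G|`, `0 ≤ a_i < r`, and `ε` is a primitive `r`-th root of `1`. -/
def frac (g : Matrix.SpecialLinearGroup (Fin n) ℂ) : Fin n → ℝ :=
  fun i => (sInf {a : ℕ | ε ^ a = conj P g i i} : ℕ) / (Nat.card G : ℝ)

/-- The age of `g`. -/
def age (g : Matrix.SpecialLinearGroup (Fin n) ℂ) : ℝ := ∑ i, frac G P ε g i

/-- The lattice `N = ℤⁿ + ∑_{g ∈ G} ℤ ĝ`. -/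
def lattice : Submodule ℤ (Fin n → ℝ) :=
  Submodule.span ℤ (Set.range (fun i : Fin n => (Pi.single i 1 : Fin n → ℝ)) ∪
    frac G P ε '' (G : Set (Matrix.SpecialLinearGroup (Fin n) ℂ)))

/-- The cone `σ = Cone(e₁, …, e_n)`; the affine toric variety of `σ` and the lattice `N` is
`ℂⁿ/G`. -/
def orthant (n : ℕ) : PointedCone ℝ (Fin n → ℝ) :=
  PointedCone.hull ℝ (Set.range fun i : Fin n => (Pi.single i 1 : Fin n → ℝ))

/-- The ray `ρ_g = Cone(ĝ)`. -/
def ray (g : Matrix.SpecialLinearGroup (Fin n) ℂ) : PointedCone ℝ (Fin n → ℝ) :=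
  PointedCone.hull ℝ {frac G P ε g}

/-- The fan `Ξ` defines a toric crepant resolution `X_Ξ → U_{σ,N} = ℂⁿ/G`. -/
def IsCrepantResolution (Ξ : Fan (lattice G P ε)) : Prop :=
  Ξ.IsSmooth ∧ Ξ.Refines (orthant n) ∧ IsCrepant Ξ (orthant n)

variable {G P ε}

/-- The ideal sheaf of the exceptional divisor `E_g = V(ρ_g) ⊆ X_Ξ`. -/
def excIdeal (Ξ : Fan (lattice G P ε)) (g : Matrix.SpecialLinearGroup (Fin n) ℂ)
    (hg : ray G P ε g ∈ Ξ.cones) : Ξ.toricVariety.IdealSheafData :=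
  Ξ.orbitIdeal ⟨ray G P ε g, hg⟩

/-- The exceptional divisor `E_g`. -/
abbrev exc (Ξ : Fan (lattice G P ε)) (g : Matrix.SpecialLinearGroup (Fin n) ℂ)
    (hg : ray G P ε g ∈ Ξ.cones) : Scheme.{0} := (excIdeal Ξ g hg).subscheme

/-- The inclusion `E_g → X_Ξ`. -/
abbrev excι (Ξ : Fan (lattice G P ε)) (g : Matrix.SpecialLinearGroup (Fin n) ℂ)
    (hg : ray G P ε g ∈ Ξ.cones) : exc Ξ g hg ⟶ Ξ.toricVariety := (excIdeal Ξ g hg).subschemeι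

/-- The fan `Ξ_g`. -/
abbrev fanAt (Ξ : Fan (lattice G P ε)) (g : Matrix.SpecialLinearGroup (Fin n) ℂ) :
    Fan (lattice G P ε) := Ξ.starFan (ray G P ε g)

/-- The morphism `X_{Ξ_g} → X_Ξ`. -/
abbrev fanAtι (Ξ : Fan (lattice G P ε)) (g : Matrix.SpecialLinearGroup (Fin n) ℂ) :
    (fanAt Ξ g).toricVariety ⟶ Ξ.toricVariety := Fan.subfanMap (Ξ.starFan_subset (ray G P ε g))

/-- The dual of the canonical sheaf `ω_{E_g}` of the `(n - 1)`-dimensional variety `E_g`; its total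
space `tot` is the total space of the canonical bundle of `E_g`. -/
abbrev excDualCanonical (Ξ : Fan (lattice G P ε)) (g : Matrix.SpecialLinearGroup (Fin n) ℂ)
    (hg : ray G P ε g ∈ Ξ.cones) : ModuleOver (𝟙 (exc Ξ g hg)) :=
  dualCanonical (excι Ξ g hg ≫ Ξ.structureMap) (n - 1)

end Group

end

end Toric

/-! Write `v` for `ĝ` with `g` junior, and let `κ` be the sum of the coordinates. Elements of `G`
have determinant one, so `κ` is integral on `N` (`coordSum_mem_dualLattice`), and crepancy forces `κ
= 1` on every ray generator of `Ξ` (`coordSum_eq_one`). A cone of `Ξ` is spanned by a part of a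
lattice basis whose members have height one. A lattice point of height one in it has nonnegative
integral coordinates with sum one, so it is one of the generators
(`IsLatticeBasis.exists_eq_of_apply_eq_one`). Hence `v` spans a ray of `Ξ` and is a basis vector in
every cone that contains it. The cones of full dimension cover the orthant
(`exists_maxCone_of_mem`), so every cone containing `v` belongs to `Ξ_g`; the charts of these cones
cover both `E_g` and `X_{Ξ_g}`.

On such a chart the pairing with `v` grades `ℂ[τ^∨ ∩ M]` by natural numbers, and the ideal `I` of
`E_g` is the part of positive degree. The coordinate `m₁` dual to `v` gives a generator `χ^{m₁}` of
`I`, and the chart ring is a polynomial ring in `χ^{m₁}` over its part of degree zero, that is,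
`Sym(I/I²)` (`exists_symEquiv`). So the whole of the normal bundle is `X_{Ξ_g}`
(`exists_tot_conormal_iso`), which is open in `X_Ξ`; this gives the normal embedding.

The canonical bundle is compared with the normal bundle by adjunction for a trivial canonical class,
made explicit. Fix a basis `c` of the ambient space with `c 0 = v`, and let `δ_k` be the derivation
`χ^m ↦ ⟨m, c_k⟩ χ^m`. A conormal element `x` is sent to the linear form `dβ₁ ∧ ⋯ ∧ dβ_d ↦ χ^{-κ} x
det(δ_k β_i)`. In the coordinates of a chart the generator `χ^{m₁}` has on the generating form the
value `C χ^μ`, where `C` is a nonzero constant and `μ` vanishes on the cone because `κ` is one on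
its generators. So the value is a unit and the map is bijective (`exists_equiv_forms_chart`,
`exists_tot_dualCanonical_iso`).

All local isomorphisms are described inside one ring, the group algebra `torusRing V`, by formulas
that do not depend on the chart. Compatibility with restriction then follows from injectivity of the
embeddings, and `IsGluing.exists_iso` produces the global isomorphisms.

For the covering, a cone of full dimension with only unit vectors as generators would give `N = ℤⁿ`
and `G` trivial. Otherwise some generator is not a unit vector, and a lattice point of the orthant
of height one that is not a unit vector is a junior `ĝ` (`exists_junior_of_mem`). -/

open AlgebraicGeometry CategoryTheory CategoryTheory.Limits

noncomputable section

namespace Toric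

/-! ### Gluing along a diagram of open subschemes -/

/-- The scheme `X` is glued from the diagram `D` along the morphisms `a j : D j ⟶ X`. -/
structure IsGluing {J : Type} [Preorder J] (D : J ⥤ Scheme.{0}) {X : Scheme.{0}}
    (a : ∀ j, D.obj j ⟶ X) : Prop where
  nat : ∀ {i j : J} (h : i ⟶ j), D.map h ≫ a j = a i
  isOpenImmersion : ∀ j, IsOpenImmersion (a j)
  surj : ∀ x : X, ∃ j, x ∈ Set.range (a j)
  inter : ∀ {i j : J} (x : X), x ∈ Set.range (a i) → x ∈ Set.range (a j) →
    ∃ k, k ≤ i ∧ k ≤ j ∧ x ∈ Set.range (a k)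

section Gluing

variable {J : Type} [Preorder J] {D : J ⥤ Scheme.{0}} {X Y : Scheme.{0}}
  {a : ∀ j, D.obj j ⟶ X} {b : ∀ j, D.obj j ⟶ Y}

/-- Openness of the map and bijectivity on stalks are local on the source; only injectivity is a
global condition. -/
lemma isOpenImmersion_of_forall {X Y : Scheme.{0}} (f : X ⟶ Y) (hf : Function.Injective f)
    (H : ∀ x : X, ∃ (Z : Scheme.{0}) (g : Z ⟶ X), IsOpenImmersion g ∧ x ∈ Set.range g ∧
      IsOpenImmersion (g ≫ f)) : IsOpenImmersion f := by
  have hopen : IsOpenMap f := by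
    refine isOpenMap_iff_nhds_le.2 fun x => ?_
    obtain ⟨Z, g, hg, ⟨z, rfl⟩, hgf⟩ := H x
    rw [← g.isOpenEmbedding.map_nhds_eq, Filter.map_map]
    exact (g ≫ f).isOpenEmbedding.isOpenMap.nhds_le z
  have : ∀ x, IsIso (f.stalkMap x) := by
    intro x
    obtain ⟨Z, g, hg, ⟨z, rfl⟩, hgf⟩ := H x
    have e := Scheme.Hom.stalkMap_comp g f z
    have h1 : IsIso ((g ≫ f).stalkMap z) := inferInstance
    rw [e] at h1
    exact @IsIso.of_isIso_comp_right _ _ _ _ _ (f.stalkMap (g z)) (g.stalkMap z) inferInstance h1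
  exact IsOpenImmersion.of_isIso_stalkMap f
    (.of_continuous_injective_isOpenMap f.continuous hf hopen)

/-- The open cover that belongs to a gluing. -/
def IsGluing.cover (ha : IsGluing D a) : X.OpenCover where
  I₀ := J
  X j := D.obj j
  f j := a j
  mem₀ := by
    rw [Scheme.presieve₀_mem_precoverage_iff]
    exact ⟨fun x => ha.surj x, ha.isOpenImmersion⟩

lemma IsGluing.hom_ext (ha : IsGluing D a) {Z : Scheme.{0}} {f g : X ⟶ Z}
    (h : ∀ j, a j ≫ f = a j ≫ g) : f = g :=
  ha.cover.hom_ext _ _ h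

/-- The condition `inter` covers the overlap of two pieces by pieces `D k` with `k` below both
indices, and there both candidates restrict to `f k`. -/
lemma IsGluing.exists_desc (ha : IsGluing D a) {Z : Scheme.{0}} (f : ∀ j, D.obj j ⟶ Z)
    (hf : ∀ {i j : J} (h : i ⟶ j), D.map h ≫ f j = f i) :
    ∃ g : X ⟶ Z, ∀ j, a j ≫ g = f j := by
  have := ha.isOpenImmersion
  refine ⟨ha.cover.glueMorphisms f ?_, fun j => ha.cover.ι_glueMorphisms f _ j⟩
  intro (i : J) (j : J)
  change pullback.fst (a i) (a j) ≫ f i = pullback.snd (a i) (a j) ≫ f j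
  refine Scheme.hom_ext_of_forall _ _ fun x => ?_
  obtain ⟨k, hi, hj, y, hy⟩ := ha.inter ((pullback.fst (a i) (a j) ≫ a i) x)
    ⟨pullback.fst (a i) (a j) x, rfl⟩
    ⟨pullback.snd (a i) (a j) x, by rw [pullback.condition]; rfl⟩
  -- `D k` is an open piece of the overlap that contains the given point; equality of the two
  -- morphisms is checked on its image.
  let l : D.obj k ⟶ pullback (a i) (a j) := pullback.lift (D.map (homOfLE hi)) (D.map (homOfLE hj))
    (by rw [ha.nat, ha.nat])
  have hl : l ≫ pullback.fst (a i) (a j) ≫ a i = a k := by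
    rw [pullback.lift_fst_assoc, ha.nat]
  have : IsOpenImmersion l := by
    have : IsOpenImmersion (l ≫ pullback.fst (a i) (a j) ≫ a i) := by rw [hl]; infer_instance
    exact .of_comp l (pullback.fst (a i) (a j) ≫ a i)
  refine ⟨l.opensRange, ⟨y, ?_⟩, ?_⟩
  · apply (pullback.fst (a i) (a j) ≫ a i).isOpenEmbedding.injective
    rw [← hy, ← hl]
    rfl
  · rw [← cancel_epi l.isoOpensRange.hom]
    simp only [Scheme.Hom.isoOpensRange_hom_ι_assoc, l]
    rw [pullback.lift_fst_assoc, pullback.lift_snd_assoc, hf, hf]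

/-- Two schemes glued from the same diagram are isomorphic. -/
lemma IsGluing.exists_iso (ha : IsGluing D a) (hb : IsGluing D b) :
    ∃ e : X ≅ Y, ∀ j, a j ≫ e.hom = b j := by
  obtain ⟨f, hf⟩ := ha.exists_desc b hb.nat
  obtain ⟨g, hg⟩ := hb.exists_desc a ha.nat
  refine ⟨⟨f, g, ha.hom_ext fun j => ?_, hb.hom_ext fun j => ?_⟩, hf⟩
  · rw [reassoc_of% hf, hg, Category.comp_id]
  · rw [reassoc_of% hg, hf, Category.comp_id]

/-- A gluing may be transported along an isomorphism of diagrams. -/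
lemma IsGluing.comp_natIso (ha : IsGluing D a) {D' : J ⥤ Scheme.{0}} (e : D' ≅ D) :
    IsGluing D' (fun j => e.hom.app j ≫ a j) where
  nat h := by rw [NatTrans.naturality_assoc, ha.nat]
  isOpenImmersion j := by
    have := ha.isOpenImmersion j
    infer_instance
  surj x := by
    obtain ⟨j, y, rfl⟩ := ha.surj x
    exact ⟨j, e.inv.app j y, by rw [← Scheme.Hom.comp_apply]; simp⟩
  inter {i j} x := by
    have key : ∀ j, Set.range (e.hom.app j ≫ a j) = Set.range (a j) := fun j => by
      ext x
      constructor
      · rintro ⟨y, rfl⟩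
        exact ⟨e.hom.app j y, rfl⟩
      · rintro ⟨y, rfl⟩
        exact ⟨e.inv.app j y, by rw [← Scheme.Hom.comp_apply]; simp⟩
    simp only [key]
    exact ha.inter x

end Gluing

/-! ### Relative spectra -/

section RelSpec

open Scheme.AffineZariskiSite

variable {X : Scheme.{0}} {F : X.AffineZariskiSiteᵒᵖ ⥤ CommRingCat.{0}}
  {α : (toOpensFunctor X).op ⋙ X.presheaf ⟶ F}

instance (h : α.Coequifibered) (U : X.AffineZariskiSite) : IsOpenImmersion (relSpecChart h U) :=
  inferInstanceAs (IsOpenImmersion (colimit.ι (relativeGluingData h).functor U))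

lemma relSpecChart_relSpecMap (h : α.Coequifibered) (U : X.AffineZariskiSite) :
    relSpecChart h U ≫ relSpecMap h = Spec.map (α.app (.op U)) ≫ U.2.fromSpec := by
  refine ((relativeGluingData h).ι_toBase U).trans ?_
  simp only [relativeGluingData]
  rfl

lemma preimage_relSpecMap (h : α.Coequifibered) (U : X.AffineZariskiSite) :
    relSpecMap h ⁻¹' U.1 = Set.range (relSpecChart h U) := by
  refine Eq.trans ?_ ((relativeGluingData h).preimage_toBase_eq_range_ι U)
  change _ = _ ⁻¹' Set.range U.1.ι
  rw [Scheme.Opens.range_ι]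
  rfl

/-- The spectra of the values of `F` on a family of affine open sets that covers the image of
`Spec_X F` glue to `Spec_X F`. -/
lemma isGluing_relSpec (h : α.Coequifibered) {J : Type} [Preorder J]
    (U : J ⥤ X.AffineZariskiSite)
    (hs : ∀ p : relSpec h, ∃ j, relSpecMap h p ∈ (U.obj j).1)
    (hi : ∀ (p : relSpec h) (i j : J), relSpecMap h p ∈ (U.obj i).1 →
      relSpecMap h p ∈ (U.obj j).1 → ∃ k, k ≤ i ∧ k ≤ j ∧ relSpecMap h p ∈ (U.obj k).1) :
    IsGluing (U ⋙ F.rightOp ⋙ Scheme.Spec) (fun j => relSpecChart h (U.obj j)) where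
  nat f := relSpecChart_comp h (U.map f)
  isOpenImmersion j := inferInstance
  surj p := by
    obtain ⟨j, hj⟩ := hs p
    exact ⟨j, (preimage_relSpecMap h _).le hj⟩
  inter {i j} p h1 h2 := by
    obtain ⟨k, hk1, hk2, hk⟩ := hi p i j ((preimage_relSpecMap h _).ge h1)
      ((preimage_relSpecMap h _).ge h2)
    exact ⟨k, hk1, hk2, (preimage_relSpecMap h _).le hk⟩

lemma ι_relSpecLift (h : α.Coequifibered) {T : Scheme.{0}} (f : T ⟶ X)
    (β : ∀ U : X.AffineZariskiSite, F.obj (.op U) ⟶ Γ(T, f ⁻¹ᵁ U.toOpens))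
    (hβ : ∀ {U W : X.AffineZariskiSite} (i : U ⟶ W), F.map i.op ≫ β U =
      β W ≫ T.presheaf.map (homOfLE (f.preimage_mono (toOpens_mono i.le))).op)
    (U : X.AffineZariskiSite) :
    (f ⁻¹ᵁ U.1).ι ≫ relSpecLift h f β hβ =
      (f ⁻¹ᵁ U.1).toSpecΓ ≫ Spec.map (β U) ≫ relSpecChart h U := by
  rw [← cancel_epi (pullbackRestrictIsoRestrict f U.1).hom, pullbackRestrictIsoRestrict_hom_ι_assoc]
  exact Scheme.OpenCover.map_glueMorphismsOfLocallyDirected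
    ((directedCover X).pullback₁ f) _
    (fun {U W} i => relSpecLift_compat h f β hβ (U := U) (W := W) i _
      (Scheme.Cover.trans_map ((directedCover X).pullback₁ f) i)) U

end RelSpec

/-! ### Symmetric algebras and localization -/

section SymLocalization

variable {A B M M' : Type} [CommRing A] [CommRing B] [Algebra A B] [AddCommGroup M] [Module A M]
  [AddCommGroup M'] [Module B M'] [Module A M'] [IsScalarTower A B M']

/-- The symmetric algebra commutes with base change. -/
lemma isPushout_symMap (g : M →ₗ[A] M') (hg : IsBaseChange B g)
    (hg' : ∀ (a : A) (x : M), g.toAddMonoidHom (a • x) = algebraMap A B a • g.toAddMonoidHom x) :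
    IsPushout (CommRingCat.ofHom (algebraMap A B))
      (CommRingCat.ofHom (algebraMap A (SymmetricAlgebra A M)))
      (CommRingCat.ofHom (algebraMap B (SymmetricAlgebra B M')))
      (CommRingCat.ofHom (symMap (algebraMap A B) g.toAddMonoidHom hg')) := by
  refine IsPushout.of_isColimit' ⟨?_⟩ (PushoutCocone.IsColimit.mk _ (fun s => ?_) (fun s => ?_)
    (fun s => ?_) fun s m h1 h2 => ?_)
  · ext a
    exact (symMap_algebraMap _ _ hg' a).symm
  -- The test ring is a `B`-algebra through `s.inl`. The restriction of `s.inr` to `M` is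
  -- `A`-linear, extends to `M'` by base change, and then to the symmetric algebra.
  · let i1 : Algebra B s.pt := s.inl.hom.toAlgebra
    let i2 : Algebra A s.pt := (s.inl.hom.comp (algebraMap A B)).toAlgebra
    have : IsScalarTower A B s.pt := .of_algebraMap_eq' rfl
    have hc : ∀ a, s.inr.hom (algebraMap A _ a) = algebraMap A s.pt a := fun a =>
      congr($(s.condition).hom a).symm
    let l : M →ₗ[A] s.pt :=
      { toFun := fun x => s.inr.hom (SymmetricAlgebra.ι A M x)
        map_add' := fun x y => by rw [map_add, map_add]
        map_smul' := fun a x => by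
          rw [map_smul, Algebra.smul_def, map_mul, hc, RingHom.id_apply, Algebra.smul_def] }
    exact CommRingCat.ofHom (SymmetricAlgebra.lift (hg.lift l)).toRingHom
  · ext b
    let i1 : Algebra B s.pt := s.inl.hom.toAlgebra
    exact AlgHom.commutes _ b
  · let i1 : Algebra B s.pt := s.inl.hom.toAlgebra
    let i2 : Algebra A s.pt := (s.inl.hom.comp (algebraMap A B)).toAlgebra
    have : IsScalarTower A B s.pt := .of_algebraMap_eq' rfl
    refine CommRingCat.hom_ext (sym_hom_ext (fun a => ?_) fun x => ?_)
    · have hc : s.inr.hom (algebraMap A _ a) = s.inl.hom (algebraMap A B a) :=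
        congr($(s.condition).hom a).symm
      rw [hc, CommRingCat.hom_comp, RingHom.comp_apply]
      exact (congrArg _ (symMap_algebraMap _ _ hg' a)).trans (AlgHom.commutes _ _)
    · rw [CommRingCat.hom_comp, RingHom.comp_apply]
      refine (congrArg _ (symMap_ι _ _ hg' x)).trans ?_
      refine (SymmetricAlgebra.lift_ι_apply _ _).trans ?_
      exact hg.lift_eq _ x
  · let i1 : Algebra B s.pt := s.inl.hom.toAlgebra
    let i2 : Algebra A s.pt := (s.inl.hom.comp (algebraMap A B)).toAlgebra
    have : IsScalarTower A B s.pt := .of_algebraMap_eq' rfl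
    have hm1 : ∀ b, m.hom (algebraMap B _ b) = s.inl.hom b := fun b => congr($(h1).hom b)
    refine CommRingCat.hom_ext (sym_hom_ext (fun b => ?_) fun x => ?_)
    · exact (hm1 b).trans (AlgHom.commutes _ b).symm
    · refine Eq.trans ?_ (SymmetricAlgebra.lift_ι_apply _ _).symm
      let l : M' →ₗ[B] s.pt :=
        { toFun := fun x => m.hom (SymmetricAlgebra.ι B M' x)
          map_add' := fun x y => by rw [map_add, map_add]
          map_smul' := fun a x => by
            rw [map_smul, Algebra.smul_def, map_mul, hm1, RingHom.id_apply, Algebra.smul_def]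
            rfl }
      refine congrFun (congrArg DFunLike.coe (hg.algHom_ext l _ fun y => ?_)) x
      rw [hg.lift_eq]
      refine Eq.trans ?_ (congr($(h2).hom (SymmetricAlgebra.ι A M y)))
      exact congrArg m.hom (symMap_ι _ _ hg' y).symm

/-- Localizing is a base change, with which symmetric algebras commute; the pushout of a
localization of `A` at `r` is the localization at the image of `r`. -/
lemma isLocalization_symMap (r : A) [IsLocalization.Away r B] (g : M →ₗ[A] M')
    [IsLocalizedModule (.powers r) g]
    (hg' : ∀ (a : A) (x : M), g.toAddMonoidHom (a • x) = algebraMap A B a • g.toAddMonoidHom x) :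
    letI := (symMap (algebraMap A B) g.toAddMonoidHom hg').toAlgebra
    IsLocalization.Away (algebraMap A (SymmetricAlgebra A M) r) (SymmetricAlgebra B M') := by
  let i := (symMap (algebraMap A B) g.toAddMonoidHom hg').toAlgebra
  have : IsScalarTower A (SymmetricAlgebra A M) (SymmetricAlgebra B M') :=
    .of_algebraMap_eq fun a => (symMap_algebraMap _ _ hg' a).symm
  have h := isPushout_symMap (B := B) g
    ((isLocalizedModule_iff_isBaseChange (.powers r) B g).mp inferInstance) hg'
  have h' : Algebra.IsPushout A B (SymmetricAlgebra A M) (SymmetricAlgebra B M') :=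
    (CommRingCat.isPushout_iff_isPushout ..).1 h
  have := (Algebra.isLocalization_iff_isPushout (.powers r) B).2 h'.symm
  simpa [IsLocalization.Away, Algebra.algebraMapSubmonoid] using this

end SymLocalization

namespace ModuleOver

open Scheme.AffineZariskiSite

variable {X T : Scheme.{0}} {t : T ⟶ X} (M : ModuleOver t)

/-- A criterion for quasi-coherence: the rings and the modules on a basic open set are the
localizations. -/
lemma isQuasiCoherent_of_isLocalization
    (hr : ∀ (U : X.AffineZariskiSite) (f : Γ(X, U.1)),
      letI := (M.ringRes (U.basicOpen_le f)).toAlgebra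
      IsLocalization.Away (M.str U f) (M.ring (U.basicOpen f)))
    (hi : ∀ (U : X.AffineZariskiSite) (f : Γ(X, U.1)) (x : M.mod U),
      M.modRes (U.basicOpen_le f) x = 0 → ∃ k : ℕ, M.str U f ^ k • x = 0)
    (hs : ∀ (U : X.AffineZariskiSite) (f : Γ(X, U.1)) (y : M.mod (U.basicOpen f)),
      ∃ (k : ℕ) (x : M.mod U), M.ringRes (U.basicOpen_le f) (M.str U f) ^ k • y =
        M.modRes (U.basicOpen_le f) x) :
    M.IsQuasiCoherent := by
  refine coequifibered_iff_forall_isLocalizationAway.2 fun U f => ?_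
  have hloc := hr U f
  let i1 : Algebra (M.ring U) (M.ring (U.basicOpen f)) := (M.ringRes (U.basicOpen_le f)).toAlgebra
  let i2 : Module (M.ring U) (M.mod (U.basicOpen f)) :=
    Module.compHom _ (M.ringRes (U.basicOpen_le f))
  have hsm : ∀ (a : M.ring U) (y : M.mod (U.basicOpen f)),
      a • y = M.ringRes (U.basicOpen_le f) a • y := fun _ _ => rfl
  have : IsScalarTower (M.ring U) (M.ring (U.basicOpen f)) (M.mod (U.basicOpen f)) :=
    ⟨fun a b y => by rw [hsm, Algebra.smul_def, mul_smul]; rfl⟩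
  let g : M.mod U →ₗ[M.ring U] M.mod (U.basicOpen f) :=
    { toFun := M.modRes (U.basicOpen_le f)
      map_add' := map_add _
      map_smul' := M.modRes_smul _ }
  have hu : IsUnit (M.ringRes (U.basicOpen_le f) (M.str U f)) :=
    IsLocalization.Away.algebraMap_isUnit (S := M.ring (U.basicOpen f)) (M.str U f)
  have : IsLocalizedModule (.powers (M.str U f)) g := by
    -- The first axiom comes from invertibility of `f` over the basic open set; the other two are
    -- `hs` and `hi`.
    refine ⟨?_, ?_, ?_⟩
    · rintro ⟨_, k, rfl⟩
      rw [Module.End.isUnit_iff]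
      have hu' := hu.pow k
      constructor
      · intro x y hxy
        have hxy' : M.ringRes (U.basicOpen_le f) (M.str U f) ^ k • x =
            M.ringRes (U.basicOpen_le f) (M.str U f) ^ k • y := by
          rw [Module.algebraMap_end_apply, Module.algebraMap_end_apply, hsm, hsm, map_pow] at hxy
          exact hxy
        exact (hu'.smul_left_cancel).1 hxy'
      · intro y
        refine ⟨(hu'.unit⁻¹ : (M.ring (U.basicOpen f))ˣ) • y, ?_⟩
        rw [Module.algebraMap_end_apply, hsm, map_pow]
        exact smul_inv_smul hu'.unit y
    · intro y
      obtain ⟨k, x, hx⟩ := hs U f y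
      refine ⟨⟨x, ⟨_, k, rfl⟩⟩, ?_⟩
      rw [← map_pow] at hx
      exact hx
    · intro x y hxy
      obtain ⟨k, hk⟩ := hi U f (x - y) (by
        rw [map_sub]
        exact sub_eq_zero.2 hxy)
      refine ⟨⟨_, k, rfl⟩, ?_⟩
      rw [smul_sub] at hk
      exact sub_eq_zero.1 hk
  exact isLocalization_symMap (M.str U f) g (M.modRes_smul _)

end ModuleOver

/-! ### Quasi-coherence of the conormal sheaf -/

section Conormal

open Scheme.AffineZariskiSite

variable {X : Scheme.{0}} (I : X.IdealSheafData)

lemma idealAt_basicOpen (U : X.AffineZariskiSite) (f : Γ(X, U.1)) :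
    (idealAt I U).map (res (U.basicOpen_le f)) = idealAt I (U.basicOpen f) :=
  I.map_ideal (U := ⟨_, (U.basicOpen f).2⟩) (V := ⟨_, U.2⟩) (X.basicOpen_le f)

/-- Both `I` and `I²` over a basic open set are the extensions of the ideals over `U`, so
denominators can be cleared in either of them. -/
lemma isQuasiCoherent_conormal : (conormal I).IsQuasiCoherent := by
  have hloc : ∀ (U : X.AffineZariskiSite) (f : Γ(X, U.1)),
      letI := (res (U.basicOpen_le f)).toAlgebra
      IsLocalization.Away f Γ(X, (U.basicOpen f).1) := fun U f => U.2.isLocalization_basicOpen f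
  refine ModuleOver.isQuasiCoherent_of_isLocalization _ (fun U f => ?_) (fun U f x hx => ?_)
    (fun U f y => ?_)
  · exact I.isLocalization_away (U := ⟨_, (U.basicOpen f).2⟩) (V := ⟨_, U.2⟩)
      (X.basicOpen_le f) f rfl
  · let i1 : Algebra Γ(X, U.1) Γ(X, (U.basicOpen f).1) := (res (U.basicOpen_le f)).toAlgebra
    have := hloc U f
    obtain ⟨x, rfl⟩ := Ideal.toCotangent_surjective _ x
    have hx' : res (U.basicOpen_le f) x.1 ∈ (idealAt I U ^ 2).map (res (U.basicOpen_le f)) := by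
      rw [Ideal.map_pow, idealAt_basicOpen]
      exact (Ideal.toCotangent_eq_zero _ _).1
        ((conormalRes_mk I (U.basicOpen_le f) x).symm.trans hx)
    obtain ⟨⟨⟨a, ha⟩, ⟨_, k, rfl⟩⟩, h⟩ :=
      (IsLocalization.mem_map_algebraMap_iff (.powers f) Γ(X, (U.basicOpen f).1)).1 hx'
    have h' : algebraMap Γ(X, U.1) Γ(X, (U.basicOpen f).1) (x.1 * f ^ k) =
        algebraMap Γ(X, U.1) Γ(X, (U.basicOpen f).1) a := by
      rw [map_mul]
      exact h
    -- `f ^ k` clears the denominator; a further `f ^ l` turns the equality in the localization into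
    -- one over `U`.
    obtain ⟨⟨_, l, rfl⟩, hl⟩ := IsLocalization.exists_of_eq (M := .powers f) h'
    refine ⟨l + k, ?_⟩
    change (Ideal.Quotient.mk (idealAt I U) f) ^ (l + k) • (idealAt I U).toCotangent x = 0
    rw [← map_pow]
    change (f ^ (l + k)) • (idealAt I U).toCotangent x = 0
    rw [← map_smul, Ideal.toCotangent_eq_zero]
    have e : f ^ (l + k) * x.1 = f ^ l * a := by
      rw [← hl, pow_add]
      ring
    change f ^ (l + k) * x.1 ∈ _
    rw [e]
    exact Ideal.mul_mem_left _ _ ha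
  · let i1 : Algebra Γ(X, U.1) Γ(X, (U.basicOpen f).1) := (res (U.basicOpen_le f)).toAlgebra
    have := hloc U f
    obtain ⟨y, rfl⟩ := Ideal.toCotangent_surjective _ y
    have hy : y.1 ∈ (idealAt I U).map (res (U.basicOpen_le f)) := by
      rw [idealAt_basicOpen]
      exact y.2
    obtain ⟨⟨⟨a, ha⟩, ⟨_, k, rfl⟩⟩, h⟩ :=
      (IsLocalization.mem_map_algebraMap_iff (.powers f) Γ(X, (U.basicOpen f).1)).1 hy
    refine ⟨k, (idealAt I U).toCotangent ⟨a, ha⟩, ?_⟩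
    refine Eq.trans ?_ (conormalRes_mk I (U.basicOpen_le f) ⟨a, ha⟩).symm
    change (Ideal.Quotient.mk (idealAt I (U.basicOpen f)) (res (U.basicOpen_le f) f)) ^ k •
      (idealAt I (U.basicOpen f)).toCotangent y = _
    rw [← map_pow]
    change ((res (U.basicOpen_le f) f) ^ k) • (idealAt I (U.basicOpen f)).toCotangent y = _
    rw [← map_smul]
    refine congrArg _ (Subtype.ext ?_)
    refine Eq.trans ?_ h
    change _ = y.1 * res (U.basicOpen_le f) (f ^ k)
    rw [map_pow, mul_comm]
    rfl

end Conormal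

/-! ### Alternating maps and localization -/

section Alternating

/-- An alternating map on a module extends to the localization of the module. -/
lemma exists_alternating_extension {A B M M' Q : Type} [CommRing A] [CommRing B] [Algebra A B]
    (S : Submonoid A) [IsLocalization S B] [AddCommGroup M] [Module A M] [AddCommGroup M']
    [Module B M'] [Module A M'] [IsScalarTower A B M'] [AddCommGroup Q] [Module B Q] [Module A Q]
    [IsScalarTower A B Q] (g : M →ₗ[A] M') [IsLocalizedModule S g] {d : ℕ}
    (h : M [⋀^Fin d]→ₗ[A] Q) :
    ∃ H : M' [⋀^Fin d]→ₗ[B] Q, ∀ x : Fin d → M, H (fun i => g (x i)) = h x := by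
  choose r hr using fun x : M' => IsLocalizedModule.surj S g x
  have hinj : ∀ {s : A} (_ : s ∈ S) {x y : Q}, s • x = s • y → x = y :=
    fun {s} hs x y h => by
      have hu := IsLocalization.map_units B (⟨s, hs⟩ : S)
      rw [← algebraMap_smul B s x, ← algebraMap_smul B s y] at h
      exact hu.smul_left_cancel.1 h
  have hdiv : ∀ (s : S) (q : Q), ∃ q' : Q, (s : A) • q' = q := fun s q => by
    have hu := IsLocalization.map_units B s
    refine ⟨(hu.unit⁻¹ : Bˣ) • q, ?_⟩
    rw [← algebraMap_smul B (s : A)]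
    exact smul_inv_smul hu.unit q
  choose D hD using hdiv
  let P : (Fin d → M') → S := fun x => ∏ i, (r (x i)).2
  let F : (Fin d → M') → Q := fun x => D (P x) (h fun i => (r (x i)).1)
  -- Any denominators `t` that clear the entries of `x` compute `F x`, not only the chosen ones. All
  -- the axioms of an alternating map reduce to this.
  have key : ∀ (x : Fin d → M') (t : Fin d → S) (z : Fin d → M),
      (∀ i, t i • x i = g (z i)) → (∏ i, (t i : A)) • F x = h z := by
    intro x t z hz
    -- Two numerators for the same entry agree in `M` only after multiplication by a further element
    -- `c i` of `S`.
    have hc : ∀ i, ∃ c : S, c • ((r (x i)).2 • z i) = c • (t i • (r (x i)).1) := fun i => by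
      refine IsLocalizedModule.exists_of_eq (S := S) (f := g) ?_
      rw [LinearMap.map_smul_of_tower, LinearMap.map_smul_of_tower, ← hz, ← hr, smul_comm]
    choose c hc using hc
    have hP : ((∏ i, (c i * (r (x i)).2 : S) : S) : A) =
        (∏ i, ((c i : A) * ((r (x i)).2 : A))) := by
      simp
    refine hinj (∏ i, (c i * (r (x i)).2 : S)).2 ?_
    have e1 : ((∏ i, (c i * (r (x i)).2 : S) : S) : A) • h z =
        h fun i => c i • ((r (x i)).2 • z i) := by
      rw [hP, ← h.map_smul_univ]
      congr 1
      funext i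
      rw [mul_smul]
      rfl
    have e2 : (h fun i => c i • ((r (x i)).2 • z i)) =
        (∏ i, ((c i : A) * (t i : A))) • h (fun i => (r (x i)).1) := by
      rw [← h.map_smul_univ]
      congr 1
      funext i
      rw [hc, mul_smul]
      rfl
    rw [e1, e2, ← hD (P x) (h fun i => (r (x i)).1), hP, smul_smul, smul_smul]
    congr 1
    simp only [P, Submonoid.coe_finsetProd, Finset.prod_mul_distrib]
    ring
  have key' : ∀ (x : Fin d → M') (t : Fin d → S) (z : Fin d → M) (q : Q),
      (∀ i, t i • x i = g (z i)) → (∏ i, (t i : A)) • q = h z → F x = q := fun x t z q h1 h2 =>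
    hinj (∏ i, t i).2 (by rw [Submonoid.coe_finsetProd, key x t z h1, h2])
  refine ⟨⟨⟨F, ?_, ?_⟩, ?_⟩, fun x => ?_⟩
  · intro inst x i a b
    obtain rfl : inst = instDecidableEqFin d := Subsingleton.elim _ _
    -- In the slot `i` the product of the two chosen denominators serves `a`, `b` and `a + b` at
    -- once.
    let t : Fin d → S := Function.update (fun j => (r (x j)).2) i ((r a).2 * (r b).2)
    let z : Fin d → M := fun j => (r (x j)).1
    refine key' _ t (Function.update z i ((r b).2 • (r a).1 + (r a).2 • (r b).1)) _ (fun j => ?_) ?_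
    · by_cases hj : j = i
      · subst hj
        simp only [t, Function.update_self, map_add, LinearMap.map_smul_of_tower, ← hr, smul_add,
          mul_smul]
        rw [smul_comm (r a).2 (r b).2 a]
      · simp [t, z, hj, hr]
    · rw [smul_add, h.map_update_add]
      congr 1
      · refine key _ t _ fun j => ?_
        by_cases hj : j = i
        · subst hj
          simp only [t, Function.update_self, LinearMap.map_smul_of_tower, ← hr, mul_smul]
          rw [smul_comm (r a).2 (r b).2 a]
        · simp [t, z, hj, hr]
      · refine key _ t _ fun j => ?_
        by_cases hj : j = i
        · subst hj
          simp only [t, Function.update_self, LinearMap.map_smul_of_tower, ← hr, mul_smul]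
        · simp [t, z, hj, hr]
  · intro inst x i b a
    obtain rfl : inst = instDecidableEqFin d := Subsingleton.elim _ _
    obtain ⟨⟨b', s⟩, hb⟩ := IsLocalization.surj S b
    let t : Fin d → S := Function.update (fun j => (r (x j)).2) i (s * (r a).2)
    let z : Fin d → M := fun j => (r (x j)).1
    have hb' : (s : A) • b = algebraMap A B b' := by
      rw [Algebra.smul_def, mul_comm]
      exact hb
    refine key' _ t (Function.update z i (b' • (r a).1)) _ (fun j => ?_) ?_
    · by_cases hj : j = i
      · subst hj
        simp only [t, Function.update_self, map_smul, ← hr, mul_smul]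
        rw [smul_comm (r a).2 b a, Submonoid.smul_def s, ← smul_assoc, hb', algebraMap_smul]
      · simp [t, z, hj, hr]
    · let t' : Fin d → S := Function.update (fun j => (r (x j)).2) i (r a).2
      have h1 : (∏ j, (t' j : A)) • F (Function.update x i a) = h (Function.update z i (r a).1) := by
        refine key _ _ _ fun j => ?_
        by_cases hj : j = i
        · subst hj
          simp only [t', Function.update_self, ← hr]
        · simp [t', z, hj, hr]
      rw [h.map_update_smul, ← h1, ← algebraMap_smul B b', ← hb']
      have h2 : (∏ j, (t j : A)) = (s : A) * ∏ j, (t' j : A) := by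
        rw [← Finset.mul_prod_erase _ _ (Finset.mem_univ i),
          ← Finset.mul_prod_erase _ (fun j => (t' j : A)) (Finset.mem_univ i), ← mul_assoc]
        simp only [t, t', Function.update_self, Submonoid.coe_mul]
        congr 1
        refine Finset.prod_congr rfl fun j hj => ?_
        rw [Function.update_of_ne (Finset.ne_of_mem_erase hj),
          Function.update_of_ne (Finset.ne_of_mem_erase hj)]
      rw [h2, mul_smul, smul_assoc, smul_comm b]
  · intro x i j hij hne
    refine hinj (P x).2 ?_
    rw [hD, smul_zero]
    exact h.map_eq_zero_of_eq _ (by rw [hij]) hne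
  · exact key' _ (fun _ => 1) x _ (fun i => one_smul _ _) (by simp)

end Alternating

/-! ### Differential forms and localization -/

section Forms

open KaehlerDifferential

/-- The form `da₁ ∧ ⋯ ∧ da_d` of an algebra. -/
def dform (k : Type) [CommRing k] {A : Type} [CommRing A] [Algebra k A] {d : ℕ} (a : Fin d → A) :
    ⋀[A]^d Ω[A⁄k] :=
  exteriorPower.ιMulti A d fun i => D k A (a i)

/-- The forms `da₁ ∧ ⋯ ∧ da_d` with entries in a set whose differentials generate determine a
linear map. -/
lemma linearMap_ext_of_span {k A Q : Type} [CommRing k] [CommRing A] [Algebra k A] {d : ℕ}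
    [AddCommGroup Q] [Module A Q] {s : Set A} (hs : Submodule.span A (D k A '' s) = ⊤)
    {φ ψ : ⋀[A]^d Ω[A⁄k] →ₗ[A] Q}
    (h : ∀ a : Fin d → A, (∀ i, a i ∈ s) → φ (dform k a) = ψ (dform k a)) : φ = ψ := by
  have key : ∀ x (hx : x ∈ ⋀[A]^d Ω[A⁄k]), φ ⟨x, hx⟩ = ψ ⟨x, hx⟩ := by
    intro x hx
    have hx' := hx
    rw [← exteriorPower.ιMulti_span_fixedDegree_of_span_eq_top A d _ hs] at hx'
    induction hx' using Submodule.span_induction with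
    | mem x hx' =>
      obtain ⟨b, hb, rfl⟩ := hx'
      choose a ha hab using fun i => hb ⟨i, rfl⟩
      have : (⟨_, hx⟩ : ⋀[A]^d Ω[A⁄k]) = dform k a := by
        refine Subtype.ext ?_
        change ExteriorAlgebra.ιMulti A d b = ExteriorAlgebra.ιMulti A d _
        exact congrArg _ (funext fun i => (hab i).symm)
      rw [this]
      exact h a ha
    | zero =>
      have : (⟨0, hx⟩ : ⋀[A]^d Ω[A⁄k]) = 0 := rfl
      rw [this, map_zero, map_zero]
    | add x y hx' hy' ihx ihy =>
      have mem : ∀ z, z ∈ Submodule.span A (ExteriorAlgebra.ιMulti A d ''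
          {a | Set.range a ⊆ D k A '' s}) → z ∈ ⋀[A]^d Ω[A⁄k] := fun z hz => by
        rwa [exteriorPower.ιMulti_span_fixedDegree_of_span_eq_top A d _ hs] at hz
      have : (⟨x + y, hx⟩ : ⋀[A]^d Ω[A⁄k]) = ⟨x, mem x hx'⟩ + ⟨y, mem y hy'⟩ := rfl
      rw [this, map_add, map_add, ihx, ihy]
    | smul c x hx' ihx =>
      have mem : ∀ z, z ∈ Submodule.span A (ExteriorAlgebra.ιMulti A d ''
          {a | Set.range a ⊆ D k A '' s}) → z ∈ ⋀[A]^d Ω[A⁄k] := fun z hz => by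
        rwa [exteriorPower.ιMulti_span_fixedDegree_of_span_eq_top A d _ hs] at hz
      have : (⟨c • x, hx⟩ : ⋀[A]^d Ω[A⁄k]) = c • ⟨x, mem x hx'⟩ := rfl
      rw [this, map_smul, map_smul, ihx]
  exact LinearMap.ext fun x => key x.1 x.2

lemma linearMap_ext_dform {k A Q : Type} [CommRing k] [CommRing A] [Algebra k A] {d : ℕ}
    [AddCommGroup Q] [Module A Q] {φ ψ : ⋀[A]^d Ω[A⁄k] →ₗ[A] Q}
    (h : ∀ a : Fin d → A, φ (dform k a) = ψ (dform k a)) : φ = ψ :=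
  linearMap_ext_of_span (s := Set.univ) (by
    rw [Set.image_univ]
    exact KaehlerDifferential.span_range_derivation k A) fun a _ => h a

variable {k A B : Type} [CommRing k] [CommRing A] [CommRing B] [Algebra k A] [Algebra k B]
  [Algebra A B] [IsScalarTower k A B] {d : ℕ}

/-- The differentials of elements of `A` already generate the differentials of a localization, so
entries with denominators need not be tested. -/
lemma linearMap_ext_of_isLocalization {Q : Type} (S : Submonoid A) [IsLocalization S B]
    [AddCommGroup Q] [Module B Q]
    {φ ψ : ⋀[B]^d Ω[B⁄k] →ₗ[B] Q} (h : ∀ a : Fin d → A,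
      φ (dform k fun i => algebraMap A B (a i)) = ψ (dform k fun i => algebraMap A B (a i))) :
    φ = ψ := by
  refine linearMap_ext_of_span (s := Set.range (algebraMap A B)) ?_ fun b hb => ?_
  · rw [← KaehlerDifferential.span_range_map_derivation_of_isLocalization k A B S]
    congr 1
    ext x
    simp
  · choose a ha using hb
    obtain rfl : (fun i => algebraMap A B (a i)) = b := funext ha
    exact h a

/-- The pullback of a linear form on the differential forms. -/
lemma exists_linearMap_comp_dform {Q : Type} [AddCommGroup Q] [Module B Q] [Module A Q]
    [IsScalarTower A B Q] (φ : ⋀[B]^d Ω[B⁄k] →ₗ[B] Q) :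
    ∃ ψ : ⋀[A]^d Ω[A⁄k] →ₗ[A] Q, ∀ a : Fin d → A,
      ψ (dform k a) = φ (dform k fun i => algebraMap A B (a i)) := by
  let h : Ω[A⁄k] [⋀^Fin d]→ₗ[A] Q :=
    { toFun := fun x => φ (exteriorPower.ιMulti B d fun i => KaehlerDifferential.map k k A B (x i))
      map_update_add' := by
        intro inst x i a b
        obtain rfl : inst = instDecidableEqFin d := Subsingleton.elim _ _
        have e : ∀ c, (fun j => KaehlerDifferential.map k k A B (Function.update x i c j)) =
            Function.update (fun j => KaehlerDifferential.map k k A B (x j)) i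
              (KaehlerDifferential.map k k A B c) := fun c =>
          funext fun j => Function.apply_update (fun _ => KaehlerDifferential.map k k A B) x i c j
        rw [e, e, e, map_add, AlternatingMap.map_update_add, map_add]
      map_update_smul' := by
        intro inst x i a b
        obtain rfl : inst = instDecidableEqFin d := Subsingleton.elim _ _
        have e : ∀ c, (fun j => KaehlerDifferential.map k k A B (Function.update x i c j)) =
            Function.update (fun j => KaehlerDifferential.map k k A B (x j)) i
              (KaehlerDifferential.map k k A B c) := fun c =>
          funext fun j => Function.apply_update (fun _ => KaehlerDifferential.map k k A B) x i c j
        rw [e, e, map_smul, ← algebraMap_smul B a (KaehlerDifferential.map k k A B b),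
          AlternatingMap.map_update_smul, map_smul, algebraMap_smul]
      map_eq_zero_of_eq' := by
        intro x i j hij hne
        rw [AlternatingMap.map_eq_zero_of_eq _ _ (by rw [hij]) hne, map_zero] }
  refine ⟨exteriorPower.alternatingMapLinearEquiv h, fun a => ?_⟩
  rw [dform, exteriorPower.alternatingMapLinearEquiv_apply_ιMulti]
  change φ (exteriorPower.ιMulti B d _) = φ (exteriorPower.ιMulti B d _)
  simp only [KaehlerDifferential.map_D]

/-- A linear form on the differential forms extends to a localization. -/
lemma exists_linearMap_dform_algebraMap (S : Submonoid A) [IsLocalization S B]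
    (φ : ⋀[A]^d Ω[A⁄k] →ₗ[A] A) :
    ∃ ψ : ⋀[B]^d Ω[B⁄k] →ₗ[B] B, ∀ a : Fin d → A,
      ψ (dform k fun i => algebraMap A B (a i)) = algebraMap A B (φ (dform k a)) := by
  obtain ⟨H, hH⟩ := exists_alternating_extension (B := B) S (KaehlerDifferential.map k k A B)
    ((Algebra.linearMap A B).compAlternatingMap
      (φ.compAlternatingMap (exteriorPower.ιMulti A d)))
  refine ⟨exteriorPower.alternatingMapLinearEquiv H, fun a => ?_⟩
  rw [dform, exteriorPower.alternatingMapLinearEquiv_apply_ιMulti]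
  simp only [← KaehlerDifferential.map_D (R := k) (S := k) (A := A) (B := B)]
  rw [hH]
  rfl

end Forms

/-! ### Quasi-coherence of the dual of the canonical sheaf -/

section DualForms

open Scheme.AffineZariskiSite

variable {Y : Scheme.{0}} (s : Y ⟶ Spec (.of ℂ)) (d : ℕ)

lemma fnRes_algebraMap {U W : Y.AffineZariskiSite} (h : U ≤ W) (c : ℂ) :
    fnRes s h (algebraMap ℂ (Fn s W) c) = algebraMap ℂ (Fn s U) c := by
  have h1 := Scheme.Hom.appLE_map s (U := ⊤) (V := W.toOpens) le_top (homOfLE (toOpens_mono h)).op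
  exact congr($(h1).hom ((Scheme.ΓSpecIso (.of ℂ)).inv.hom c))

/-- In the affine Zariski site `U ≤ W` means that `U` is a basic open subset of `W`, not merely
contained in it. -/
lemma exists_isLocalization_fnRes {U W : Y.AffineZariskiSite} (h : U ≤ W) :
    ∃ f : Fn s W, letI := (fnRes s h).toAlgebra; IsLocalization.Away f (Fn s U) := by
  obtain ⟨f, hf⟩ := id h
  obtain rfl : W.basicOpen f = U := Subtype.ext hf
  exact ⟨f, W.2.isLocalization_basicOpen f⟩

/-- A linear map on the forms over `U` is the restriction of a section of the dual sheaf. -/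
lemma exists_dualForms (U : Y.AffineZariskiSite) (φ : Forms s d U →ₗ[Fn s U] Fn s U) :
    ∃ Φ : dualForms s d U, ∀ x, (Φ.1 ⟨U, le_refl U⟩).eval s d x = φ x := by
  have ext : ∀ W : {W : Y.AffineZariskiSite // W ≤ U}, ∃ ψ : Forms s d W.1 →ₗ[Fn s W.1] Fn s W.1,
      ∀ a : Fin d → Fn s U, ψ (form s d fun i => fnRes s W.2 (a i)) =
        fnRes s W.2 (φ (form s d a)) := by
    intro W
    let i1 := (fnRes s W.2).toAlgebra
    have : IsScalarTower ℂ (Fn s U) (Fn s W.1) :=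
      .of_algebraMap_eq fun c => (fnRes_algebraMap s W.2 c).symm
    obtain ⟨f, hf⟩ := exists_isLocalization_fnRes s W.2
    exact exists_linearMap_dform_algebraMap (.powers f) φ
  choose ψ hψ using ext
  refine ⟨⟨ψ, fun W W' h a => ?_⟩, fun x => ?_⟩
  · let i1 := (fnRes s W.2).toAlgebra
    let i2 := (fnRes s h).toAlgebra
    have : IsScalarTower ℂ (Fn s U) (Fn s W.1) :=
      .of_algebraMap_eq fun c => (fnRes_algebraMap s W.2 c).symm
    have : IsScalarTower ℂ (Fn s W.1) (Fn s W'.1) :=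
      .of_algebraMap_eq fun c => (fnRes_algebraMap s h c).symm
    obtain ⟨f, hf⟩ := exists_isLocalization_fnRes s W.2
    obtain ⟨χ, hχ⟩ := exists_linearMap_comp_dform (A := Fn s W.1) (ψ W')
    -- To compare the values over `W'` and `W`, it is enough to take forms with entries restricted
    -- from `U`, where both come from `φ`.
    have e : χ = (Algebra.linearMap (Fn s W.1) (Fn s W'.1)).comp (ψ W) := by
      refine linearMap_ext_of_isLocalization (.powers f) fun a => ?_
      rw [hχ]
      refine Eq.trans ?_ (congrArg (fnRes s h) (hψ W a).symm)
      rw [fnRes_fnRes]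
      refine Eq.trans ?_ (hψ W' a)
      refine congrArg (ψ W') (congrArg _ (funext fun i => ?_))
      exact fnRes_fnRes s h W.2 (a i)
    exact (hχ a).symm.trans congr($e (form s d a))
  · refine congrFun (congrArg DFunLike.coe (linearMap_ext_dform fun a => ?_)) x
    have := hψ ⟨U, le_refl U⟩ a
    simp only [fnRes_self] at this
    exact this

/-- A section of the dual sheaf is determined by its value on the largest open set. -/
lemma dualForms_ext {U : Y.AffineZariskiSite} {φ ψ : dualForms s d U}
    (h : ∀ a, (φ.1 ⟨U, le_refl U⟩).eval s d (form s d a) =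
      (ψ.1 ⟨U, le_refl U⟩).eval s d (form s d a)) : φ = ψ := by
  refine Subtype.ext (funext fun W => ?_)
  let i1 := (fnRes s W.2).toAlgebra
  have : IsScalarTower ℂ (Fn s U) (Fn s W.1) :=
    .of_algebraMap_eq fun c => (fnRes_algebraMap s W.2 c).symm
  obtain ⟨f, hf⟩ := exists_isLocalization_fnRes s W.2
  refine linearMap_ext_of_isLocalization (k := ℂ) (.powers f)
    (φ := show Forms s d W.1 →ₗ[Fn s W.1] Fn s W.1 from φ.1 W)
    (ψ := show Forms s d W.1 →ₗ[Fn s W.1] Fn s W.1 from ψ.1 W) fun a => ?_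
  have h1 := φ.2 ⟨U, le_refl U⟩ W W.2 a
  have h2 := ψ.2 ⟨U, le_refl U⟩ W W.2 a
  rw [h a] at h1
  exact h1.trans h2.symm

/-- Homomorphisms out of a finitely presented module commute with localization. Finite type over `ℂ`
makes the rings noetherian and the modules of forms finitely presented. -/
lemma isQuasiCoherent_dualCanonical
    (hft : ∀ U : Y.AffineZariskiSite, Algebra.FiniteType ℂ (Fn s U)) :
    (dualCanonical s d).IsQuasiCoherent := by
  refine ModuleOver.isQuasiCoherent_of_isLocalization _ (fun U f => ?_) (fun U f x hx => ?_)
    (fun U f y => ?_)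
  · exact U.2.isLocalization_basicOpen f
  · have := hft U
    let f' : Fn s U := f
    let W : {W : Y.AffineZariskiSite // W ≤ U} := ⟨U.basicOpen f, U.basicOpen_le f⟩
    let i1 := (fnRes s W.2).toAlgebra
    have : IsLocalization.Away f' (Fn s W.1) := U.2.isLocalization_basicOpen f
    let φ : Forms s d U →ₗ[Fn s U] Fn s U := x.1 ⟨U, le_refl U⟩
    have h0 : (Algebra.linearMap (Fn s U) (Fn s W.1)).comp φ =
        (Algebra.linearMap (Fn s U) (Fn s W.1)).comp (0 : Forms s d U →ₗ[Fn s U] Fn s U) := by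
      refine linearMap_ext_dform (k := ℂ) fun a => ?_
      have h1 := x.2 ⟨U, le_refl U⟩ W W.2 a
      have h2 : (x.1 W).eval s d (form s d fun i => fnRes s W.2 (a i)) = 0 := by
        have : x.1 W = 0 := congrFun (congrArg Subtype.val hx) ⟨W.1, le_refl _⟩
        rw [this]
        exact FormsDual.zero_eval ..
      rw [h2] at h1
      rw [LinearMap.comp_zero, LinearMap.zero_apply]
      exact h1.symm
    have : IsNoetherianRing (Fn s U) := Algebra.FiniteType.isNoetherianRing ℂ (Fn s U)
    obtain ⟨⟨_, k, rfl⟩, hk⟩ := Module.Finite.exists_smul_of_comp_eq_of_isLocalizedModule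
      (.powers f') (Algebra.linearMap (Fn s U) (Fn s W.1)) φ 0 h0
    refine ⟨k, dualForms_ext s d fun a => ?_⟩
    have := congr($hk (form s d a))
    rw [smul_zero] at this
    change fnRes s (le_refl U) (f' ^ k) * φ (form s d a) = _
    rw [fnRes_self]
    exact this
  · have := hft U
    let f' : Fn s U := f
    let W : {W : Y.AffineZariskiSite // W ≤ U} := ⟨U.basicOpen f, U.basicOpen_le f⟩
    let i1 := (fnRes s W.2).toAlgebra
    have : IsLocalization.Away f' (Fn s W.1) := U.2.isLocalization_basicOpen f
    have : IsScalarTower ℂ (Fn s U) (Fn s W.1) :=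
      .of_algebraMap_eq fun c => (fnRes_algebraMap s W.2 c).symm
    have : IsNoetherianRing (Fn s U) := Algebra.FiniteType.isNoetherianRing ℂ (Fn s U)
    let ψ : Forms s d W.1 →ₗ[Fn s W.1] Fn s W.1 := y.1 ⟨W.1, le_refl _⟩
    -- `χ` is `ψ` on forms over `U`, with values in the localization. A multiple of it by a power of
    -- `f` takes values over `U` itself.
    obtain ⟨χ, hχ⟩ := exists_linearMap_comp_dform (A := Fn s U) (k := ℂ) ψ
    have : Module.FinitePresentation (Fn s U) (Forms s d U) :=
      Module.finitePresentation_of_finite (Fn s U) (Forms s d U)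
    obtain ⟨φ, ⟨_, k, rfl⟩, hk⟩ := Module.FinitePresentation.exists_lift_of_isLocalizedModule
      (.powers f') (Algebra.linearMap (Fn s U) (Fn s W.1)) χ
    obtain ⟨Φ, hΦ⟩ := exists_dualForms s d U φ
    refine ⟨k, Φ, ?_⟩
    refine dualForms_ext s d fun b => ?_
    let φ₁ : Forms s d W.1 →ₗ[Fn s W.1] Fn s W.1 := Φ.1 W
    have hφ₁ : ∀ a, φ₁ (form s d fun i => fnRes s W.2 (a i)) = fnRes s W.2 (φ (form s d a)) :=
      fun a => (Φ.2 ⟨U, le_refl U⟩ W W.2 a).trans (congrArg _ (hΦ _))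
    have e : fnRes s W.2 f' ^ k • ψ = φ₁ := by
      refine linearMap_ext_of_isLocalization (k := ℂ) (.powers f') fun a => ?_
      refine Eq.trans ?_ (hφ₁ a).symm
      rw [LinearMap.smul_apply, ← hχ, ← map_pow]
      exact congr($hk (form s d a)).symm
    change fnRes s (le_refl W.1) (fnRes s W.2 f' ^ k) * ψ (form s d b) = φ₁ (form s d b)
    rw [fnRes_self, ← e]
    rfl

end DualForms

/-! ### The grading of the coordinate rings by a lattice point of the cone -/

section Grading

variable {V : Type} [AddCommGroup V] [Module ℝ V] {N : Submodule ℤ V} {τ η : PointedCone ℝ V}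

/-- The group algebra of the dual space; it contains all the rings `ℂ[τ^∨ ∩ M]`. -/
abbrev torusRing (V : Type) [AddCommGroup V] [Module ℝ V] : Type :=
  AddMonoidAlgebra ℂ (Module.Dual ℝ V)

/-- The character `χ^m`. -/
abbrev chr (m : Module.Dual ℝ V) : torusRing V := AddMonoidAlgebra.single m 1

lemma chr_add (m m' : Module.Dual ℝ V) : chr (m + m') = chr m * chr m' := by
  rw [AddMonoidAlgebra.single_mul_single, one_mul]

lemma chr_zero : chr (0 : Module.Dual ℝ V) = 1 := rfl

/-- The dual space is a rational vector space, so it has the two-unique-sums property, which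
excludes zero divisors. Primality of `rayIdeal` rests on this. -/
instance : IsDomain (torusRing V) := by
  let : Module ℚ (Module.Dual ℝ V) := Module.compHom _ (algebraMap ℚ ℝ)
  have : TwoUniqueSums (Module.Dual ℝ V) := inferInstance
  infer_instance

/-- The character `χ^m` in `ℂ[τ^∨ ∩ M]`. -/
abbrev mon (m : dualMonoid N τ) : coordRing N τ := AddMonoidAlgebra.single m 1

lemma mon_add (m m' : dualMonoid N τ) : mon (m + m') = mon m * mon m' := by
  rw [AddMonoidAlgebra.single_mul_single, one_mul]

lemma mon_zero : mon (0 : dualMonoid N τ) = 1 := rfl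

lemma coordRing_induction {motive : coordRing N τ → Prop} (x : coordRing N τ)
    (mon : ∀ m, motive (mon m)) (add : ∀ x y, motive x → motive y → motive (x + y))
    (smul : ∀ (c : ℂ) x, motive x → motive (c • x)) : motive x :=
  AddMonoidAlgebra.induction_on x (fun m => mon m) add smul

/-- The inclusion of `ℂ[τ^∨ ∩ M]` into the group algebra of the dual space. -/
def incl (N : Submodule ℤ V) (τ : PointedCone ℝ V) : coordRing N τ →ₐ[ℂ] torusRing V :=
  AddMonoidAlgebra.mapDomainAlgHom ℂ ℂ (dualMonoid N τ).subtype

lemma incl_mon (m : dualMonoid N τ) : incl N τ (mon m) = chr m.1 := by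
  simp [incl]

lemma incl_injective : Function.Injective (incl N τ) :=
  AddMonoidAlgebra.mapDomain_injective Subtype.val_injective

lemma coordMap_mon (h : τ ≤ η) (m : dualMonoid N η) :
    coordMap N h (mon m) = mon ⟨m.1, dualMonoid_anti N h m.2⟩ :=
  coordMap_single h m 1

lemma incl_coordMap (h : τ ≤ η) (x : coordRing N η) :
    incl N τ (coordMap N h x) = incl N η x := by
  induction x using coordRing_induction with
  | mon m => rw [coordMap_mon, incl_mon, incl_mon]
  | add x y hx hy => rw [map_add, map_add, map_add, hx, hy]
  | smul c x hx => rw [map_smul, map_smul, map_smul, hx]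

variable {v : V}

lemma natFloor_apply (hN : v ∈ N) (hv : v ∈ τ) (m : dualMonoid N τ) :
    (⌊m.1 v⌋₊ : ℝ) = m.1 v := by
  obtain ⟨k, hk⟩ := m.2.1 v hN
  have h0 := m.2.2 v hv
  rw [hk] at h0 ⊢
  have h1 : 0 ≤ k := by exact_mod_cast h0
  lift k to ℕ using h1
  simp

/-- The homomorphism `ℂ[τ^∨ ∩ M] → R[t]` with `χ^m ↦ χ^m t^{⟨m, v⟩}`. -/
def grade (hN : v ∈ N) (hv : v ∈ τ) : coordRing N τ →ₐ[ℂ] Polynomial (torusRing V) :=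
  AddMonoidAlgebra.lift ℂ (Polynomial (torusRing V)) (dualMonoid N τ)
    { toFun := fun m => Polynomial.monomial ⌊m.toAdd.1 v⌋₊ (chr m.toAdd.1)
      map_one' := by
        simp only [toAdd_one, AddSubmonoid.coe_zero, LinearMap.zero_apply, Nat.floor_zero]
        rfl
      map_mul' := fun m m' => by
        have : ((⌊(m * m').toAdd.1 v⌋₊ : ℕ) : ℝ) = (⌊m.toAdd.1 v⌋₊ + ⌊m'.toAdd.1 v⌋₊ : ℕ) := by
          rw [natFloor_apply hN hv, Nat.cast_add, natFloor_apply hN hv, natFloor_apply hN hv]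
          rfl
        rw [Polynomial.monomial_mul_monomial, ← chr_add, Nat.cast_injective this]
        rfl }

variable (hN : v ∈ N) (hv : v ∈ τ)

lemma grade_mon (m : dualMonoid N τ) :
    grade hN hv (mon m) = Polynomial.monomial ⌊m.1 v⌋₊ (chr m.1) := by
  simp [grade]

/-- The degree is the pairing with `v`, in which the cone plays no role. Compatibility of all later
constructions with restriction comes from here. -/
lemma grade_coordMap (h : τ ≤ η) (x : coordRing N η) :
    grade hN hv (coordMap N h x) = grade hN (h hv) x := by
  induction x using coordRing_induction with
  | mon m => rw [coordMap_mon, grade_mon, grade_mon]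
  | add x y hx hy => rw [map_add, map_add, map_add, hx, hy]
  | smul c x hx => rw [map_smul, map_smul, map_smul, hx]

/-- The part of degree `0`. -/
def part₀ : coordRing N τ →ₐ[ℂ] torusRing V :=
  { (Polynomial.constantCoeff.comp (grade hN hv).toRingHom) with
    commutes' := fun c => by
      change (grade hN hv (algebraMap ℂ _ c)).coeff 0 = _
      rw [AlgHom.commutes, IsScalarTower.algebraMap_apply ℂ (torusRing V)]
      exact Polynomial.coeff_C_zero }

/-- The part of degree `1`. -/
def part₁ : coordRing N τ →ₗ[ℂ] torusRing V where
  toFun x := (grade hN hv x).coeff 1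
  map_add' x y := by rw [map_add, Polynomial.coeff_add]
  map_smul' c x := by rw [map_smul, Polynomial.coeff_smul, RingHom.id_apply]

lemma part₀_apply (x : coordRing N τ) : part₀ hN hv x = (grade hN hv x).coeff 0 := rfl

lemma part₁_apply (x : coordRing N τ) : part₁ hN hv x = (grade hN hv x).coeff 1 := rfl

lemma part₀_mon_of_eq {m : dualMonoid N τ} (h : m.1 v = 0) : part₀ hN hv (mon m) = chr m.1 := by
  rw [part₀_apply, grade_mon, h, Nat.floor_zero, Polynomial.coeff_monomial_same]

lemma part₀_mon_of_ne {m : dualMonoid N τ} (h : m.1 v ≠ 0) : part₀ hN hv (mon m) = 0 := by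
  rw [part₀_apply, grade_mon, Polynomial.coeff_monomial_of_ne]
  intro h0
  exact h (by rw [← natFloor_apply hN hv, ← h0, Nat.cast_zero])

lemma part₁_mon_of_eq {m : dualMonoid N τ} (h : m.1 v = 1) : part₁ hN hv (mon m) = chr m.1 := by
  rw [part₁_apply, grade_mon, h, Nat.floor_one, Polynomial.coeff_monomial_same]

lemma part₁_mul (x y : coordRing N τ) : part₁ hN hv (x * y) =
    part₀ hN hv x * part₁ hN hv y + part₁ hN hv x * part₀ hN hv y := by
  rw [part₁_apply, map_mul, Polynomial.mul_coeff_one]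
  rfl

lemma part₀_coordMap (h : τ ≤ η) (x : coordRing N η) :
    part₀ hN hv (coordMap N h x) = part₀ hN (h hv) x := by
  rw [part₀_apply, grade_coordMap, part₀_apply]

lemma part₁_coordMap (h : τ ≤ η) (x : coordRing N η) :
    part₁ hN hv (coordMap N h x) = part₁ hN (h hv) x := by
  rw [part₁_apply, grade_coordMap, part₁_apply]

/-- The ideal of the orbit closure of the ray through `v` in `ℂ[τ^∨ ∩ M]`. -/
def rayIdeal : Ideal (coordRing N τ) := RingHom.ker (part₀ hN hv)

lemma mem_rayIdeal {x : coordRing N τ} : x ∈ rayIdeal hN hv ↔ part₀ hN hv x = 0 := Iff.rfl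

instance : (rayIdeal hN hv).IsPrime := RingHom.ker_isPrime _

/-- On the ideal the part of degree one is linear over the part of degree zero and kills products of
two elements, so it factors through the cotangent module. -/
lemma part₁_mul_of_mem {x y : coordRing N τ} (hy : y ∈ rayIdeal hN hv) :
    part₁ hN hv (x * y) = part₀ hN hv x * part₁ hN hv y := by
  rw [part₁_mul, (mem_rayIdeal hN hv).1 hy, mul_zero, add_zero]

lemma comap_rayIdeal (h : τ ≤ η) :
    (rayIdeal hN hv).comap (coordMap N h) = rayIdeal hN (h hv) := by
  ext x
  rw [Ideal.mem_comap, mem_rayIdeal, mem_rayIdeal, part₀_coordMap]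

/-- The degree is nonnegative, so the kernel of the degree zero part consists of the combinations of
monomials of nonzero degree. -/
lemma rayIdeal_eq_span : rayIdeal hN hv =
    Ideal.span {f | ∃ m : dualMonoid N τ, m.1 v ≠ 0 ∧ f = mon m} := by
  apply le_antisymm
  -- `y` collects the monomials of degree zero in `x`. If `x` lies in the ideal, then `y` vanishes
  -- because `incl` is injective.
  · have key : ∀ x : coordRing N τ, ∃ y : coordRing N τ, incl N τ y = part₀ hN hv x ∧
        x - y ∈ Ideal.span {f | ∃ m : dualMonoid N τ, m.1 v ≠ 0 ∧ f = mon m} := by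
      intro x
      induction x using coordRing_induction with
      | mon m =>
        by_cases h : m.1 v = 0
        · exact ⟨mon m, by rw [part₀_mon_of_eq hN hv h, incl_mon], by simp⟩
        · refine ⟨0, by rw [part₀_mon_of_ne hN hv h, map_zero], ?_⟩
          rw [sub_zero]
          exact Ideal.subset_span ⟨m, h, rfl⟩
      | add x y hx hy =>
        obtain ⟨x', h1, h2⟩ := hx
        obtain ⟨y', h3, h4⟩ := hy
        exact ⟨x' + y', by rw [map_add, map_add, h1, h3], by
          rw [add_sub_add_comm]
          exact add_mem h2 h4⟩
      | smul c x hx =>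
        obtain ⟨x', h1, h2⟩ := hx
        exact ⟨c • x', by rw [map_smul, map_smul, h1], by
          rw [← smul_sub, Algebra.smul_def]
          exact Ideal.mul_mem_left _ _ h2⟩
    intro x hx
    obtain ⟨y, h1, h2⟩ := key x
    rw [(mem_rayIdeal hN hv).1 hx] at h1
    rw [incl_injective (h1.trans (map_zero (incl N τ)).symm), sub_zero] at h2
    exact h2
  · rw [Ideal.span_le]
    rintro _ ⟨m, hm, rfl⟩
    exact part₀_mon_of_ne hN hv hm

end Grading

/-! ### The charts of a toric variety -/

section Charts

open Scheme.AffineZariskiSite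

variable {V : Type} [AddCommGroup V] [Module ℝ V] {N : Submodule ℤ V} (Ξ : Fan N)

namespace Fan

instance (τ : Ξ.Cone) : IsOpenImmersion (Ξ.chart τ) :=
  inferInstanceAs (IsOpenImmersion (colimit.ι Ξ.diagram τ))

/-- The open immersion `U_τ → U_η` for `τ ≤ η`. -/
def chartMap {τ η : Ξ.Cone} (h : τ ≤ η) :
    Spec (.of (coordRing N τ.1)) ⟶ Spec (.of (coordRing N η.1)) :=
  Spec.map (CommRingCat.ofHom (coordMap N h).toRingHom)

lemma chartMap_chart {τ η : Ξ.Cone} (h : τ ≤ η) : Ξ.chartMap h ≫ Ξ.chart η = Ξ.chart τ :=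
  Ξ.chart_comp (homOfLE h)

lemma exists_mem_range_chart (x : Ξ.toricVariety) : ∃ τ, x ∈ Set.range (Ξ.chart τ) := by
  obtain ⟨τ, y, hy⟩ := Scheme.IsLocallyDirected.ι_jointly_surjective Ξ.diagram x
  exact ⟨τ, y, hy⟩

lemma exists_map_eq_of_chart_eq {τ η : Ξ.Cone} {x : Spec (.of (coordRing N τ.1))}
    {y : Spec (.of (coordRing N η.1))} (h : Ξ.chart τ x = Ξ.chart η y) :
    ∃ (κ : Ξ.Cone) (f : κ ≤ τ) (g : κ ≤ η) (z : Spec (.of (coordRing N κ.1))),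
      Ξ.chartMap f z = x ∧ Ξ.chartMap g z = y := by
  obtain ⟨κ, f, g, z, h1, h2⟩ := (Scheme.IsLocallyDirected.ι_eq_ι_iff Ξ.diagram).1 h
  exact ⟨κ, f.le, g.le, z, h1, h2⟩

lemma exists_mem_range_chart_of_mem {τ η : Ξ.Cone} {x : Ξ.toricVariety}
    (h1 : x ∈ Set.range (Ξ.chart τ)) (h2 : x ∈ Set.range (Ξ.chart η)) :
    ∃ κ, κ ≤ τ ∧ κ ≤ η ∧ x ∈ Set.range (Ξ.chart κ) := by
  obtain ⟨y, rfl⟩ := h1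
  obtain ⟨z, hz⟩ := h2
  obtain ⟨κ, f, g, w, rfl, rfl⟩ := Ξ.exists_map_eq_of_chart_eq hz.symm
  refine ⟨κ, f, g, w, ?_⟩
  rw [← Scheme.Hom.comp_apply, Ξ.chartMap_chart]

lemma range_chart_subset {τ η : Ξ.Cone} (h : τ ≤ η) :
    Set.range (Ξ.chart τ) ⊆ Set.range (Ξ.chart η) := by
  rintro _ ⟨x, rfl⟩
  exact ⟨Ξ.chartMap h x, by rw [← Scheme.Hom.comp_apply, Ξ.chartMap_chart]⟩

lemma chart_structureMap (τ : Ξ.Cone) : Ξ.chart τ ≫ Ξ.structureMap =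
    Spec.map (CommRingCat.ofHom (algebraMap ℂ (coordRing N τ.1))) :=
  colimit.ι_desc _ _

/-- The image of a chart as an affine open set. -/
def chartOpen (τ : Ξ.Cone) : Ξ.toricVariety.AffineZariskiSite :=
  ⟨(Ξ.chart τ).opensRange, isAffineOpen_opensRange _⟩

lemma le_preimage_chartOpen (τ : Ξ.Cone) : ⊤ ≤ Ξ.chart τ ⁻¹ᵁ (Ξ.chartOpen τ).toOpens := by
  rintro x -
  exact ⟨x, rfl⟩

/-- The isomorphism `Γ(X_Ξ, U_τ) → ℂ[τ^∨ ∩ M]`. -/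
def chartHom (τ : Ξ.Cone) : Γ(Ξ.toricVariety, (Ξ.chartOpen τ).toOpens) ⟶ .of (coordRing N τ.1) :=
  (Ξ.chart τ).appLE (Ξ.chartOpen τ).toOpens ⊤ (Ξ.le_preimage_chartOpen τ) ≫ (Scheme.ΓSpecIso _).hom

lemma SpecMap_chartHom (τ : Ξ.Cone) :
    Spec.map (Ξ.chartHom τ) ≫ (Ξ.chartOpen τ).2.fromSpec = Ξ.chart τ := by
  have h := IsAffineOpen.SpecMap_appLE_fromSpec (Ξ.chart τ) (Ξ.chartOpen τ).2
    (isAffineOpen_top _) (Ξ.le_preimage_chartOpen τ)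
  rw [chartHom, Spec.map_comp, Category.assoc]
  refine (congrArg _ h).trans ?_
  rw [IsAffineOpen.fromSpec_top]
  simp

/-- The spectrum of this map differs from the chart by `fromSpec`, whose image is the range of the
chart; so it is a surjective open immersion. -/
instance (τ : Ξ.Cone) : IsIso (Ξ.chartHom τ) := by
  have h1 : IsOpenImmersion (Spec.map (Ξ.chartHom τ) ≫ (Ξ.chartOpen τ).2.fromSpec) := by
    rw [Ξ.SpecMap_chartHom]
    infer_instance
  have h2 : IsOpenImmersion (Spec.map (Ξ.chartHom τ)) :=
    .of_comp _ (Ξ.chartOpen τ).2.fromSpec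
  have h3 : Function.Surjective (Spec.map (Ξ.chartHom τ)) := by
    intro x
    have : (Ξ.chartOpen τ).2.fromSpec x ∈ Set.range (Ξ.chart τ) := by
      have : (Ξ.chartOpen τ).2.fromSpec x ∈ Set.range (Ξ.chartOpen τ).2.fromSpec := ⟨x, rfl⟩
      rw [IsAffineOpen.range_fromSpec] at this
      exact this
    obtain ⟨y, hy⟩ := this
    refine ⟨y, (Ξ.chartOpen τ).2.fromSpec.isOpenEmbedding.injective ?_⟩
    rw [← hy, ← Scheme.Hom.comp_apply, Ξ.SpecMap_chartHom]
  have : Epi (Spec.map (Ξ.chartHom τ)).base := (TopCat.epi_iff_surjective _).2 h3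
  have : IsIso (Spec.map (Ξ.chartHom τ)) := IsOpenImmersion.isIso _
  have : IsIso (Scheme.Spec.map (Ξ.chartHom τ).op) := this
  have := isIso_of_reflects_iso (Ξ.chartHom τ).op Scheme.Spec
  exact (isIso_op_iff _).1 this

/-- Containment is not enough for the order of the site. The face is cut out by some `m`, and its
chart is the locus where `χ^m` does not vanish. -/
lemma chartOpen_le {τ η : Ξ.Cone} (h : τ ≤ η) : Ξ.chartOpen τ ≤ Ξ.chartOpen η := by
  obtain ⟨m, hm, -, -, hr⟩ := Ξ.exists_eq_slice h
  refine ⟨inv (Ξ.chartHom η) (mon ⟨m, hm⟩), TopologicalSpace.Opens.ext ?_⟩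
  have h1 (x : Spec (.of (coordRing N η.1))) :
      Ξ.chart η x ∈ Ξ.toricVariety.basicOpen (inv (Ξ.chartHom η) (mon ⟨m, hm⟩)) ↔
        x ∈ Set.range (Ξ.chartMap h) := by
    have h2 : x ∈ Set.range (Ξ.chartMap h) ↔ mon ⟨m, hm⟩ ∉ x.asIdeal := Set.ext_iff.1 hr x
    have h3 : Ξ.chart η ⁻¹ᵁ Ξ.toricVariety.basicOpen (inv (Ξ.chartHom η) (mon ⟨m, hm⟩)) =
        Spec.map (Ξ.chartHom η) ⁻¹ᵁ PrimeSpectrum.basicOpen (inv (Ξ.chartHom η) (mon ⟨m, hm⟩)) := by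
      rw [← Ξ.SpecMap_chartHom η, Scheme.Hom.comp_preimage,
        IsAffineOpen.fromSpec_preimage_basicOpen]
    rw [h2, ← Scheme.Hom.mem_preimage, h3]
    refine not_congr ?_
    change Ξ.chartHom η (inv (Ξ.chartHom η) (mon ⟨m, hm⟩)) ∈ x.asIdeal ↔ mon ⟨m, hm⟩ ∈ x.asIdeal
    rw [← CommRingCat.comp_apply, IsIso.inv_hom_id]
    rfl
  refine Set.ext fun y => ⟨fun hy => ?_, ?_⟩
  · obtain ⟨x, rfl⟩ := Ξ.toricVariety.basicOpen_le _ hy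
    obtain ⟨z, rfl⟩ := (h1 x).1 hy
    exact ⟨z, by rw [← Scheme.Hom.comp_apply, Ξ.chartMap_chart]⟩
  · rintro ⟨z, rfl⟩
    have := (h1 _).2 ⟨z, rfl⟩
    rwa [← Scheme.Hom.comp_apply, Ξ.chartMap_chart] at this

lemma chartHom_res {τ η : Ξ.Cone} (h : τ ≤ η) (a : Γ(Ξ.toricVariety, (Ξ.chartOpen η).toOpens)) :
    Ξ.chartHom τ (res (Ξ.chartOpen_le h) a) = coordMap N h (Ξ.chartHom η a) := by
  have : Ξ.toricVariety.presheaf.map (homOfLE (toOpens_mono (Ξ.chartOpen_le h))).op ≫ Ξ.chartHom τ =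
      Ξ.chartHom η ≫ CommRingCat.ofHom (coordMap N h).toRingHom := by
    apply Spec.map_injective
    rw [← cancel_mono (Ξ.chartOpen η).2.fromSpec, Spec.map_comp, Spec.map_comp, Category.assoc,
      Category.assoc, Ξ.SpecMap_chartHom,
      IsAffineOpen.map_fromSpec (Ξ.chartOpen η).2 (Ξ.chartOpen τ).2, Ξ.SpecMap_chartHom]
    exact (Ξ.chartMap_chart h).symm
  exact congr($(this).hom a)

end Fan

end Charts

/-! ### The closure of the orbit of a ray -/

section Orbit

open Scheme.AffineZariskiSite

variable {V : Type} [AddCommGroup V] [Module ℝ V] {N : Submodule ℤ V} {Ξ : Fan N}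
  {v : V} (hN : v ∈ N)

/-- The generic point of the orbit closure of the ray through `v` in the chart of `τ`. -/
def rayPoint (τ : Ξ.Cone) (hv : v ∈ τ.1) : Spec (.of (coordRing N τ.1)) :=
  ⟨rayIdeal hN hv, inferInstance⟩

lemma chartMap_rayPoint {τ η : Ξ.Cone} (h : τ ≤ η) (hv : v ∈ τ.1) :
    Ξ.chartMap h (rayPoint hN τ hv) = rayPoint hN η (h hv) :=
  PrimeSpectrum.ext (comap_rayIdeal hN hv h)

lemma chart_rayPoint {τ η : Ξ.Cone} (h : τ ≤ η) (hv : v ∈ τ.1) :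
    Ξ.chart τ (rayPoint hN τ hv) = Ξ.chart η (rayPoint hN η (h hv)) := by
  rw [← chartMap_rayPoint hN h, ← Scheme.Hom.comp_apply, Ξ.chartMap_chart]

lemma mem_closure_rayPoint {τ : Ξ.Cone} (hv : v ∈ τ.1) (x : Spec (.of (coordRing N τ.1))) :
    x ∈ closure {rayPoint hN τ hv} ↔ rayIdeal hN hv ≤ x.asIdeal := by
  rw [← specializes_iff_mem_closure]
  exact (PrimeSpectrum.le_iff_specializes (rayPoint hN τ hv) x).symm

lemma exists_hull_apply_ne_iff (m : Module.Dual ℝ V) :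
    (∃ w ∈ PointedCone.hull ℝ {v}, m w ≠ 0) ↔ m v ≠ 0 := by
  refine ⟨?_, fun h => ⟨v, Submodule.subset_span rfl, h⟩⟩
  rintro ⟨w, hw, h⟩ h0
  obtain ⟨c, rfl⟩ := Submodule.mem_span_singleton.1 hw
  refine h ?_
  change m ((c : ℝ) • v) = 0
  rw [map_smul, h0, smul_zero]

variable {ρ : Ξ.Cone} (hρ : ρ.1 = PointedCone.hull ℝ {v})

include hρ

lemma mem_ray : v ∈ ρ.1 := by
  rw [hρ]
  exact Submodule.subset_span rfl

lemma ray_le {τ : Ξ.Cone} (hv : v ∈ τ.1) : ρ ≤ τ := by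
  change ρ.1 ≤ τ.1
  rw [hρ]
  exact Submodule.span_le.2 (Set.singleton_subset_iff.2 hv)

/-- Both sides are the zero locus of the monomials `χ^m` with `m v ≠ 0`: on the ray, `m` is nonzero
somewhere exactly if it is nonzero at `v`. -/
lemma orbit_eq_closure : Ξ.orbit ρ = closure {rayPoint hN ρ (mem_ray hρ)} := by
  ext x
  rw [mem_closure_rayPoint, rayIdeal_eq_span, Ideal.span_le, Fan.orbit]
  have : {f | ∃ m : dualMonoid N ρ.1, (∃ w ∈ ρ.1, m.1 w ≠ 0) ∧ f = AddMonoidAlgebra.single m 1} =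
      {f | ∃ m : dualMonoid N ρ.1, m.1 v ≠ 0 ∧ f = mon m} := by
    ext f
    refine exists_congr fun m => and_congr ?_ Iff.rfl
    rw [← exists_hull_apply_ne_iff m.1]
    exact exists_congr fun w => and_congr (by rw [hρ]) Iff.rfl
  rw [this]
  rfl

lemma mem_support_orbitIdeal (x : Ξ.toricVariety) : x ∈ (Ξ.orbitIdeal ρ).support ↔
    x ∈ closure {Ξ.chart ρ (rayPoint hN ρ (mem_ray hρ))} := by
  rw [← SetLike.mem_coe, Fan.orbitIdeal, Scheme.IdealSheafData.coe_support_vanishingIdeal]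
  change x ∈ closure (Ξ.chart ρ '' Ξ.orbit ρ) ↔ _
  rw [orbit_eq_closure hN hρ, closure_image_closure (Ξ.chart ρ).continuous, Set.image_singleton]

lemma chart_mem_support {τ : Ξ.Cone} (hv : v ∈ τ.1) (x : Spec (.of (coordRing N τ.1))) :
    Ξ.chart τ x ∈ (Ξ.orbitIdeal ρ).support ↔ rayIdeal hN hv ≤ x.asIdeal := by
  rw [mem_support_orbitIdeal hN hρ, chart_rayPoint hN (ray_le hρ hv), ← Set.image_singleton,
    ← Set.mem_preimage, ← (Ξ.chart τ).isOpenEmbedding.isEmbedding.closure_eq_preimage_closure_image,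
    mem_closure_rayPoint]

-- An open chart that meets the orbit closure contains its generic point, which then lies in the
-- chart of a face `κ` of `ρ`. If `v ∉ τ`, this face is cut out by some `m` with `m v ≠ 0`; but
-- `χ^m` is a unit on its chart and vanishes at the generic point.
include hN in
lemma mem_of_mem_support {τ : Ξ.Cone} {x : Ξ.toricVariety} (hx : x ∈ (Ξ.orbitIdeal ρ).support)
    (hτ : x ∈ Set.range (Ξ.chart τ)) : v ∈ τ.1 := by
  rw [mem_support_orbitIdeal hN hρ, ← specializes_iff_mem_closure] at hx
  obtain ⟨κ, h1, h2, z, hz⟩ := Ξ.exists_mem_range_chart_of_mem ⟨_, rfl⟩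
    (hx.mem_open (Ξ.chart τ).isOpenEmbedding.isOpen_range hτ)
  by_contra hv
  obtain ⟨m, hm, hκ⟩ := Ξ.isFace_of_le κ.2 ρ.2 h1
  have h0 : m v ≠ 0 := fun h => hv (h2 (show v ∈ κ.1 by rw [hκ]; exact ⟨mem_ray hρ, h⟩))
  rw [← Ξ.chartMap_chart h1, Scheme.Hom.comp_apply] at hz
  have hz := (Ξ.chart ρ).isOpenEmbedding.injective hz
  have h3 : mon ⟨m, hm⟩ ∈ (Ξ.chartMap h1 z).asIdeal := by
    rw [hz]
    exact part₀_mon_of_ne hN (mem_ray hρ) h0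
  have h4 : coordMap N h1 (mon ⟨m, hm⟩) ∈ z.asIdeal := h3
  have hneg : -m ∈ dualMonoid N κ.1 := by
    refine ⟨neg_mem hm.1, fun w hw => ?_⟩
    rw [hκ] at hw
    simp [(mem_slice.1 hw).2]
  -- The product of `χ^m` with its inverse `χ^{-m}` puts `1` into the prime ideal of `z`.
  refine z.2.ne_top ((Ideal.eq_top_iff_one _).2 ?_)
  have h5 := Ideal.mul_mem_left z.asIdeal (mon ⟨-m, hneg⟩) h4
  rw [coordMap_mon, ← mon_add] at h5
  convert h5 using 1
  refine congrArg mon (Subtype.ext ?_)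
  change 0 = -m + m
  simp

/-- In the chart the orbit closure is the closure of the point `rayIdeal`. This ideal is prime, so
the reduced ideal of the closure is `rayIdeal` itself. -/
lemma mem_idealAt_orbitIdeal {τ : Ξ.Cone} (hv : v ∈ τ.1)
    (a : Γ(Ξ.toricVariety, (Ξ.chartOpen τ).toOpens)) :
    a ∈ idealAt (Ξ.orbitIdeal ρ) (Ξ.chartOpen τ) ↔ part₀ hN hv (Ξ.chartHom τ a) = 0 := by
  have h1 (y : Spec (.of (coordRing N τ.1))) :
      (Ξ.chartOpen τ).2.fromSpec (Spec.map (Ξ.chartHom τ) y) ∈ closure (Ξ.chart ρ '' Ξ.orbit ρ) ↔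
        rayIdeal hN hv ≤ y.asIdeal := by
    rw [← Scheme.Hom.comp_apply, Ξ.SpecMap_chartHom, ← chart_mem_support hN hρ, ← SetLike.mem_coe,
      Fan.orbitIdeal, Scheme.IdealSheafData.coe_support_vanishingIdeal]
    rfl
  have h2 : a ∈ idealAt (Ξ.orbitIdeal ρ) (Ξ.chartOpen τ) ↔
      ∀ x : Spec Γ(Ξ.toricVariety, (Ξ.chartOpen τ).toOpens),
        (Ξ.chartOpen τ).2.fromSpec x ∈ closure (Ξ.chart ρ '' Ξ.orbit ρ) → a ∈ x.asIdeal := by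
    rw [idealAt, Fan.orbitIdeal, Scheme.IdealSheafData.vanishingIdeal_ideal]
    exact PrimeSpectrum.mem_vanishingIdeal _ _
  rw [h2, ← mem_rayIdeal]
  refine ⟨fun h => h (Spec.map (Ξ.chartHom τ) (rayPoint hN τ hv)) ((h1 _).2 le_rfl),
    fun h x hx => ?_⟩
  obtain ⟨y, rfl⟩ : ∃ y, Spec.map (Ξ.chartHom τ) y = x :=
    ⟨inv (Spec.map (Ξ.chartHom τ)) x, by rw [← Scheme.Hom.comp_apply, IsIso.inv_hom_id]; rfl⟩
  exact (h1 y).1 hx h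

end Orbit

/-! ### Subfans and open immersions -/

section Subfan

variable {V : Type} [AddCommGroup V] [Module ℝ V] {N : Submodule ℤ V}

namespace Fan

lemma chart_subfanMap {Θ Ξ : Fan N} (h : Θ.cones ⊆ Ξ.cones) (τ : Θ.Cone) :
    Θ.chart τ ≫ subfanMap h = Ξ.chart ⟨τ.1, h τ.2⟩ :=
  colimit.ι_desc _ _

/-- On charts the map is an open immersion, which leaves injectivity. -/
lemma isOpenImmersion_subfanMap {Θ Ξ : Fan N} (h : Θ.cones ⊆ Ξ.cones) :
    IsOpenImmersion (subfanMap h) := by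
  refine isOpenImmersion_of_forall _ ?_ fun x => ?_
  · intro x y hxy
    obtain ⟨τ, x, rfl⟩ := Θ.exists_mem_range_chart x
    obtain ⟨η, y, rfl⟩ := Θ.exists_mem_range_chart y
    rw [← Scheme.Hom.comp_apply, ← Scheme.Hom.comp_apply, chart_subfanMap, chart_subfanMap] at hxy
    obtain ⟨κ, f, g, z, rfl, rfl⟩ := Ξ.exists_map_eq_of_chart_eq hxy
    -- Points are identified in the large variety along a cone `κ` of `Ξ`. As a face of a cone of
    -- `Θ`, it belongs to `Θ`, so they are already identified there.
    have hκ : κ.1 ∈ Θ.cones := Θ.face_mem τ.1 τ.2 κ.1 (Ξ.isFace_of_le κ.2 (h τ.2) f)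
    have e1 := Θ.chartMap_chart (τ := ⟨κ.1, hκ⟩) (η := τ) f
    have e2 := Θ.chartMap_chart (τ := ⟨κ.1, hκ⟩) (η := η) g
    exact congr($e1 z).trans congr($e2 z).symm
  · obtain ⟨τ, hτ⟩ := Θ.exists_mem_range_chart x
    refine ⟨_, Θ.chart τ, inferInstance, hτ, ?_⟩
    rw [chart_subfanMap]
    infer_instance

lemma subfanMap_structureMap {Θ Ξ : Fan N} (h : Θ.cones ⊆ Ξ.cones) :
    subfanMap h ≫ Ξ.structureMap = Θ.structureMap := by
  refine colimit.hom_ext fun τ => ?_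
  change Θ.chart τ ≫ _ = Θ.chart τ ≫ _
  rw [← Category.assoc, chart_subfanMap, chart_structureMap, chart_structureMap]

end Fan

end Subfan

/-! ### The image of the normal bundle in the ambient scheme -/

section ConormalSupport

open Scheme.AffineZariskiSite

/-- The structure map to `Sym(I/I²)` factors through the quotient by `I`, so functions in `I` vanish
on the image. Charts that miss the subscheme therefore contribute nothing to the total space. -/
lemma totMap_mem_support {X : Scheme.{0}} {I : X.IdealSheafData}
    (h : (conormal I).IsQuasiCoherent) (p : ModuleOver.tot h) :
    ModuleOver.totMap h p ∈ I.support := by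
  obtain ⟨U, hxU⟩ : ∃ U : X.AffineZariskiSite, ModuleOver.totMap h p ∈ U.toOpens := by
    obtain ⟨_, ⟨U, hU, rfl⟩, hxU, -⟩ := X.isBasis_affineOpens.exists_subset_of_mem_open
      (Set.mem_univ (ModuleOver.totMap h p)) isOpen_univ
    exact ⟨⟨U, hU⟩, hxU⟩
  obtain ⟨q, rfl⟩ := (preimage_relSpecMap h U).le hxU
  have e := relSpecChart_relSpecMap h U
  have e' : ModuleOver.totMap h (relSpecChart h U q) =
      U.2.fromSpec (Spec.map ((conormal I).symStrHom U) q) := congr($e q)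
  rw [Scheme.IdealSheafData.mem_support_iff_of_mem (U := ⟨U.1, U.2⟩) hxU, e', ← Set.mem_preimage,
    U.2.fromSpec_preimage_zeroLocus]
  intro a ha
  change (conormal I).symStrHom U a ∈ q.asIdeal
  have h0 : (conormal I).str U a = 0 := Ideal.Quotient.eq_zero_iff_mem.2 ha
  have : (conormal I).symStrHom U a = 0 :=
    (congrArg (algebraMap ((conormal I).ring U) (SymmetricAlgebra ((conormal I).ring U)
      ((conormal I).mod U)))
      h0).trans (map_zero _)
  rw [this]
  exact zero_mem _

end ConormalSupport

/-! ### Semilinear maps out of symmetric algebras and cotangent modules -/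

section SymLift

variable {A R M : Type} [CommRing A] [CommRing R] [AddCommGroup M] [Module A M]

/-- The homomorphism `Sym_A M → R` given by `φ : A → R` and a `φ`-linear map `g : M → R`. -/
def symLift (φ : A →+* R) (g : M →+ R) (hg : ∀ (a : A) (x : M), g (a • x) = φ a * g x) :
    SymmetricAlgebra A M →+* R :=
  letI : Algebra A R := φ.toAlgebra
  (SymmetricAlgebra.lift (R := A) (A := R)
    { toFun := g
      map_add' := map_add g
      map_smul' := fun a x => by
        rw [hg, Algebra.smul_def]
        rfl }).toRingHom

variable (φ : A →+* R) (g : M →+ R) (hg : ∀ (a : A) (x : M), g (a • x) = φ a * g x)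

lemma symLift_algebraMap (a : A) : symLift φ g hg (algebraMap A _ a) = φ a := by
  let : Algebra A R := φ.toAlgebra
  exact AlgHom.commutes _ a

lemma symLift_ι (x : M) : symLift φ g hg (SymmetricAlgebra.ι A M x) = g x := by
  let : Algebra A R := φ.toAlgebra
  exact SymmetricAlgebra.lift_ι_apply _ x

/-- The map `I/I² → R` induced by a map `I → R` that is linear over `φ : A → R` and vanishes
on products. -/
def cotangentLift {I : Ideal A} (φ : A →+* R) (g : I →+ R)
    (hg : ∀ (a : A) (x : I), g (a • x) = φ a * g x) (hI : ∀ a ∈ I, φ a = 0) :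
    I.Cotangent →+ R :=
  letI : Module A R := Module.compHom R φ
  (Ideal.Cotangent.lift (I := I) (M := R)
    { g with map_smul' := hg } fun x y => by
      change g (x.1 • y) = 0
      rw [hg, hI x.1 x.2, zero_mul]).toAddMonoidHom

end SymLift

/-! ### The ring of the normal bundle on a chart -/

section NormalBundleRing

variable {V : Type} [AddCommGroup V] [Module ℝ V] {N : Submodule ℤ V} {τ : PointedCone ℝ V}
  {v : V} (hN : v ∈ N) (hv : v ∈ τ)

variable {A : Type} [CommRing A] {I : Ideal A} (c : A →+* coordRing N τ)
  (hI : ∀ a, a ∈ I ↔ part₀ hN hv (c a) = 0)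

/-- The homomorphism `A/I → R` induced by the part of degree `0`. -/
def quotEval : A ⧸ I →+* torusRing V :=
  Ideal.Quotient.lift I ((part₀ hN hv).toRingHom.comp c) fun a ha => (hI a).1 ha

lemma quotEval_mk (a : A) :
    quotEval hN hv c hI (Ideal.Quotient.mk I a) = part₀ hN hv (c a) := rfl

lemma quotEval_injective : Function.Injective (quotEval hN hv c hI) := by
  rw [injective_iff_map_eq_zero]
  intro a
  obtain ⟨a, rfl⟩ := Ideal.Quotient.mk_surjective a
  rw [quotEval_mk, Ideal.Quotient.eq_zero_iff_mem, hI]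
  exact id

/-- The map `I/I² → R` induced by the part of degree `1`. -/
def cotangentEval : I.Cotangent →+ torusRing V :=
  cotangentLift ((part₀ hN hv).toRingHom.comp c)
    (((part₁ hN hv).toAddMonoidHom.comp c.toAddMonoidHom).comp I.toAddSubgroup.subtype)
    (fun a x => by
      change part₁ hN hv (c (a * x)) = _
      rw [map_mul, part₁_mul_of_mem hN hv ((hI _).1 x.2)]
      rfl) fun a ha => (hI a).1 ha

lemma cotangentEval_toCotangent (x : I) :
    cotangentEval hN hv c hI (I.toCotangent x) = part₁ hN hv (c x) := rfl

lemma cotangentEval_smul (a : A ⧸ I) (x : I.Cotangent) : cotangentEval hN hv c hI (a • x) =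
    quotEval hN hv c hI a * cotangentEval hN hv c hI x := by
  obtain ⟨a, rfl⟩ := Ideal.Quotient.mk_surjective a
  obtain ⟨x, rfl⟩ := Ideal.toCotangent_surjective _ x
  change cotangentEval hN hv c hI (a • I.toCotangent x) = _
  rw [← map_smul, cotangentEval_toCotangent, cotangentEval_toCotangent, quotEval_mk]
  change part₁ hN hv (c (a * x)) = _
  rw [map_mul, part₁_mul_of_mem hN hv ((hI _).1 x.2)]

/-- The homomorphism `Sym(I/I²) → R`. -/
def symEval : SymmetricAlgebra (A ⧸ I) I.Cotangent →+* torusRing V :=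
  symLift (quotEval hN hv c hI) (cotangentEval hN hv c hI) (cotangentEval_smul hN hv c hI)

/-- `m₁` is the coordinate function of the ray through `v`: it has the value `1` at `v`, and `χ^{m₁}`
divides all `χ^m` that vanish on the orbit closure of the ray. -/
structure IsRayCoordinate (N : Submodule ℤ V) (τ : PointedCone ℝ V) (v : V)
    (m₁ : dualMonoid N τ) : Prop where
  apply_eq : m₁.1 v = 1
  sub_mem : ∀ m ∈ dualMonoid N τ, 1 ≤ m v → m - m₁.1 ∈ dualMonoid N τ

variable {hN hv} {m₁ : dualMonoid N τ}

include hN hv in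
lemma IsRayCoordinate.one_le_apply (m : dualMonoid N τ) (h : m.1 v ≠ 0) :
    1 ≤ m.1 v := by
  rw [← natFloor_apply hN hv] at h ⊢
  exact_mod_cast Nat.one_le_iff_ne_zero.2 (by exact_mod_cast h)

/-- The coordinate can be split off once for each unit of degree, because the degree is still
positive before every step. -/
lemma IsRayCoordinate.sub_nsmul_mem (h₁ : IsRayCoordinate N τ v m₁) (k : ℕ) :
    ∀ m : dualMonoid N τ, m.1 v = k → m.1 - k • m₁.1 ∈ dualMonoid N τ := by
  induction k with
  | zero => intro m _; simp
  | succ k ih =>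
    intro m hm
    have h := h₁.sub_mem m.1 m.2 (by rw [hm]; push_cast; linarith [k.cast_nonneg (α := ℝ)])
    have := ih ⟨_, h⟩ (by simp [hm, h₁.apply_eq])
    convert this using 1
    simp only [succ_nsmul]
    abel

/-- The factor of degree `0` of `χ^m`. -/
def IsRayCoordinate.rest (hN : v ∈ N) (hv : v ∈ τ) (h₁ : IsRayCoordinate N τ v m₁)
    (m : dualMonoid N τ) : dualMonoid N τ :=
  ⟨m.1 - ⌊m.1 v⌋₊ • m₁.1, h₁.sub_nsmul_mem _ m (natFloor_apply hN hv m).symm⟩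

lemma IsRayCoordinate.rest_apply (h₁ : IsRayCoordinate N τ v m₁) (m : dualMonoid N τ) :
    (h₁.rest hN hv m).1 v = 0 := by
  change (m.1 - ⌊m.1 v⌋₊ • m₁.1) v = 0
  rw [LinearMap.sub_apply, LinearMap.smul_apply, h₁.apply_eq, nsmul_one, natFloor_apply hN hv,
    sub_self]

lemma IsRayCoordinate.rest_add (h₁ : IsRayCoordinate N τ v m₁) (m : dualMonoid N τ) :
    (h₁.rest hN hv m).1 + ⌊m.1 v⌋₊ • m₁.1 = m.1 := sub_add_cancel _ _

lemma natFloor_add (hN : v ∈ N) (hv : v ∈ τ) (m m' : dualMonoid N τ) :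
    ⌊(m + m').1 v⌋₊ = ⌊m.1 v⌋₊ + ⌊m'.1 v⌋₊ := by
  have : ((⌊(m + m').1 v⌋₊ : ℕ) : ℝ) = (⌊m.1 v⌋₊ + ⌊m'.1 v⌋₊ : ℕ) := by
    rw [natFloor_apply hN hv, Nat.cast_add, natFloor_apply hN hv, natFloor_apply hN hv]
    rfl
  exact_mod_cast this

lemma IsRayCoordinate.rest_add_eq (h₁ : IsRayCoordinate N τ v m₁) (m m' : dualMonoid N τ) :
    h₁.rest hN hv (m + m') = h₁.rest hN hv m + h₁.rest hN hv m' := by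
  refine Subtype.ext ?_
  change (m + m').1 - ⌊(m + m').1 v⌋₊ • m₁.1 =
    (m.1 - ⌊m.1 v⌋₊ • m₁.1) + (m'.1 - ⌊m'.1 v⌋₊ • m₁.1)
  rw [natFloor_add hN hv, add_nsmul, AddSubmonoid.coe_add]
  abel

lemma IsRayCoordinate.rest_of_apply_eq_zero (h₁ : IsRayCoordinate N τ v m₁) {m : dualMonoid N τ}
    (h : m.1 v = 0) : h₁.rest hN hv m = m := by
  refine Subtype.ext ?_
  change m.1 - ⌊m.1 v⌋₊ • m₁.1 = m.1
  simp [h]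

/-- The ideal is generated by monomials of positive degree, each divisible by `χ^{m₁}`; so it is
principal, and one class generates the cotangent module. -/
lemma IsRayCoordinate.exists_mul_eq (h₁ : IsRayCoordinate N τ v m₁) {y : coordRing N τ}
    (hy : y ∈ rayIdeal hN hv) : ∃ b : coordRing N τ, b * mon m₁ = y := by
  rw [← Ideal.mem_span_singleton']
  rw [rayIdeal_eq_span] at hy
  refine Ideal.span_le.2 ?_ hy
  rintro _ ⟨m, hm, rfl⟩
  have h := h₁.sub_mem m.1 m.2 (IsRayCoordinate.one_le_apply (hN := hN) (hv := hv) m hm)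
  refine Ideal.mem_span_singleton'.2 ⟨mon ⟨_, h⟩, ?_⟩
  rw [← mon_add]
  exact congrArg mon (Subtype.ext (sub_add_cancel _ _))

variable (hc : Function.Bijective c)

include hc

/-- If the ray has a coordinate function, then `Sym(I/I²)` is `ℂ[τ^∨ ∩ M]`. -/
lemma exists_symEquiv (h₁ : IsRayCoordinate N τ v m₁) :
    ∃ L : coordRing N τ ≃+* SymmetricAlgebra (A ⧸ I) I.Cotangent,
      (∀ x, symEval hN hv c hI (L x) = incl N τ x) ∧
      ∀ a : A, SymmetricAlgebra.algebraMapInv (L (c a)) = Ideal.Quotient.mk I a := by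
  let e := RingEquiv.ofBijective c hc
  have hce (x) : c (e.symm x) = x := e.apply_symm_apply x
  have hmem (m : dualMonoid N τ) : e.symm (mon m) ∈ I ↔ m.1 v ≠ 0 := by
    rw [hI, hce]
    by_cases h : m.1 v = 0
    · rw [part₀_mon_of_eq hN hv h]
      simp [h]
    · rw [part₀_mon_of_ne hN hv h]
      simp [h]
  have hm₁ : e.symm (mon m₁) ∈ I := (hmem m₁).2 (by rw [h₁.apply_eq]; exact one_ne_zero)
  let X : SymmetricAlgebra (A ⧸ I) I.Cotangent :=
    SymmetricAlgebra.ι _ _ (I.toCotangent ⟨e.symm (mon m₁), hm₁⟩)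
  let q : coordRing N τ →+* SymmetricAlgebra (A ⧸ I) I.Cotangent :=
    ((algebraMap (A ⧸ I) _).comp (Ideal.Quotient.mk I)).comp e.symm.toRingHom
  have hq (x) : q x = algebraMap _ _ (Ideal.Quotient.mk I (e.symm x)) := rfl
  have hqa (a) : q (e a) = algebraMap _ _ (Ideal.Quotient.mk I a) := by
    rw [hq, e.symm_apply_apply]
  -- Every exponent is its factor of degree zero plus a multiple of `m₁`. The first goes to `A/I`,
  -- and `χ^{m₁}` goes to its class `X` in the cotangent module.
  let L : coordRing N τ →+* SymmetricAlgebra (A ⧸ I) I.Cotangent :=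
    AddMonoidAlgebra.liftNCRingHom (q.comp (algebraMap ℂ (coordRing N τ)))
      { toFun := fun m => q (mon (h₁.rest hN hv m.toAdd)) * X ^ ⌊m.toAdd.1 v⌋₊
        map_one' := by
          have h0 : h₁.rest hN hv (0 : dualMonoid N τ) = 0 :=
            h₁.rest_of_apply_eq_zero (by simp)
          simp only [toAdd_one, h0, mon_zero, map_one, AddSubmonoid.coe_zero,
            LinearMap.zero_apply, Nat.floor_zero, pow_zero, mul_one]
        map_mul' := fun m m' => by
          rw [toAdd_mul, natFloor_add hN hv, h₁.rest_add_eq, mon_add, map_mul, pow_add]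
          ring } (fun _ _ => Commute.all _ _)
  have hL (m : dualMonoid N τ) : L (mon m) = q (mon (h₁.rest hN hv m)) * X ^ ⌊m.1 v⌋₊ := by
    refine (AddMonoidAlgebra.liftNCRingHom_single _ _ _ _ _).trans ?_
    rw [map_one, one_mul]
    rfl
  have hLc (z : ℂ) : L (algebraMap ℂ _ z) = q (algebraMap ℂ _ z) := by
    refine (AddMonoidAlgebra.liftNCRingHom_single _ _ _ _ _).trans ?_
    rw [ofAdd_zero, map_one, mul_one]
    rfl
  have hL0 (m : dualMonoid N τ) (h : m.1 v = 0) : L (mon m) = q (mon m) := by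
    rw [hL, h₁.rest_of_apply_eq_zero h, h, Nat.floor_zero, pow_zero, mul_one]
  have hsmul (z : ℂ) (x : coordRing N τ) : z • x = algebraMap ℂ _ z * x := Algebra.smul_def _ _
  -- Followed by evaluation in the group algebra, `L` becomes the inclusion. This gives injectivity
  -- of `L`.
  have hκ (x) : symEval hN hv c hI (L x) = incl N τ x := by
    have hκq (x) : symEval hN hv c hI (q x) = part₀ hN hv x := by
      rw [hq, symEval, symLift_algebraMap, quotEval_mk, hce]
    induction x using coordRing_induction with
    | mon m =>
      have hX : symEval hN hv c hI X = chr m₁.1 := by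
        rw [symEval, symLift_ι, cotangentEval_toCotangent, hce,
          part₁_mon_of_eq hN hv h₁.apply_eq]
      rw [hL, map_mul, map_pow, hX, hκq, part₀_mon_of_eq hN hv (h₁.rest_apply m),
        AddMonoidAlgebra.single_pow, one_pow, ← chr_add, h₁.rest_add, incl_mon]
    | add x y hx hy => rw [map_add, map_add, map_add, hx, hy]
    | smul z x hx =>
      rw [hsmul, map_mul, map_mul, map_mul, hx, hLc, hκq, AlgHom.commutes, AlgHom.commutes]
  have hinj : Function.Injective L := fun x y h => incl_injective (by rw [← hκ, ← hκ, h])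
  -- `L` and `q` agree on monomials of degree zero, and `q` kills the others.
  have hrq (x) : q x ∈ L.range := by
    induction x using coordRing_induction with
    | mon m =>
      by_cases h : m.1 v = 0
      · exact ⟨mon m, hL0 m h⟩
      · have : q (mon m) = 0 := by
          rw [hq, Ideal.Quotient.eq_zero_iff_mem.2 ((hmem m).2 h), map_zero]
        rw [this]
        exact zero_mem _
    | add x y hx hy => rw [map_add]; exact add_mem hx hy
    | smul z x hx => rw [hsmul, map_mul, ← hLc]; exact mul_mem ⟨_, rfl⟩ hx
  have hι (x : A) (hx : x ∈ I) : SymmetricAlgebra.ι _ _ (I.toCotangent ⟨x, hx⟩) ∈ L.range := by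
    have hXr : X ∈ L.range := by
      refine ⟨mon m₁, ?_⟩
      have h0 : h₁.rest hN hv m₁ = 0 := Subtype.ext (by
        change m₁.1 - ⌊m₁.1 v⌋₊ • m₁.1 = 0
        rw [h₁.apply_eq, Nat.floor_one, one_nsmul, sub_self])
      rw [hL, h0, h₁.apply_eq, mon_zero, map_one, one_mul, Nat.floor_one, pow_one]
    obtain ⟨b, hb⟩ := h₁.exists_mul_eq ((hI x).1 hx)
    have : (⟨x, hx⟩ : I) = e.symm b • ⟨e.symm (mon m₁), hm₁⟩ := Subtype.ext (by
      change x = e.symm b * e.symm (mon m₁)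
      rw [← map_mul, hb]; exact (e.symm_apply_apply x).symm)
    rw [this, map_smul]
    change SymmetricAlgebra.ι (A ⧸ I) I.Cotangent
      ((Ideal.Quotient.mk I (e.symm b)) • I.toCotangent ⟨e.symm (mon m₁), hm₁⟩) ∈ _
    rw [map_smul, Algebra.smul_def, ← hq]
    exact mul_mem (hrq b) hXr
  have hsurj : Function.Surjective L := by
    intro z
    change z ∈ L.range
    induction z using SymmetricAlgebra.induction with
    | algebraMap a =>
      obtain ⟨a, rfl⟩ := Ideal.Quotient.mk_surjective a
      rw [← hqa]
      exact hrq _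
    | ι x =>
      obtain ⟨x, rfl⟩ := Ideal.toCotangent_surjective _ x
      exact hι x.1 x.2
    | mul a b ha hb => exact mul_mem ha hb
    | add a b ha hb => exact add_mem ha hb
  refine ⟨RingEquiv.ofBijective L ⟨hinj, hsurj⟩, hκ, fun a => ?_⟩
  -- The zero section kills `X`, and thereby every monomial of positive degree, as reduction modulo
  -- `I` does.
  have hz (x) : SymmetricAlgebra.algebraMapInv (L x) = Ideal.Quotient.mk I (e.symm x) := by
    have hzq (x) : SymmetricAlgebra.algebraMapInv (q x) = Ideal.Quotient.mk I (e.symm x) :=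
      AlgHom.commutes _ _
    induction x using coordRing_induction with
    | mon m =>
      by_cases h : m.1 v = 0
      · rw [hL0 m h, hzq]
      · have hk : ⌊m.1 v⌋₊ ≠ 0 := fun h0 => h (by rw [← natFloor_apply hN hv, h0, Nat.cast_zero])
        rw [hL, map_mul, map_pow, SymmetricAlgebra.algebraMapInv_ι, zero_pow hk, mul_zero]
        exact (Ideal.Quotient.eq_zero_iff_mem.2 ((hmem m).2 h)).symm
    | add x y hx hy => simp only [map_add, hx, hy]
    | smul z x hx => rw [hsmul, map_mul, map_mul, hx, hLc, hzq, map_mul, map_mul]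
  exact (hz (e a)).trans (by rw [e.symm_apply_apply])

/-- After composition with the isomorphism `L` the map is the injective `incl`. Identities in the
symmetric algebra may thus be verified in the group algebra. -/
lemma symEval_injective (h₁ : IsRayCoordinate N τ v m₁) :
    Function.Injective (symEval hN hv c hI) := by
  obtain ⟨L, h, -⟩ := exists_symEquiv c hI hc h₁
  intro x y hxy
  obtain ⟨x, rfl⟩ := L.surjective x
  obtain ⟨y, rfl⟩ := L.surjective y
  rw [h, h] at hxy
  rw [incl_injective hxy]

end NormalBundleRing

/-! ### The normal bundle of a toric divisor -/

section NormalBundle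

open Scheme.AffineZariskiSite

namespace ModuleOver

variable {X T : Scheme.{0}} {t : T ⟶ X} {M : ModuleOver t} (h : M.IsQuasiCoherent)
  (U : X.AffineZariskiSite)

/-- The open immersion `Spec Sym M(U) → Spec_X Sym M`. -/
def totChart : Spec (.of (SymmetricAlgebra (M.ring U) (M.mod U))) ⟶ tot h := relSpecChart h U

lemma totChart_totMap :
    totChart h U ≫ totMap h = Spec.map (M.symStrHom U) ≫ U.2.fromSpec :=
  relSpecChart_relSpecMap h U

lemma totChart_totMap_assoc {Z : Scheme.{0}} (k : X ⟶ Z) :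
    totChart h U ≫ totMap h ≫ k = Spec.map (M.symStrHom U) ≫ U.2.fromSpec ≫ k := by
  rw [← Category.assoc, totChart_totMap, Category.assoc]

lemma ι_zeroSection : (t ⁻¹ᵁ U.toOpens).ι ≫ zeroSection h =
    (t ⁻¹ᵁ U.toOpens).toSpecΓ ≫ Spec.map (M.symZero U) ≫ totChart h U :=
  ι_relSpecLift h t M.symZero (fun i => M.symRes_symZero i.le) U

lemma ι_zeroSection_assoc {Z : Scheme.{0}} (k : tot h ⟶ Z) :
    (t ⁻¹ᵁ U.toOpens).ι ≫ zeroSection h ≫ k =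
      (t ⁻¹ᵁ U.toOpens).toSpecΓ ≫ Spec.map (M.symZero U) ≫ totChart h U ≫ k := by
  rw [← Category.assoc, ι_zeroSection, Category.assoc, Category.assoc]

end ModuleOver

variable {V : Type} [AddCommGroup V] [Module ℝ V] {N : Submodule ℤ V} (Ξ : Fan N) (v : V)

/-- The cones of the fan that contain `v`. -/
abbrev Fan.ConeAt : Type := {τ : Ξ.Cone // v ∈ τ.1}

/-- The charts of the cones that contain `v`. -/
def Fan.openAt : Ξ.ConeAt v ⥤ Ξ.toricVariety.AffineZariskiSite :=
  Monotone.functor (f := fun τ => Ξ.chartOpen τ.1) fun _ _ h => Ξ.chartOpen_le h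

variable {Ξ v}

/-- The intersection of two cones containing `v` again contains `v`, so overlaps need no other
charts. -/
lemma exists_coneAt_of_mem {τ η : Ξ.ConeAt v} {x : Ξ.toricVariety}
    (h1 : x ∈ Set.range (Ξ.chart τ.1)) (h2 : x ∈ Set.range (Ξ.chart η.1)) :
    ∃ κ : Ξ.ConeAt v, κ ≤ τ ∧ κ ≤ η ∧ x ∈ Set.range (Ξ.chart κ.1) := by
  obtain ⟨κ, h3, h4, hκ⟩ := Ξ.exists_mem_range_chart_of_mem h1 h2
  refine ⟨⟨⟨τ.1.1 ⊓ η.1.1, Ξ.face_mem _ η.1.2 _ (Ξ.inf_isFace _ τ.1.2 _ η.1.2)⟩, τ.2, η.2⟩,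
    inf_le_left (a := τ.1.1), inf_le_right (a := τ.1.1), Ξ.range_chart_subset ?_ hκ⟩
  exact le_inf (show κ.1 ≤ τ.1.1 from h3) (show κ.1 ≤ η.1.1 from h4)

variable (hN : v ∈ N) {ρ : Ξ.Cone} (hρ : ρ.1 = PointedCone.hull ℝ {v})

include hN hρ in
lemma exists_coneAt_of_mem_support {x : Ξ.toricVariety} (hx : x ∈ (Ξ.orbitIdeal ρ).support) :
    ∃ τ : Ξ.ConeAt v, x ∈ Set.range (Ξ.chart τ.1) := by
  obtain ⟨τ, hτ⟩ := Ξ.exists_mem_range_chart x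
  exact ⟨⟨τ, mem_of_mem_support hN hρ hx hτ⟩, hτ⟩

lemma chartHom_bijective (τ : Ξ.Cone) : Function.Bijective (Ξ.chartHom τ).hom :=
  ConcreteCategory.bijective_of_isIso (Ξ.chartHom τ)

include hN hρ in
lemma isGluing_tot_conormal (h : (conormal (Ξ.orbitIdeal ρ)).IsQuasiCoherent) :
    IsGluing (Ξ.openAt v ⋙ (conormal (Ξ.orbitIdeal ρ)).sym.rightOp ⋙ Scheme.Spec)
      (X := ModuleOver.tot h) (fun τ => ModuleOver.totChart h (Ξ.chartOpen τ.1)) :=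
  isGluing_relSpec h (Ξ.openAt v)
    (fun p => exists_coneAt_of_mem_support hN hρ (totMap_mem_support h p))
    (fun _ _ _ h1 h2 => exists_coneAt_of_mem h1 h2)

/-- The homomorphism `Sym(I/I²) → R` on the chart of `τ`. -/
def symEvalAt (τ : Ξ.ConeAt v) :
    SymmetricAlgebra ((conormal (Ξ.orbitIdeal ρ)).ring (Ξ.chartOpen τ.1))
      ((conormal (Ξ.orbitIdeal ρ)).mod (Ξ.chartOpen τ.1)) →+* torusRing V :=
  symEval hN τ.2 (Ξ.chartHom τ.1).hom (mem_idealAt_orbitIdeal hN hρ τ.2)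

/-- The evaluation is built from the parts of degree zero and one, which do not depend on the chart.
-/
lemma symEvalAt_symRes {τ η : Ξ.ConeAt v} (h : τ ≤ η) (x) :
    symEvalAt hN hρ τ ((conormal (Ξ.orbitIdeal ρ)).symRes (Ξ.chartOpen_le h) x) =
      symEvalAt hN hρ η x := by
  have : (symEvalAt hN hρ τ).comp ((conormal (Ξ.orbitIdeal ρ)).symRes (Ξ.chartOpen_le h)).hom =
      symEvalAt hN hρ η := by
    refine sym_hom_ext (fun a => ?_) fun x => ?_
    · obtain ⟨a, rfl⟩ := Ideal.Quotient.mk_surjective a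
      refine (congrArg (symEvalAt hN hρ τ) (symMap_algebraMap _ _
        ((conormal (Ξ.orbitIdeal ρ)).modRes_smul (Ξ.chartOpen_le h)) _)).trans ?_
      refine (symLift_algebraMap _ _ (cotangentEval_smul hN τ.2 _ _) _).trans
        (Eq.trans ?_ (symLift_algebraMap _ _ (cotangentEval_smul hN η.2 _ _) _).symm)
      change part₀ hN τ.2 (Ξ.chartHom τ.1 (res (Ξ.chartOpen_le h) a)) =
        part₀ hN η.2 (Ξ.chartHom η.1 a)
      rw [Ξ.chartHom_res (show τ.1 ≤ η.1 from h), part₀_coordMap]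
    · obtain ⟨x, rfl⟩ := Ideal.toCotangent_surjective _ x
      refine (congrArg (symEvalAt hN hρ τ) (symMap_ι _ _
        ((conormal (Ξ.orbitIdeal ρ)).modRes_smul (Ξ.chartOpen_le h)) _)).trans ?_
      refine (symLift_ι _ _ (cotangentEval_smul hN τ.2 _ _) _).trans
        (Eq.trans ?_ (symLift_ι _ _ (cotangentEval_smul hN η.2 _ _) _).symm)
      refine (congrArg _ (conormalRes_mk _ (Ξ.chartOpen_le h) x)).trans ?_
      change part₁ hN τ.2 (Ξ.chartHom τ.1 (res (Ξ.chartOpen_le h) x.1)) =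
        part₁ hN η.2 (Ξ.chartHom η.1 x.1)
      rw [Ξ.chartHom_res (show τ.1 ≤ η.1 from h), part₁_coordMap]
  exact congr($this x)

variable (hcoord : ∀ τ : Ξ.ConeAt v, ∃ m₁, IsRayCoordinate N τ.1.1 v m₁)

include hcoord

lemma symEvalAt_injective (τ : Ξ.ConeAt v) : Function.Injective (symEvalAt hN hρ τ) := by
  obtain ⟨m₁, h₁⟩ := hcoord τ
  exact symEval_injective _ _ (chartHom_bijective τ.1) h₁

lemma exists_symEquivAt (τ : Ξ.ConeAt v) :
    ∃ L : CommRingCat.of (coordRing N τ.1.1) ≅ CommRingCat.of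
        (SymmetricAlgebra ((conormal (Ξ.orbitIdeal ρ)).ring (Ξ.chartOpen τ.1))
          ((conormal (Ξ.orbitIdeal ρ)).mod (Ξ.chartOpen τ.1))),
      (∀ x, symEvalAt hN hρ τ (L.hom x) = incl N τ.1.1 x) ∧
      ∀ a, (conormal (Ξ.orbitIdeal ρ)).symZero (Ξ.chartOpen τ.1) (L.hom (Ξ.chartHom τ.1 a)) =
        (Ξ.orbitIdeal ρ).subschemeι.app (Ξ.chartOpen τ.1).toOpens a := by
  obtain ⟨m₁, h₁⟩ := hcoord τ
  obtain ⟨L, h2, h3⟩ := exists_symEquiv _ (mem_idealAt_orbitIdeal hN hρ τ.2)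
    (chartHom_bijective τ.1) h₁
  refine ⟨L.toCommRingCatIso, h2, fun a => ?_⟩
  exact congrArg ((conormal (Ξ.orbitIdeal ρ)).toSections (Ξ.chartOpen τ.1)) (h3 a)

-- A cone of the star is a face of a full-dimensional cone with the face `ρ`, and this larger cone
-- contains `v` even if its face does not.
omit hcoord in
include hρ in
lemma exists_coneAt_starFan (hstar : ∀ τ ∈ Ξ.cones, v ∈ τ → τ ∈ (Ξ.starFan ρ.1).cones)
    (x : (Ξ.starFan ρ.1).toricVariety) : ∃ τ : Ξ.ConeAt v,
      x ∈ Set.range ((Ξ.starFan ρ.1).chart ⟨τ.1.1, hstar τ.1.1 τ.1.2 τ.2⟩) := by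
  obtain ⟨τ, hτ⟩ := (Ξ.starFan ρ.1).exists_mem_range_chart x
  obtain ⟨η, hη, ⟨m, -, hm⟩, ⟨m', -, hm'⟩⟩ := τ.2
  have hv : v ∈ η := by
    have := mem_ray hρ
    rw [hm] at this
    exact this.1
  refine ⟨⟨⟨η, hη.1⟩, hv⟩, (Ξ.starFan ρ.1).range_chart_subset ?_ hτ⟩
  change τ.1 ≤ η
  rw [hm']
  exact inf_le_left

-- The star is exhibited as glued from the diagram that also glues the normal bundle; `L` carries
-- one system of charts to the other.
omit hcoord in
include hρ in
lemma isGluing_starFan (hstar : ∀ τ ∈ Ξ.cones, v ∈ τ → τ ∈ (Ξ.starFan ρ.1).cones)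
    (L : ∀ τ : Ξ.ConeAt v, CommRingCat.of (coordRing N τ.1.1) ≅ CommRingCat.of
        (SymmetricAlgebra ((conormal (Ξ.orbitIdeal ρ)).ring (Ξ.chartOpen τ.1))
          ((conormal (Ξ.orbitIdeal ρ)).mod (Ξ.chartOpen τ.1))))
    (hL : ∀ {τ η : Ξ.ConeAt v} (h : τ ≤ η) (x : coordRing N η.1.1),
      (conormal (Ξ.orbitIdeal ρ)).symRes (Ξ.chartOpen_le h) ((L η).hom x) = (L τ).hom (coordMap N h x)) :
    IsGluing (Ξ.openAt v ⋙ (conormal (Ξ.orbitIdeal ρ)).sym.rightOp ⋙ Scheme.Spec)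
      (fun τ => Spec.map (L τ).hom ≫
        (Ξ.starFan ρ.1).chart ⟨τ.1.1, hstar τ.1.1 τ.1.2 τ.2⟩) := by
  have hnat {τ η : Ξ.ConeAt v} (h : τ ≤ η) :
      Spec.map ((conormal (Ξ.orbitIdeal ρ)).symRes (Ξ.chartOpen_le h)) ≫ Spec.map (L η).hom ≫
        (Ξ.starFan ρ.1).chart ⟨η.1.1, hstar η.1.1 η.1.2 η.2⟩ = Spec.map (L τ).hom ≫
        (Ξ.starFan ρ.1).chart ⟨τ.1.1, hstar τ.1.1 τ.1.2 τ.2⟩ := by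
    rw [← (Ξ.starFan ρ.1).chartMap_chart (τ := ⟨τ.1.1, hstar τ.1.1 τ.1.2 τ.2⟩)
      (η := ⟨η.1.1, hstar η.1.1 η.1.2 η.2⟩) h, Fan.chartMap, ← Spec.map_comp_assoc,
      ← Spec.map_comp_assoc]
    congr 2
    exact CommRingCat.hom_ext (RingHom.ext fun x => hL h x)
  have himm (τ : Ξ.ConeAt v) : IsOpenImmersion (Spec.map (L τ).hom ≫
    (Ξ.starFan ρ.1).chart ⟨τ.1.1, hstar τ.1.1 τ.1.2 τ.2⟩) := inferInstance
  have hrange (τ : Ξ.ConeAt v) : Set.range (Spec.map (L τ).hom ≫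
        (Ξ.starFan ρ.1).chart ⟨τ.1.1, hstar τ.1.1 τ.1.2 τ.2⟩) =
      Set.range ((Ξ.starFan ρ.1).chart ⟨τ.1.1, hstar τ.1.1 τ.1.2 τ.2⟩) := by
    refine Set.Subset.antisymm ?_ ?_
    · rintro _ ⟨x, rfl⟩
      exact ⟨_, (Scheme.Hom.comp_apply _ _ _).symm⟩
    · rintro _ ⟨x, rfl⟩
      refine ⟨inv (Spec.map (L τ).hom) x, ?_⟩
      rw [← Scheme.Hom.comp_apply, IsIso.inv_hom_id_assoc]
  refine ⟨fun h => hnat h.le, himm, fun x => ?_, fun {τ η} x h1 h2 => ?_⟩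
  · obtain ⟨τ, hτ⟩ := exists_coneAt_starFan hρ hstar x
    exact ⟨τ, (hrange τ).ge hτ⟩
  · have h1 := (hrange τ).le h1
    have h2 := (hrange η).le h2
    obtain ⟨κ, h3, h4, hκ⟩ := (Ξ.starFan ρ.1).exists_mem_range_chart_of_mem h1 h2
    let μ : Ξ.ConeAt v := ⟨⟨τ.1.1 ⊓ η.1.1, Ξ.face_mem _ η.1.2 _ (Ξ.inf_isFace _ τ.1.2 _ η.1.2)⟩,
      τ.2, η.2⟩
    refine ⟨μ, inf_le_left (a := τ.1.1), inf_le_right (a := τ.1.1), (hrange μ).ge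
      ((Ξ.starFan ρ.1).range_chart_subset ?_ hκ)⟩
    exact le_inf (show κ.1 ≤ τ.1.1 from h3) (show κ.1 ≤ η.1.1 from h4)

include hN hρ in
/-- The total space of the normal bundle of the orbit closure of a ray is the toric variety of the
star of the ray. -/
lemma exists_tot_conormal_iso (hstar : ∀ τ ∈ Ξ.cones, v ∈ τ → τ ∈ (Ξ.starFan ρ.1).cones)
    (h : (conormal (Ξ.orbitIdeal ρ)).IsQuasiCoherent) :
    ∃ e : ModuleOver.tot h ≅ (Ξ.starFan ρ.1).toricVariety,
      e.hom ≫ (Ξ.starFan ρ.1).structureMap = ModuleOver.totMap h ≫ Ξ.structureMap ∧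
      ModuleOver.zeroSection h ≫ e.hom ≫ Fan.subfanMap (Ξ.starFan_subset ρ.1) =
        (Ξ.orbitIdeal ρ).subschemeι := by
  choose L hL hLz using exists_symEquivAt hN hρ hcoord
  obtain ⟨e, he⟩ : ∃ e : ModuleOver.tot h ≅ (Ξ.starFan ρ.1).toricVariety, ∀ τ : Ξ.ConeAt v,
      ModuleOver.totChart h (Ξ.chartOpen τ.1) ≫ e.hom =
        Spec.map (L τ).hom ≫ (Ξ.starFan ρ.1).chart ⟨τ.1.1, hstar τ.1.1 τ.1.2 τ.2⟩ :=
    (isGluing_tot_conormal hN hρ h).exists_iso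
      -- In the group algebra both sides become the inclusion of `x`.
      (isGluing_starFan hρ hstar L fun {τ η} h x => by
        apply symEvalAt_injective hN hρ hcoord τ
        rw [symEvalAt_symRes hN hρ h, hL, hL, incl_coordMap])
  have hsub (τ : Ξ.ConeAt v) : (Ξ.starFan ρ.1).chart ⟨τ.1.1, hstar τ.1.1 τ.1.2 τ.2⟩ ≫
    Fan.subfanMap (Ξ.starFan_subset ρ.1) = Ξ.chart τ.1 := Fan.chart_subfanMap _ _
  refine ⟨e, ?_, ?_⟩
  · have key (τ : Ξ.ConeAt v) : ModuleOver.totChart h (Ξ.chartOpen τ.1) ≫ e.hom ≫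
        (Ξ.starFan ρ.1).structureMap = ModuleOver.totChart h (Ξ.chartOpen τ.1) ≫
          ModuleOver.totMap h ≫ Ξ.structureMap := by
      have h3 : (Ξ.chartOpen τ.1).2.fromSpec = inv (Spec.map (Ξ.chartHom τ.1)) ≫ Ξ.chart τ.1 := by
        rw [IsIso.eq_inv_comp, Ξ.SpecMap_chartHom]
      rw [← Fan.subfanMap_structureMap (Ξ.starFan_subset ρ.1), reassoc_of% (he τ),
        reassoc_of% (hsub τ), ModuleOver.totChart_totMap_assoc, h3, Category.assoc,
        Fan.chart_structureMap, ← Spec.map_inv, ← Spec.map_comp, ← Spec.map_comp, ← Spec.map_comp]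
      congr 1
      refine CommRingCat.hom_ext (RingHom.ext fun z => ?_)
      change (L τ).hom (algebraMap ℂ _ z) = (conormal (Ξ.orbitIdeal ρ)).symStrHom (Ξ.chartOpen τ.1)
        (inv (Ξ.chartHom τ.1) (algebraMap ℂ _ z))
      apply symEvalAt_injective hN hρ hcoord τ
      rw [hL, AlgHom.commutes]
      refine Eq.trans ?_ (symLift_algebraMap _ _ (cotangentEval_smul hN τ.2 _ _) _).symm
      change _ = part₀ hN τ.2 (Ξ.chartHom τ.1 (inv (Ξ.chartHom τ.1) (algebraMap ℂ _ z)))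
      have : Ξ.chartHom τ.1 (inv (Ξ.chartHom τ.1) (algebraMap ℂ (coordRing N τ.1.1) z)) =
          algebraMap ℂ _ z := by
        rw [← CommRingCat.comp_apply, IsIso.inv_hom_id]
        rfl
      rw [this, AlgHom.commutes]
    exact (isGluing_tot_conormal hN hρ h).hom_ext key
  · refine Scheme.hom_ext_of_forall _ _ fun x => ?_
    obtain ⟨τ, hτ⟩ := exists_coneAt_of_mem_support hN hρ
      (x := (Ξ.orbitIdeal ρ).subschemeι x) (by
        rw [← SetLike.mem_coe, ← Scheme.IdealSheafData.range_subschemeι]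
        exact ⟨x, rfl⟩)
    refine ⟨(Ξ.orbitIdeal ρ).subschemeι ⁻¹ᵁ (Ξ.chartOpen τ.1).toOpens, hτ, ?_⟩
    -- On the chart the zero section is given by `symZero`, which under `L` becomes restriction of
    -- functions to the orbit closure.
    have h3 : Ξ.chartHom τ.1 ≫ (L τ).hom ≫
        (conormal (Ξ.orbitIdeal ρ)).symZero (Ξ.chartOpen τ.1) =
          (Ξ.orbitIdeal ρ).subschemeι.app (Ξ.chartOpen τ.1).toOpens :=
      CommRingCat.hom_ext (RingHom.ext fun a => hLz τ a)
    rw [ModuleOver.ι_zeroSection_assoc, reassoc_of% (he τ), hsub, ← Ξ.SpecMap_chartHom,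
      ← Spec.map_comp_assoc, ← Spec.map_comp_assoc, h3,
      Scheme.Opens.toSpecΓ_naturality_assoc, IsAffineOpen.toSpecΓ_fromSpec, morphismRestrict_ι]

end NormalBundle

/-! ### Forms on an algebra with coordinates -/

section Derivations

variable {V : Type} [AddCommGroup V] [Module ℝ V]

/-- The homomorphism `χ^m ↦ (1 + ⟨m, u⟩ε) χ^m` to the dual numbers. -/
def dualNumberHom (u : V) : torusRing V →ₐ[ℂ] TrivSqZeroExt (torusRing V) (torusRing V) :=
  AddMonoidAlgebra.lift ℂ (TrivSqZeroExt (torusRing V) (torusRing V)) (Module.Dual ℝ V)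
    { toFun := fun m => TrivSqZeroExt.inl (chr m.toAdd) +
        TrivSqZeroExt.inr ((m.toAdd u : ℂ) • chr m.toAdd)
      map_one' := by
        ext
        · simp [chr_zero]
        · simp
      map_mul' := fun m m' => by
        rw [toAdd_mul, chr_add]
        ext
        · simp
        · simp only [LinearMap.add_apply, Complex.ofReal_add, TrivSqZeroExt.snd_add,
            TrivSqZeroExt.snd_inl, TrivSqZeroExt.snd_inr, zero_add, TrivSqZeroExt.snd_mul,
            TrivSqZeroExt.fst_add, TrivSqZeroExt.fst_inl, TrivSqZeroExt.fst_inr, add_zero,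
            smul_eq_mul, op_smul_eq_mul, add_smul, smul_mul_assoc, mul_smul_comm]
          rw [add_comm] }

lemma dualNumberHom_chr (u : V) (m : Module.Dual ℝ V) : dualNumberHom u (chr m) =
    TrivSqZeroExt.inl (chr m) + TrivSqZeroExt.inr ((m u : ℂ) • chr m) := by
  simp [dualNumberHom]

lemma fst_dualNumberHom (u : V) (x : torusRing V) : (dualNumberHom u x).fst = x := by
  induction x using AddMonoidAlgebra.induction_on with
  | of m =>
    change (dualNumberHom u (chr m)).fst = chr m
    rw [dualNumberHom_chr]
    simp
  | add x y hx hy => rw [map_add, TrivSqZeroExt.fst_add, hx, hy]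
  | smul c x hx => rw [map_smul, TrivSqZeroExt.fst_smul, hx]

/-- The derivation `χ^m ↦ ⟨m, u⟩ χ^m`. -/
def dirDeriv (u : V) : Derivation ℂ (torusRing V) (torusRing V) :=
  Derivation.mk'
    { toFun := fun x => (dualNumberHom u x).snd
      map_add' := fun x y => by rw [map_add, TrivSqZeroExt.snd_add]
      map_smul' := fun c x => by rw [map_smul, TrivSqZeroExt.snd_smul, RingHom.id_apply] }
    fun x y => by
      change (dualNumberHom u (x * y)).snd = x • (dualNumberHom u y).snd + y • (dualNumberHom u x).snd
      rw [map_mul, TrivSqZeroExt.snd_mul, fst_dualNumberHom, fst_dualNumberHom]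
      simp only [smul_eq_mul, op_smul_eq_mul]
      ring

lemma dirDeriv_chr (u : V) (m : Module.Dual ℝ V) : dirDeriv u (chr m) = (m u : ℂ) • chr m := by
  change (dualNumberHom u (chr m)).snd = _
  rw [dualNumberHom_chr]
  simp

end Derivations

/-! ### Linear maps on a cyclic module of top forms -/

section CyclicForms

open KaehlerDifferential

/-- If the differentials of `y₁, …, y_d` generate, then `dy₁ ∧ ⋯ ∧ dy_d` generates the forms of
degree `d`. -/
lemma linearMap_ext_of_coordinates {k A Q : Type} [CommRing k] [CommRing A] [Algebra k A] {d : ℕ}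
    [AddCommGroup Q] [Module A Q] {y : Fin d → A}
    (hy : Submodule.span A (Set.range fun i => D k A (y i)) = ⊤)
    {φ ψ : ⋀[A]^d Ω[A⁄k] →ₗ[A] Q} (h : φ (dform k y) = ψ (dform k y)) : φ = ψ := by
  refine linearMap_ext_of_span (s := Set.range y) ?_ fun a ha => ?_
  · rw [← Set.range_comp]
    exact hy
  · choose f hf using ha
    obtain rfl : y ∘ f = a := funext hf
    by_cases hinj : Function.Injective f
    · let σ : Equiv.Perm (Fin d) := Equiv.ofBijective f (Finite.injective_iff_bijective.1 hinj)
      have : dform k (y ∘ f) = Equiv.Perm.sign σ • dform k y :=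
        (exteriorPower.ιMulti A d).map_perm (fun i => D k A (y i)) σ
      rw [this]
      rcases Int.units_eq_one_or (Equiv.Perm.sign σ) with h' | h' <;> rw [h'] <;> simp [h]
    · obtain ⟨i, j, hij, hne⟩ : ∃ i j, f i = f j ∧ i ≠ j := by
        simpa [Function.Injective] using hinj
      have : dform k (y ∘ f) = 0 := (exteriorPower.ιMulti A d).map_eq_zero_of_eq _
        (by simp [hij]) hne
      rw [this, map_zero, map_zero]

variable {R B : Type} [CommRing R] [CommRing B] [Algebra ℂ R] [Algebra ℂ B] {d : ℕ}
  (j : B →ₐ[ℂ] R) (hj : Function.Injective j) (δ : Fin d → Derivation ℂ R R)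

/-- The determinant of the values of the derivations `δ` on `d` elements of `B`. -/
def jacobian (b : Fin d → B) : R := Matrix.det (Matrix.of fun i k => δ k (j (b i)))

include hj

/-- The determinant of derivations is a linear form with values in `R`. The forms are generated by
`dy₁ ∧ ⋯ ∧ dy_d`, so its multiple by `q` takes values in `B` as soon as it does so there, which is
`hw`. -/
lemma exists_linearMap_jacobian {y : Fin d → B}
    (hy : Submodule.span B (Set.range fun i => D ℂ B (y i)) = ⊤) (q : R) (w : B)
    (hw : q * jacobian j δ y = j w) :
    ∃ φ : ⋀[B]^d Ω[B⁄ℂ] →ₗ[B] B, ∀ b, j (φ (dform ℂ b)) = q * jacobian j δ b := by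
  let : Algebra B R := j.toRingHom.toAlgebra
  have : IsScalarTower ℂ B R := .of_algebraMap_eq fun c => (j.commutes c).symm
  let Δ : ⋀[R]^d Ω[R⁄ℂ] →ₗ[R] R := exteriorPower.alternatingMapLinearEquiv
    ((Matrix.detRowAlternating (n := Fin d) (R := R)).compLinearMap
      (LinearMap.pi fun k => (δ k).liftKaehlerDifferential))
  obtain ⟨ψ, hψ⟩ := exists_linearMap_comp_dform (A := B) Δ
  have hψ' (b : Fin d → B) : ψ (dform ℂ b) = jacobian j δ b := by
    rw [hψ, dform, exteriorPower.alternatingMapLinearEquiv_apply_ιMulti]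
    refine congrArg Matrix.det (Matrix.ext fun i k => ?_)
    exact Derivation.liftKaehlerDifferential_comp_D _ _
  let Q : Submodule B R := LinearMap.range (Algebra.linearMap B R)
  let qψ : ⋀[B]^d Ω[B⁄ℂ] →ₗ[B] R := (LinearMap.mulLeft B q).comp ψ
  have hqψ (b : Fin d → B) : qψ (dform ℂ b) = q * jacobian j δ b := congrArg (q * ·) (hψ' b)
  -- Values in `B` mean vanishing in `R / B`, which can be tested on the generator.
  have hQ : Q.mkQ.comp qψ = 0 := by
    refine linearMap_ext_of_coordinates hy ?_
    rw [LinearMap.comp_apply, hqψ, hw, LinearMap.zero_apply, Submodule.mkQ_apply,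
      Submodule.Quotient.mk_eq_zero]
    exact ⟨w, rfl⟩
  have hmem (z) : qψ z ∈ Q := by
    rw [← Submodule.Quotient.mk_eq_zero]
    exact congr($hQ z)
  let E := LinearEquiv.ofInjective (Algebra.linearMap B R) hj
  refine ⟨E.symm.toLinearMap.comp (qψ.codRestrict Q hmem), fun b => ?_⟩
  have := congrArg Subtype.val (E.apply_symm_apply ((qψ.codRestrict Q hmem) (dform ℂ b)))
  exact this.trans (hqψ b)

/-- Sections of a line bundle with the generator `x₁`, realized in a domain `R` by `e`, are
identified with the linear maps on forms. -/
lemma exists_equiv_forms {C M : Type} [CommRing C] [AddCommGroup M] [Module C M] (r : C →+* B)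
    (hr : Function.Bijective r) (e : M →+ R) (he : ∀ (c : C) (x : M), e (c • x) = j (r c) * e x)
    (x₁ : M) (hx₁ : ∀ x : M, ∃ c : C, c • x₁ = x) {y : Fin d → B}
    (hy : Submodule.span B (Set.range fun i => D ℂ B (y i)) = ⊤) (q : R) (w : B) (hwu : IsUnit w)
    (hw : q * e x₁ * jacobian j δ y = j w) :
    ∃ T : M ≃+ (⋀[B]^d Ω[B⁄ℂ] →ₗ[B] B), ∀ x b,
      j (T x (dform ℂ b)) = q * e x * jacobian j δ b := by
  have H (x : M) : ∃ φ : ⋀[B]^d Ω[B⁄ℂ] →ₗ[B] B, ∀ b,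
      j (φ (dform ℂ b)) = q * e x * jacobian j δ b := by
    obtain ⟨c, rfl⟩ := hx₁ x
    refine exists_linearMap_jacobian j hj δ hy _ (r c * w) ?_
    rw [he, map_mul, ← hw]
    ring
  choose T hT using H
  let T' : M →+ (⋀[B]^d Ω[B⁄ℂ] →ₗ[B] B) :=
    { toFun := T
      map_zero' := linearMap_ext_dform fun b => hj (by rw [hT]; simp)
      map_add' := fun x x' => linearMap_ext_dform fun b => hj (by
        rw [hT, LinearMap.add_apply, map_add j, hT, hT, map_add]
        ring) }
  refine ⟨AddEquiv.ofBijective T' ⟨?_, fun φ => ?_⟩, hT⟩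
  · rw [injective_iff_map_eq_zero]
    intro x hx
    obtain ⟨c, rfl⟩ := hx₁ x
    have h1 := hT (c • x₁) y
    have h0 : T (c • x₁) = 0 := hx
    rw [h0, LinearMap.zero_apply, map_zero, he] at h1
    have h2 : j (r c * w) = j 0 := by
      rw [map_mul, ← hw, map_zero, h1]
      ring
    have h3 : r c = 0 := by simpa [hwu.mul_left_eq_zero] using hj h2
    rw [(injective_iff_map_eq_zero r).1 hr.1 c h3, zero_smul]
  -- The generator `x₁` has the unit `w` as value on `dy₁ ∧ ⋯ ∧ dy_d`, so `φ` is `x₁` times the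
  -- value of `φ` divided by `w`.
  · obtain ⟨w', hw'⟩ := hwu.exists_right_inv
    obtain ⟨c, hc⟩ := hr.2 (φ (dform ℂ y) * w')
    refine ⟨c • x₁, linearMap_ext_of_coordinates hy (hj ?_)⟩
    refine (hT _ _).trans ?_
    have : φ (dform ℂ y) = r c * w := by rw [hc, mul_assoc, mul_comm w', hw', mul_one]
    rw [he, this, map_mul, ← hw]
    ring

end CyclicForms

/-! ### Bases adapted to a cone -/

section AdaptedBasis

variable {V : Type} [AddCommGroup V] [Module ℝ V] {N : Submodule ℤ V} {τ : PointedCone ℝ V}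
  {v : V} {d : ℕ}

/-- A linear form that is nonnegative on generators is nonnegative on the cone. -/
lemma nonneg_of_mem_hull {S : Set V} {m : Module.Dual ℝ V} (h : ∀ u ∈ S, 0 ≤ m u) {x : V}
    (hx : x ∈ PointedCone.hull ℝ S) : 0 ≤ m x := by
  induction hx using Submodule.span_induction with
  | mem u hu => exact h u hu
  | zero => simp
  | add a b _ _ ha hb => rw [map_add]; exact add_nonneg ha hb
  | smul c a _ ha =>
    have : m (c • a) = (c : ℝ) * m a := by
      change m ((c : ℝ) • a) = _
      rw [map_smul, smul_eq_mul]
    rw [this]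
    exact mul_nonneg c.2 ha

/-- `b` is a `ℤ`-basis of `N` that contains `v` and of which a part generates the cone `τ ∋ v`. -/
structure IsAdaptedBasis (N : Submodule ℤ V) (τ : PointedCone ℝ V) (v : V)
    (b : Module.Basis (Fin (d + 1)) ℝ V) (s : Set (Fin (d + 1))) : Prop where
  mem_iff : ∀ x, x ∈ N ↔ ∀ i, ∃ k : ℤ, b.coord i x = k
  eq_hull : τ = PointedCone.hull ℝ (b '' s)
  zero_mem : 0 ∈ s
  apply_zero : b 0 = v

namespace IsAdaptedBasis

variable {b : Module.Basis (Fin (d + 1)) ℝ V} {s : Set (Fin (d + 1))}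
  (hb : IsAdaptedBasis N τ v b s)

include hb

lemma basis_mem (i : Fin (d + 1)) : b i ∈ N := by
  rw [hb.mem_iff]
  intro k
  rw [Module.Basis.coord_apply, Module.Basis.repr_self, Finsupp.single_apply]
  split_ifs
  · exact ⟨1, by simp⟩
  · exact ⟨0, by simp⟩

lemma basis_mem_cone {i : Fin (d + 1)} (hi : i ∈ s) : b i ∈ τ := by
  rw [hb.eq_hull]
  exact Submodule.subset_span ⟨i, hi, rfl⟩

lemma mem_lattice : v ∈ N := hb.apply_zero ▸ hb.basis_mem 0

lemma mem_cone : v ∈ τ := hb.apply_zero ▸ hb.basis_mem_cone hb.zero_mem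

lemma mem_dualMonoid_iff (m : Module.Dual ℝ V) : m ∈ dualMonoid N τ ↔
    (∀ i, ∃ k : ℤ, m (b i) = k) ∧ ∀ i ∈ s, 0 ≤ m (b i) := by
  refine ⟨fun h => ⟨fun i => h.1 _ (hb.basis_mem i), fun i hi => h.2 _ (hb.basis_mem_cone hi)⟩,
    fun h => ⟨fun u hu => ?_, fun u hu => ?_⟩⟩
  · choose k hk using (hb.mem_iff u).1 hu
    choose l hl using h.1
    refine ⟨∑ i, k i * l i, ?_⟩
    conv_lhs => rw [← b.sum_repr u]
    rw [map_sum, Int.cast_sum]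
    refine Finset.sum_congr rfl fun i _ => ?_
    rw [map_smul, hl, Int.cast_mul, ← hk i, smul_eq_mul, Module.Basis.coord_apply]
  · rw [hb.eq_hull] at hu
    refine nonneg_of_mem_hull ?_ hu
    rintro _ ⟨i, hi, rfl⟩
    exact h.2 i hi

lemma coord_mem (i : Fin (d + 1)) : b.coord i ∈ dualMonoid N τ := by
  rw [hb.mem_dualMonoid_iff]
  have (k : Fin (d + 1)) : b.coord i (b k) = if k = i then 1 else 0 := by
    rw [Module.Basis.coord_apply, Module.Basis.repr_self, Finsupp.single_apply]
  refine ⟨fun k => ?_, fun k _ => ?_⟩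
  · rw [this]
    split_ifs
    · exact ⟨1, by simp⟩
    · exact ⟨0, by simp⟩
  · rw [this]
    split_ifs <;> simp

lemma neg_coord_mem {i : Fin (d + 1)} (hi : i ∉ s) : -b.coord i ∈ dualMonoid N τ := by
  refine (hb.mem_dualMonoid_iff _).2 ⟨fun k => ?_, fun k hk => ?_⟩
  · obtain ⟨l, hl⟩ := ((hb.mem_dualMonoid_iff _).1 (hb.coord_mem i)).1 k
    exact ⟨-l, by simp [← hl]⟩
  · have : k ≠ i := fun h => hi (h ▸ hk)
    simp [this]

/-- Among the basis vectors, subtracting the coordinate dual to `v` changes only the value at `v`,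
which was at least one. -/
lemma isRayCoordinate : IsRayCoordinate N τ v ⟨b.coord 0, hb.coord_mem 0⟩ where
  apply_eq := by simp [← hb.apply_zero]
  sub_mem m hm h1 := by
    rw [hb.mem_dualMonoid_iff] at hm ⊢
    refine ⟨fun i => ?_, fun i hi => ?_⟩
    · obtain ⟨k, hk⟩ := hm.1 i
      obtain ⟨l, hl⟩ := ((hb.mem_dualMonoid_iff _).1 (hb.coord_mem 0)).1 i
      exact ⟨k - l, by rw [LinearMap.sub_apply, hk, hl, Int.cast_sub]⟩
    · by_cases h : i = 0
      · rw [h, hb.apply_zero, LinearMap.sub_apply]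
        simp only [← hb.apply_zero, Module.Basis.coord_apply, Module.Basis.repr_self,
          Finsupp.single_eq_same] at h1 ⊢
        linarith
      · have := hm.2 i hi
        simpa [LinearMap.sub_apply, h] using this

/-- In the dual basis `m` has integral coefficients, zero at `v` and nonnegative along the
generators of the cone. Negative coefficients occur only outside `s`, where the coordinate is
invertible. -/
lemma mem_closure {m : Module.Dual ℝ V} (hm : m ∈ dualMonoid N τ) (h0 : m v = 0) :
    m ∈ AddSubmonoid.closure ((Set.range fun i : Fin d => b.coord i.succ) ∪
      {x | ∃ i : Fin d, i.succ ∉ s ∧ x = -b.coord i.succ}) := by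
  have hsum : m = ∑ i : Fin d, m (b i.succ) • b.coord i.succ := by
    refine b.ext fun k => ?_
    refine Fin.cases ?_ (fun k => ?_) k
    · rw [hb.apply_zero, h0, LinearMap.sum_apply]
      refine (Finset.sum_eq_zero fun i _ => ?_).symm
      simp [← hb.apply_zero]
    · rw [LinearMap.sum_apply, Finset.sum_eq_single k]
      · simp
      · intro i _ hi
        simp [Ne.symm hi]
      · simp
  rw [hsum]
  rw [hb.mem_dualMonoid_iff] at hm
  refine sum_mem fun i _ => ?_
  obtain ⟨k, hk⟩ := hm.1 i.succ
  have hpos (l : ℕ) : (l : ℝ) • b.coord i.succ = l • b.coord i.succ := by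
    ext x
    simp
  have hgen : b.coord i.succ ∈ AddSubmonoid.closure
      ((Set.range fun i : Fin d => b.coord i.succ) ∪
        {x | ∃ i : Fin d, i.succ ∉ s ∧ x = -b.coord i.succ}) :=
    AddSubmonoid.subset_closure (Set.mem_union_left _ ⟨i, rfl⟩)
  rw [hk]
  by_cases hi : i.succ ∈ s
  · have h := hm.2 _ hi
    rw [hk] at h
    obtain ⟨l, rfl⟩ := Int.eq_ofNat_of_zero_le (by exact_mod_cast h)
    rw [Int.cast_natCast, hpos]
    exact AddSubmonoid.nsmul_mem _ hgen _
  · obtain ⟨l, rfl | rfl⟩ := Int.eq_nat_or_neg k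
    · rw [Int.cast_natCast, hpos]
      exact AddSubmonoid.nsmul_mem _ hgen _
    · have hneg : ((-(l : ℤ) : ℤ) : ℝ) • b.coord i.succ = l • (-b.coord i.succ) := by
        ext x
        simp
      rw [hneg]
      refine AddSubmonoid.nsmul_mem _ (AddSubmonoid.subset_closure (Set.mem_union_right _ ?_)) _
      exact ⟨i, hi, rfl⟩

/-- Both bases begin with `v`, so the first column of the transition matrix is a unit vector;
expansion along it leaves this minor. -/
lemma det_ne_zero (c : Module.Basis (Fin (d + 1)) ℝ V) (hc : c 0 = v) :
    Matrix.det (Matrix.of fun i k : Fin d => b.coord i.succ (c k.succ)) ≠ 0 := by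
  have h := b.isUnit_det c
  rw [Module.Basis.det_apply, Matrix.det_succ_column_zero, Finset.sum_eq_single 0] at h
  · have h1 : b.toMatrix c 0 0 = 1 := by
      rw [Module.Basis.toMatrix_apply, hc, ← hb.apply_zero]
      simp
    rw [h1] at h
    convert h.ne_zero using 1
    simp only [Fin.val_zero, pow_zero, one_mul]
    rfl
  · intro i _ hi
    have : b.toMatrix c i 0 = 0 := by
      rw [Module.Basis.toMatrix_apply, hc, ← hb.apply_zero]
      simp [Ne.symm hi]
    rw [this, mul_zero, zero_mul]
  · simp

end IsAdaptedBasis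

end AdaptedBasis

/-! ### Forms on the orbit closure in a chart -/

section FormsOnChart

open KaehlerDifferential

variable {V : Type} [AddCommGroup V] [Module ℝ V] {N : Submodule ℤ V} {τ : PointedCone ℝ V}
  {v : V} {d : ℕ}

lemma part₀_mem_span (hN : v ∈ N) (hv : v ∈ τ) (x : coordRing N τ) : part₀ hN hv x ∈
    Submodule.span ℂ (chr '' {m : Module.Dual ℝ V | m ∈ dualMonoid N τ ∧ m v = 0}) := by
  induction x using coordRing_induction with
  | mon m =>
    by_cases h : m.1 v = 0
    · rw [part₀_mon_of_eq hN hv h]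
      exact Submodule.subset_span ⟨m.1, ⟨m.2, h⟩, rfl⟩
    · rw [part₀_mon_of_ne hN hv h]
      exact zero_mem _
  | add x y hx hy => rw [map_add]; exact add_mem hx hy
  | smul c x hx => rw [map_smul]; exact Submodule.smul_mem _ _ hx

variable {b : Module.Basis (Fin (d + 1)) ℝ V} {s : Set (Fin (d + 1))}
  (hb : IsAdaptedBasis N τ v b s) {B : Type} [CommRing B] [Algebra ℂ B] (j : B →ₐ[ℂ] torusRing V)
  (hj : Function.Injective j)

-- The monomials of degree zero are products of the coordinates `y i` and of inverses of some of
-- them. Leibniz' rule reduces their differentials to those of the `y i`.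
include hb hj in
lemma span_D_coordinates
    (hspan : ∀ β, j β ∈
      Submodule.span ℂ (chr '' {m : Module.Dual ℝ V | m ∈ dualMonoid N τ ∧ m v = 0}))
    (hchr : ∀ m ∈ dualMonoid N τ, m v = 0 → ∃ β, j β = chr m) {y : Fin d → B}
    (hy : ∀ i, j (y i) = chr (b.coord i.succ)) :
    Submodule.span B (Set.range fun i => D ℂ B (y i)) = ⊤ := by
  set P := Submodule.span B (Set.range fun i => D ℂ B (y i)) with hP
  have hyP (i) : D ℂ B (y i) ∈ P := Submodule.subset_span ⟨i, rfl⟩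
  have hcl : ∀ m ∈ AddSubmonoid.closure ((Set.range fun i : Fin d => b.coord i.succ) ∪
      {x | ∃ i : Fin d, i.succ ∉ s ∧ x = -b.coord i.succ}), ∃ β, j β = chr m ∧ D ℂ B β ∈ P := by
    intro m hm
    induction hm using AddSubmonoid.closure_induction with
    | mem m hm =>
      rcases hm with ⟨i, rfl⟩ | ⟨i, hi, rfl⟩
      · exact ⟨y i, hy i, hyP i⟩
      · obtain ⟨β, hβ⟩ := hchr _ (hb.neg_coord_mem hi) (by simp [← hb.apply_zero])
        refine ⟨β, hβ, ?_⟩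
        have h1 : β * y i = 1 := hj (by
          rw [map_mul, hβ, hy, ← chr_add, neg_add_cancel, chr_zero, map_one])
        have h2 : β • D ℂ B (y i) + y i • D ℂ B β = 0 := by
          rw [← Derivation.leibniz, h1, Derivation.map_one_eq_zero]
        -- The differential of an inverse, from `β * y i = 1`.
        have h3 : D ℂ B β = -((β * β) • D ℂ B (y i)) := by
          have := congrArg (β • ·) h2
          simp only [smul_add, smul_smul, smul_zero, h1, one_smul] at this
          exact eq_neg_of_add_eq_zero_right this
        rw [h3]
        exact neg_mem (Submodule.smul_mem _ _ (hyP i))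
    | zero => exact ⟨1, by rw [map_one, chr_zero], by simp⟩
    | add m m' _ _ h h' =>
      obtain ⟨β, hβ, h⟩ := h
      obtain ⟨β', hβ', h'⟩ := h'
      refine ⟨β * β', by rw [map_mul, hβ, hβ', chr_add], ?_⟩
      rw [Derivation.leibniz]
      exact add_mem (Submodule.smul_mem _ _ h') (Submodule.smul_mem _ _ h)
  rw [eq_top_iff, ← KaehlerDifferential.span_range_derivation ℂ B, Submodule.span_le]
  rintro _ ⟨β, rfl⟩
  let Q : Submodule ℂ B := (P.restrictScalars ℂ).comap (D ℂ B).toLinearMap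
  have hle : Submodule.span ℂ (chr '' {m : Module.Dual ℝ V | m ∈ dualMonoid N τ ∧ m v = 0}) ≤
      Q.map j.toLinearMap := by
    rw [Submodule.span_le]
    rintro _ ⟨m, ⟨hm, h0⟩, rfl⟩
    obtain ⟨β, h1, h2⟩ := hcl m (hb.mem_closure hm h0)
    exact ⟨β, h2, h1⟩
  obtain ⟨β', h1, h2⟩ := hle (hspan β)
  obtain rfl := hj h2
  exact h1

lemma chr_sum {ι : Type} (t : Finset ι) (m : ι → Module.Dual ℝ V) :
    chr (∑ i ∈ t, m i) = ∏ i ∈ t, chr (m i) := by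
  classical
  induction t using Finset.induction with
  | empty => rw [Finset.sum_empty, Finset.prod_empty, chr_zero]
  | insert a t ha ih => rw [Finset.sum_insert ha, Finset.prod_insert ha, chr_add, ih]

include hb in
/-- The conormal module of the orbit closure of a ray is dual to the forms of top degree. -/
lemma exists_equiv_forms_chart (hN : v ∈ N) (hv : v ∈ τ)
    {κ : Module.Dual ℝ V} (hκN : κ ∈ dualLattice N)
    (hκ : ∀ i ∈ s, κ (b i) = 1) (c : Module.Basis (Fin (d + 1)) ℝ V) (hc : c 0 = v)
    {A : Type} [CommRing A] {I : Ideal A} (f : A →+* coordRing N τ) (hf : Function.Bijective f)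
    (hI : ∀ a, a ∈ I ↔ part₀ hN hv (f a) = 0) (r : A ⧸ I →+* B)
    (hr : Function.Bijective r) (hjr : ∀ x, j (r x) = quotEval hN hv f hI x) :
    ∃ T : I.Cotangent ≃+ (⋀[B]^d Ω[B⁄ℂ] →ₗ[B] B), ∀ x β, j (T x (dform ℂ β)) =
      chr (-κ) * cotangentEval hN hv f hI x * jacobian j (fun k => dirDeriv (c k.succ)) β := by
  have hj : Function.Injective j := by
    intro x y hxy
    obtain ⟨x, rfl⟩ := hr.2 x
    obtain ⟨y, rfl⟩ := hr.2 y
    rw [hjr, hjr] at hxy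
    rw [quotEval_injective hN hv f hI hxy]
  have hspan (β) : j β ∈
      Submodule.span ℂ (chr '' {m : Module.Dual ℝ V | m ∈ dualMonoid N τ ∧ m v = 0}) := by
    obtain ⟨x, rfl⟩ := hr.2 β
    obtain ⟨a, rfl⟩ := Ideal.Quotient.mk_surjective x
    rw [hjr]
    exact part₀_mem_span hN hv (f a)
  have hchr (m) (hm : m ∈ dualMonoid N τ) (h0 : m v = 0) : ∃ β, j β = chr m := by
    obtain ⟨a, ha⟩ := hf.2 (mon ⟨m, hm⟩)
    exact ⟨r (Ideal.Quotient.mk I a), by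
      rw [hjr, quotEval_mk, ha, part₀_mon_of_eq hN hv (m := ⟨m, hm⟩) h0]⟩
  choose y hy using fun i : Fin d => hchr _ (hb.coord_mem i.succ) (by simp [← hb.apply_zero])
  have hD := span_D_coordinates hb j hj hspan hchr hy
  obtain ⟨a₁, ha₁⟩ := hf.2 (mon ⟨b.coord 0, hb.coord_mem 0⟩)
  have ha₁I : a₁ ∈ I := by
    rw [hI, ha₁]
    exact part₀_mon_of_ne hN hv (by simp [← hb.apply_zero])
  have hex : cotangentEval hN hv f hI (I.toCotangent ⟨a₁, ha₁I⟩) = chr (b.coord 0) := by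
    rw [cotangentEval_toCotangent]
    refine (congrArg _ ha₁).trans ?_
    exact part₁_mon_of_eq hN hv (by simp [← hb.apply_zero])
  -- Up to a constant, `χ^μ` is the value of the generator of the conormal module on `dy₁ ∧ ⋯ ∧
  -- dy_d`. The coordinates sum to one at each basis vector, and `κ` is one at those in `s`; so `μ`
  -- vanishes on the cone and both `χ^μ` and `χ^{-μ}` are functions on the chart.
  let μ : Module.Dual ℝ V := b.coord 0 + ∑ i : Fin d, b.coord i.succ - κ
  have hμ0 {i} (hi : i ∈ s) : μ (b i) = 0 := by
    have : b.coord 0 + ∑ i : Fin d, b.coord i.succ = ∑ i, b.coord i :=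
      (Fin.sum_univ_succ fun i => b.coord i).symm
    simp only [μ, this, LinearMap.sub_apply, LinearMap.sum_apply, hκ i hi]
    simp [Finsupp.single_apply]
  have hμN : μ ∈ dualLattice N :=
    sub_mem (add_mem (hb.coord_mem 0).1 (sum_mem fun i _ => (hb.coord_mem i.succ).1)) hκN
  have hμv : μ v = 0 := by
    rw [← hb.apply_zero]
    exact hμ0 hb.zero_mem
  obtain ⟨w, hw⟩ := hchr μ ((hb.mem_dualMonoid_iff _).2
    ⟨fun i => hμN _ (hb.basis_mem i), fun i hi => (hμ0 hi).ge⟩) hμv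
  obtain ⟨w', hw'⟩ := hchr (-μ) ((hb.mem_dualMonoid_iff _).2
    ⟨fun i => neg_mem hμN _ (hb.basis_mem i), fun i hi => by simp [hμ0 hi]⟩) (by simp [hμv])
  have hww : w * w' = 1 := hj (by
    rw [map_mul, hw, hw', ← chr_add, add_neg_cancel, chr_zero, map_one])
  let C : ℝ := Matrix.det (Matrix.of fun i k : Fin d => b.coord i.succ (c k.succ))
  have hC : (C : ℂ) ≠ 0 := by exact_mod_cast hb.det_ne_zero c hc
  have hjac : jacobian j (fun k => dirDeriv (c k.succ)) y =
      (C : ℂ) • chr (∑ i : Fin d, b.coord i.succ) := by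
    -- The derivations multiply characters by constants, so the row `i` is `χ` of the coordinate `i`
    -- times a row of real numbers.
    have h1 : (Matrix.of fun i k => dirDeriv (c k.succ) (j (y i))) =
        Matrix.of fun i k => chr (b.coord i.succ) * ((algebraMap ℂ (torusRing V)).comp
          Complex.ofRealHom).mapMatrix
            (Matrix.of fun i k : Fin d => b.coord i.succ (c k.succ)) i k := by
      refine Matrix.ext fun i k => ?_
      rw [Matrix.of_apply, Matrix.of_apply, hy, dirDeriv_chr, Algebra.smul_def, mul_comm]
      rfl
    rw [jacobian, h1, Matrix.det_mul_column, ← RingHom.map_det, ← chr_sum, Algebra.smul_def,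
      mul_comm]
    rfl
  refine exists_equiv_forms j hj _ r hr _ (fun x z => ?_) (I.toCotangent ⟨a₁, ha₁I⟩)
    (fun x => ?_) hD (chr (-κ)) ((C : ℂ) • w) ?_ ?_
  · rw [cotangentEval_smul, hjr]
  · obtain ⟨x, rfl⟩ := Ideal.toCotangent_surjective _ x
    obtain ⟨z, hz⟩ := hb.isRayCoordinate.exists_mul_eq (hN := hN) (hv := hv) ((hI _).1 x.2)
    obtain ⟨a, rfl⟩ := hf.2 z
    refine ⟨Ideal.Quotient.mk I a, ?_⟩
    change a • I.toCotangent ⟨a₁, ha₁I⟩ = _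
    rw [← map_smul]
    refine congrArg _ (Subtype.ext (hf.1 ?_))
    change f (a * a₁) = f x
    rw [map_mul, ha₁, hz]
  · rw [Algebra.smul_def]
    exact ((IsUnit.mk0 _ hC).map (algebraMap ℂ B)).mul (IsUnit.of_mul_eq_one _ hww)
  · rw [hex, hjac, map_smul, hw, mul_smul_comm, ← chr_add, ← chr_add]
    congr 2
    simp only [μ]
    abel

end FormsOnChart

/-! ### Comparison of the canonical bundle with another line bundle -/

section Comparison

open Scheme.AffineZariskiSite

/-- A semilinear bijection induces an isomorphism of symmetric algebras. -/
lemma symMap_bijective {A B M M' : Type} [CommRing A] [CommRing B] [AddCommGroup M] [Module A M]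
    [AddCommGroup M'] [Module B M'] (φ : A →+* B) (g : M →+ M')
    (hg : ∀ (a : A) (x : M), g (a • x) = φ a • g x) (hφ : Function.Bijective φ)
    (hg' : Function.Bijective g) : Function.Bijective (symMap φ g hg) := by
  let φ' := RingEquiv.ofBijective φ hφ
  let g' := AddEquiv.ofBijective g hg'
  have h1 (b : B) (x : M') : g'.symm.toAddMonoidHom (b • x) =
      φ'.symm.toRingHom b • g'.symm.toAddMonoidHom x := by
    apply g'.injective
    refine (g'.apply_symm_apply _).trans (Eq.trans ?_ (hg _ _).symm)
    exact congrArg₂ (· • ·) (φ'.apply_symm_apply b).symm (g'.apply_symm_apply x).symm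
  refine Function.bijective_iff_has_inverse.2 ⟨symMap φ'.symm.toRingHom g'.symm.toAddMonoidHom h1,
    fun z => ?_, fun z => ?_⟩
  · have : (symMap φ'.symm.toRingHom g'.symm.toAddMonoidHom h1).comp (symMap φ g hg) =
        RingHom.id _ := by
      refine sym_hom_ext (fun a => ?_) fun x => ?_
      · rw [RingHom.comp_apply, symMap_algebraMap, symMap_algebraMap]
        exact congrArg _ (φ'.symm_apply_apply a)
      · rw [RingHom.comp_apply, symMap_ι, symMap_ι]
        exact congrArg _ (g'.symm_apply_apply x)
    exact congr($this z)
  · have : (symMap φ g hg).comp (symMap φ'.symm.toRingHom g'.symm.toAddMonoidHom h1) =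
        RingHom.id _ := by
      refine sym_hom_ext (fun a => ?_) fun x => ?_
      · rw [RingHom.comp_apply, symMap_algebraMap, symMap_algebraMap]
        exact congrArg _ (φ'.apply_symm_apply a)
      · rw [RingHom.comp_apply, symMap_ι, symMap_ι]
        exact congrArg _ (g'.apply_symm_apply x)
    exact congr($this z)

variable {X T : Scheme.{0}} (t : T ⟶ X) [IsAffineHom t]

/-- The preimage of an affine open set under an affine morphism. -/
def preOpen (U : X.AffineZariskiSite) : T.AffineZariskiSite :=
  ⟨t ⁻¹ᵁ U.toOpens, U.2.preimage t⟩

/-- The preimage of a basic open set is again basic, defined by the pullback of the function. -/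
lemma preOpen_mono : Monotone (preOpen t) := by
  rintro U W ⟨f, hf⟩
  refine ⟨t.app W.toOpens f, ?_⟩
  change T.basicOpen (t.app W.toOpens f) = t ⁻¹ᵁ U.toOpens
  rw [← Scheme.preimage_basicOpen]
  exact congrArg _ hf

variable {t} {M : ModuleOver t} {M' : ModuleOver (𝟙 T)} {J : Type} [Preorder J]
  (U : J ⥤ X.AffineZariskiSite)

/-- An isomorphism of a module on `X` with a module on `T` induces an isomorphism of the total
spaces. -/
lemma exists_tot_iso (h : M.IsQuasiCoherent) (h' : M'.IsQuasiCoherent)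
    (φ : ∀ j, M.ring (U.obj j) →+* M'.ring (preOpen t (U.obj j)))
    (hbij : ∀ j, Function.Bijective (φ j))
    (hstr : ∀ j a, φ j (M.str (U.obj j) a) = M'.str (preOpen t (U.obj j)) (t.app (U.obj j).toOpens a))
    (hres : ∀ {i j} (k : i ⟶ j) (c : M.ring (U.obj j)),
      M'.ringRes (preOpen_mono t (U.map k).le) (φ j c) = φ i (M.ringRes (U.map k).le c))
    (hsec : ∀ j c, M'.toSections (preOpen t (U.obj j)) (φ j c) = M.toSections (U.obj j) c)
    (hcov : ∀ x : T, ∃ j, t x ∈ (U.obj j).toOpens)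
    (G : IsGluing (U ⋙ M.sym.rightOp ⋙ Scheme.Spec) (X := ModuleOver.tot h)
      (fun j => ModuleOver.totChart h (U.obj j)))
    (G' : IsGluing ((U ⋙ (preOpen_mono t).functor) ⋙ M'.sym.rightOp ⋙ Scheme.Spec)
      (X := ModuleOver.tot h') (fun j => ModuleOver.totChart h' (preOpen t (U.obj j))))
    (F : ∀ j, M.mod (U.obj j) →+ M'.mod (preOpen t (U.obj j)))
    (hF : ∀ j, Function.Bijective (F j))
    (hFs : ∀ j (c : M.ring (U.obj j)) (x : M.mod (U.obj j)), F j (c • x) = φ j c • F j x)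
    (hFr : ∀ {i j} (k : i ⟶ j) (x : M.mod (U.obj j)),
      M'.modRes (preOpen_mono t (U.map k).le) (F j x) = F i (M.modRes (U.map k).le x)) :
    ∃ ψ : ModuleOver.tot h' ≅ ModuleOver.tot h,
      ψ.hom ≫ ModuleOver.totMap h = ModuleOver.totMap h' ≫ t ∧
      ModuleOver.zeroSection h' ≫ ψ.hom = ModuleOver.zeroSection h := by
  let S (j : J) : CommRingCat.of (SymmetricAlgebra (M.ring (U.obj j)) (M.mod (U.obj j))) ⟶
      CommRingCat.of (SymmetricAlgebra (M'.ring (preOpen t (U.obj j)))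
        (M'.mod (preOpen t (U.obj j)))) :=
    CommRingCat.ofHom (symMap (φ j) (F j) (hFs j))
  have hSiso (j : J) : IsIso (S j) :=
    (ConcreteCategory.isIso_iff_bijective _).2 (symMap_bijective _ _ (hFs j) (hbij j) (hF j))
  have hSp (j : J) : IsIso (Spec.map (S j)) := inferInstance
  -- The maps on symmetric algebras commute with restriction because they do so on coefficients and
  -- on modules; they form an isomorphism of the two gluing diagrams.
  have hSnat {i j : J} (k : i ⟶ j) :
      S j ≫ M'.symRes (preOpen_mono t (U.map k).le) = M.symRes (U.map k).le ≫ S i := by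
    refine CommRingCat.hom_ext (sym_hom_ext (fun a => ?_) fun x => ?_)
    · change symMap _ _ (M'.modRes_smul (preOpen_mono t (U.map k).le))
          (symMap _ _ (hFs j) (algebraMap _ _ a)) =
        symMap _ _ (hFs i) (symMap _ _ (M.modRes_smul (U.map k).le) (algebraMap _ _ a))
      rw [symMap_algebraMap, symMap_algebraMap, symMap_algebraMap, symMap_algebraMap, hres k]
    · change symMap _ _ (M'.modRes_smul (preOpen_mono t (U.map k).le))
          (symMap _ _ (hFs j) (SymmetricAlgebra.ι _ _ x)) =
        symMap _ _ (hFs i) (symMap _ _ (M.modRes_smul (U.map k).le) (SymmetricAlgebra.ι _ _ x))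
      rw [symMap_ι, symMap_ι, symMap_ι, symMap_ι, hFr k]
  let e : (U ⋙ (preOpen_mono t).functor) ⋙ M'.sym.rightOp ⋙ Scheme.Spec ≅
      U ⋙ M.sym.rightOp ⋙ Scheme.Spec :=
    NatIso.ofComponents (fun j => @asIso _ _ _ _ (Spec.map (S j)) (hSp j)) fun {i j} k => by
      change Spec.map (M'.symRes (preOpen_mono t (U.map k).le)) ≫ Spec.map (S j) =
        Spec.map (S i) ≫ Spec.map (M.symRes (U.map k).le)
      rw [← Spec.map_comp, ← Spec.map_comp, hSnat k]
  obtain ⟨ψ, hψ⟩ : ∃ ψ : ModuleOver.tot h' ≅ ModuleOver.tot h, ∀ j,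
      ModuleOver.totChart h' (preOpen t (U.obj j)) ≫ ψ.hom =
        Spec.map (S j) ≫ ModuleOver.totChart h (U.obj j) := G'.exists_iso (G.comp_natIso e)
  refine ⟨ψ, ?_, ?_⟩
  · have key (j : J) : ModuleOver.totChart h' (preOpen t (U.obj j)) ≫ ψ.hom ≫ ModuleOver.totMap h =
        ModuleOver.totChart h' (preOpen t (U.obj j)) ≫ ModuleOver.totMap h' ≫ t := by
      have h1 : Spec.map (t.app (U.obj j).toOpens) ≫ (U.obj j).2.fromSpec =
          (preOpen t (U.obj j)).2.fromSpec ≫ t := by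
        rw [← IsAffineOpen.SpecMap_appLE_fromSpec t (U.obj j).2 (preOpen t (U.obj j)).2 le_rfl,
          Scheme.Hom.app_eq_appLE]
        rfl
      rw [reassoc_of% (hψ j), ModuleOver.totChart_totMap, ModuleOver.totChart_totMap_assoc,
        ← h1, ← Spec.map_comp_assoc]
      refine Eq.trans ?_ (Spec.map_comp_assoc (t.app (U.obj j).toOpens)
        (M'.symStrHom (preOpen t (U.obj j))) _)
      congr 2
      refine CommRingCat.hom_ext (RingHom.ext fun a => ?_)
      refine (symMap_algebraMap _ _ (hFs j) _).trans ?_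
      exact congrArg _ (hstr j a)
    exact G'.hom_ext key
  · refine Scheme.hom_ext_of_forall _ _ fun x => ?_
    obtain ⟨j, hj⟩ := hcov x
    refine ⟨t ⁻¹ᵁ (U.obj j).toOpens, hj, ?_⟩
    let Z : CommRingCat.of (SymmetricAlgebra (M'.ring (preOpen t (U.obj j)))
        (M'.mod (preOpen t (U.obj j)))) ⟶ Γ(T, t ⁻¹ᵁ (U.obj j).toOpens) :=
      M'.symZero (preOpen t (U.obj j))
    have h1 : (t ⁻¹ᵁ (U.obj j).toOpens).ι ≫ ModuleOver.zeroSection h' =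
        (t ⁻¹ᵁ (U.obj j).toOpens).toSpecΓ ≫ Spec.map Z ≫
            ModuleOver.totChart h' (preOpen t (U.obj j)) :=
      ModuleOver.ι_zeroSection h' (preOpen t (U.obj j))
    have h2 : S j ≫ Z = M.symZero (U.obj j) := by
      refine CommRingCat.hom_ext (sym_hom_ext (fun a => ?_) fun x => ?_)
      · change M'.toSections _ (SymmetricAlgebra.algebraMapInv
          (symMap _ _ (hFs j) (algebraMap _ _ a))) =
          M.toSections _ (SymmetricAlgebra.algebraMapInv (algebraMap _ _ a))
        rw [symMap_algebraMap, AlgHom.commutes, AlgHom.commutes]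
        exact hsec j a
      · change M'.toSections _ (SymmetricAlgebra.algebraMapInv
          (symMap _ _ (hFs j) (SymmetricAlgebra.ι _ _ x))) =
          M.toSections _ (SymmetricAlgebra.algebraMapInv (SymmetricAlgebra.ι _ _ x))
        rw [symMap_ι, SymmetricAlgebra.algebraMapInv_ι, SymmetricAlgebra.algebraMapInv_ι, map_zero,
          map_zero]
        rfl
    rw [ModuleOver.ι_zeroSection, ← h2, Spec.map_comp, Category.assoc, ← hψ j, reassoc_of% h1]

end Comparison

/-! ### The canonical bundle of a toric divisor -/

section CanonicalBundle

open Scheme.AffineZariskiSite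

/-- The linear maps on the forms over `U` are the sections over `U` of the dual sheaf. -/
lemma exists_equiv_dualForms {Y : Scheme.{0}} (s : Y ⟶ Spec (.of ℂ)) (d : ℕ)
    (U : Y.AffineZariskiSite) : ∃ E : (Forms s d U →ₗ[Fn s U] Fn s U) ≃+ dualForms s d U,
      ∀ φ β, ((E φ).1 ⟨U, le_refl U⟩).eval s d (form s d β) = φ (form s d β) := by
  choose E hE using exists_dualForms s d U
  refine ⟨AddEquiv.ofBijective (AddMonoidHom.mk' E fun φ ψ => dualForms_ext s d fun β => ?_)
    ⟨fun φ ψ h => ?_, fun Φ => ?_⟩, fun φ β => hE φ _⟩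
  · refine (hE _ _).trans ?_
    rw [LinearMap.add_apply, ← hE, ← hE]
    rfl
  · refine LinearMap.ext fun x => ?_
    rw [← hE, ← hE]
    exact congrArg (fun Φ : dualForms s d U => (Φ.1 ⟨U, le_refl U⟩).eval s d x) h
  · exact ⟨show Forms s d U →ₗ[Fn s U] Fn s U from Φ.1 ⟨U, le_refl U⟩,
      dualForms_ext s d fun β => hE _ _⟩

lemma appLE_top_comp_appLE {X Y Z : Scheme.{0}} (f : X ⟶ Y) (g : Y ⟶ Z) (U : Y.Opens) (W : X.Opens)
    (e : W ≤ f ⁻¹ᵁ U) : g.appLE ⊤ U le_top ≫ f.appLE U W e = (f ≫ g).appLE ⊤ W le_top :=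
  Scheme.Hom.appLE_comp_appLE ..

/-- On an affine open set a closed subscheme is the spectrum of the quotient by its ideal, so the
rings of the conormal sheaf are the functions on the subscheme. -/
lemma toSections_conormal_bijective {X : Scheme.{0}} (I : X.IdealSheafData)
    (U : X.AffineZariskiSite) : Function.Bijective ((conormal I).toSections U) := by
  constructor
  · rw [injective_iff_map_eq_zero]
    intro a ha
    obtain ⟨a, rfl⟩ := Ideal.Quotient.mk_surjective a
    exact Ideal.Quotient.eq_zero_iff_mem.2 ((I.ker_subschemeι_app ⟨U.1, U.2⟩).le ha)
  · intro b
    obtain ⟨a, ha⟩ := I.subschemeι_app_surjective ⟨U.1, U.2⟩ b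
    exact ⟨Ideal.Quotient.mk _ a, ha⟩

variable {V : Type} [AddCommGroup V] [Module ℝ V] {N : Submodule ℤ V} {Ξ : Fan N} {v : V}

lemma chartHom_structureMap (τ : Ξ.Cone) (z : ℂ) :
    Ξ.chartHom τ (Ξ.structureMap.appLE ⊤ (Ξ.chartOpen τ).toOpens le_top
      ((Scheme.ΓSpecIso (.of ℂ)).inv z)) = algebraMap ℂ (coordRing N τ.1) z := by
  have h : (Scheme.ΓSpecIso (.of ℂ)).inv ≫
      Ξ.structureMap.appLE ⊤ (Ξ.chartOpen τ).toOpens le_top ≫ Ξ.chartHom τ =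
      CommRingCat.ofHom (algebraMap ℂ (coordRing N τ.1)) := by
    rw [Iso.inv_comp_eq, ← Scheme.ΓSpecIso_naturality]
    have h1 := appLE_top_comp_appLE (Ξ.chart τ) Ξ.structureMap _ _ (Ξ.le_preimage_chartOpen τ)
    have h2 : (Ξ.chart τ ≫ Ξ.structureMap).appLE ⊤ ⊤ le_top =
        (Spec.map (CommRingCat.ofHom (algebraMap ℂ (coordRing N τ.1)))).appLE ⊤ ⊤ le_top := by
      congr 1
      exact Ξ.chart_structureMap τ
    exact congrArg (· ≫ (Scheme.ΓSpecIso _).hom) ((h1.trans h2).trans (Scheme.Hom.app_eq_appLE _).symm)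
  exact congr($(h).hom z)

variable (hN : v ∈ N) {ρ : Ξ.Cone} (hρ : ρ.1 = PointedCone.hull ℝ {v})

/-- The affine open subsets of the orbit closure of `ρ` given by the charts. -/
abbrev divisorOpen (ρ : Ξ.Cone) (τ : Ξ.Cone) : (Ξ.orbitIdeal ρ).subscheme.AffineZariskiSite :=
  preOpen (Ξ.orbitIdeal ρ).subschemeι (Ξ.chartOpen τ)

/-- The functions on a chart of the orbit closure. -/
abbrev DivisorFn (ρ : Ξ.Cone) (τ : Ξ.Cone) : Type :=
  Fn ((Ξ.orbitIdeal ρ).subschemeι ≫ Ξ.structureMap) (divisorOpen ρ τ)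

/-- The isomorphism of the residue ring with the functions on the orbit closure. -/
def divisorHom (ρ : Ξ.Cone) (τ : Ξ.Cone) :
    Γ(Ξ.toricVariety, (Ξ.chartOpen τ).toOpens) ⧸ idealAt (Ξ.orbitIdeal ρ) (Ξ.chartOpen τ) →+*
      DivisorFn ρ τ :=
  (conormal (Ξ.orbitIdeal ρ)).toSections (Ξ.chartOpen τ)

lemma divisorHom_bijective (ρ : Ξ.Cone) (τ : Ξ.Cone) : Function.Bijective (divisorHom ρ τ) :=
  toSections_conormal_bijective _ _

lemma divisorHom_algebraMap (ρ : Ξ.Cone) (τ : Ξ.Cone) (z : ℂ) :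
    divisorHom ρ τ (Ideal.Quotient.mk _ (Ξ.structureMap.appLE ⊤ (Ξ.chartOpen τ).toOpens le_top
      ((Scheme.ΓSpecIso (.of ℂ)).inv z))) = algebraMap ℂ (DivisorFn ρ τ) z := by
  have h : Ξ.structureMap.appLE ⊤ (Ξ.chartOpen τ).toOpens le_top ≫
      (Ξ.orbitIdeal ρ).subschemeι.app (Ξ.chartOpen τ).toOpens =
      ((Ξ.orbitIdeal ρ).subschemeι ≫ Ξ.structureMap).appLE ⊤
        ((Ξ.orbitIdeal ρ).subschemeι ⁻¹ᵁ (Ξ.chartOpen τ).toOpens) le_top := by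
    rw [Scheme.Hom.app_eq_appLE]
    exact appLE_top_comp_appLE _ _ _ _ _
  exact congr($(h).hom ((Scheme.ΓSpecIso (.of ℂ)).inv z))

/-- The functions on a chart of the orbit closure as Laurent polynomials. -/
def divisorEval (τ : Ξ.ConeAt v) : DivisorFn ρ τ.1 →ₐ[ℂ] torusRing V :=
  { (quotEval hN τ.2 (Ξ.chartHom τ.1).hom (mem_idealAt_orbitIdeal hN hρ τ.2)).comp
      (RingEquiv.ofBijective _ (divisorHom_bijective ρ τ.1)).symm.toRingHom with
    commutes' := fun z => by
      have h := (RingEquiv.ofBijective _ (divisorHom_bijective ρ τ.1)).symm_apply_apply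
        (Ideal.Quotient.mk _ (Ξ.structureMap.appLE ⊤ (Ξ.chartOpen τ.1).toOpens le_top
          ((Scheme.ΓSpecIso (.of ℂ)).inv z)))
      rw [RingEquiv.ofBijective_apply, divisorHom_algebraMap] at h
      refine (congrArg (quotEval hN τ.2 (Ξ.chartHom τ.1).hom
        (mem_idealAt_orbitIdeal hN hρ τ.2)) h).trans ?_
      rw [quotEval_mk]
      refine (congrArg _ (chartHom_structureMap τ.1 z)).trans ?_
      exact AlgHom.commutes _ z }

lemma divisorEval_divisorHom (τ : Ξ.ConeAt v) (x) : divisorEval hN hρ τ (divisorHom ρ τ.1 x) =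
    quotEval hN τ.2 (Ξ.chartHom τ.1).hom (mem_idealAt_orbitIdeal hN hρ τ.2) x :=
  congrArg (quotEval hN τ.2 (Ξ.chartHom τ.1).hom (mem_idealAt_orbitIdeal hN hρ τ.2))
    ((RingEquiv.ofBijective _ (divisorHom_bijective ρ τ.1)).symm_apply_apply x)

lemma divisorEval_injective (τ : Ξ.ConeAt v) :
    Function.Injective (divisorEval hN hρ τ) :=
  (quotEval_injective hN τ.2 (Ξ.chartHom τ.1).hom (mem_idealAt_orbitIdeal hN hρ τ.2)).comp
    (RingEquiv.ofBijective _ (divisorHom_bijective ρ τ.1)).symm.injective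

lemma divisorOpen_le (ρ : Ξ.Cone) {τ η : Ξ.Cone} (h : τ ≤ η) :
    divisorOpen ρ τ ≤ divisorOpen ρ η :=
  preOpen_mono (Ξ.orbitIdeal ρ).subschemeι (Ξ.chartOpen_le h)

lemma fnRes_divisorHom (ρ : Ξ.Cone) {τ η : Ξ.Cone} (h : τ ≤ η) (x) :
    fnRes ((Ξ.orbitIdeal ρ).subschemeι ≫ Ξ.structureMap) (divisorOpen_le ρ h) (divisorHom ρ η x) =
      divisorHom ρ τ ((conormal (Ξ.orbitIdeal ρ)).ringRes (Ξ.chartOpen_le h) x) :=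
  ((conormal (Ξ.orbitIdeal ρ)).toSections_res (Ξ.chartOpen_le h) x).symm

/-- Functions on the orbit closure are read off as parts of degree zero, which restriction
preserves. -/
lemma divisorEval_fnRes {τ η : Ξ.ConeAt v} (h : τ ≤ η) (y : DivisorFn ρ η.1) :
    divisorEval hN hρ τ (fnRes ((Ξ.orbitIdeal ρ).subschemeι ≫ Ξ.structureMap)
      (divisorOpen_le ρ h) y) = divisorEval hN hρ η y := by
  obtain ⟨x, rfl⟩ := (divisorHom_bijective ρ η.1).2 y
  refine (congrArg _ (fnRes_divisorHom ρ (show τ.1 ≤ η.1 from h) x)).trans ?_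
  refine (divisorEval_divisorHom hN hρ τ _).trans (.trans ?_ (divisorEval_divisorHom hN hρ η x).symm)
  obtain ⟨a, rfl⟩ := Ideal.Quotient.mk_surjective x
  change part₀ hN τ.2 (Ξ.chartHom τ.1 (res (Ξ.chartOpen_le h) a)) =
    part₀ hN η.2 (Ξ.chartHom η.1 a)
  rw [Ξ.chartHom_res (show τ.1 ≤ η.1 from h), part₀_coordMap]

/-- The conormal elements on a chart as Laurent polynomials. -/
def conormalEval (τ : Ξ.ConeAt v) :
    (idealAt (Ξ.orbitIdeal ρ) (Ξ.chartOpen τ.1)).Cotangent →+ torusRing V :=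
  cotangentEval hN τ.2 (Ξ.chartHom τ.1).hom (mem_idealAt_orbitIdeal hN hρ τ.2)

lemma conormalEval_smul (τ : Ξ.ConeAt v)
    (a : Γ(Ξ.toricVariety, (Ξ.chartOpen τ.1).toOpens) ⧸ idealAt (Ξ.orbitIdeal ρ) (Ξ.chartOpen τ.1))
    (x : (idealAt (Ξ.orbitIdeal ρ) (Ξ.chartOpen τ.1)).Cotangent) :
    conormalEval hN hρ τ (a • x) =
      divisorEval hN hρ τ (divisorHom ρ τ.1 a) * conormalEval hN hρ τ x := by
  rw [divisorEval_divisorHom]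
  exact cotangentEval_smul _ _ _ _ _ _

lemma conormalEval_conormalRes {τ η : Ξ.ConeAt v} (h : τ ≤ η) (x) :
    conormalEval hN hρ τ (conormalRes (Ξ.orbitIdeal ρ) (Ξ.chartOpen_le h) x) =
      conormalEval hN hρ η x := by
  obtain ⟨x, rfl⟩ := Ideal.toCotangent_surjective _ x
  refine (congrArg _ (conormalRes_mk _ (Ξ.chartOpen_le h) x)).trans ?_
  change part₁ hN τ.2 (Ξ.chartHom τ.1 (res (Ξ.chartOpen_le h) x.1)) =
    part₁ hN η.2 (Ξ.chartHom η.1 x.1)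
  rw [Ξ.chartHom_res (show τ.1 ≤ η.1 from h), part₁_coordMap]

variable {d : ℕ} (c : Module.Basis (Fin (d + 1)) ℝ V) (κ : Module.Dual ℝ V)

/-- The sections of the dual of the canonical sheaf of the orbit closure on a chart. -/
abbrev DivisorDual (d : ℕ) (ρ τ : Ξ.Cone) : Type :=
  dualForms ((Ξ.orbitIdeal ρ).subschemeι ≫ Ξ.structureMap) d (divisorOpen ρ τ)

/-- The value of a section of the dual of the canonical sheaf on a form. -/
def DivisorDual.eval {ρ τ : Ξ.Cone} (Φ : DivisorDual d ρ τ) (β : Fin d → DivisorFn ρ τ) :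
    DivisorFn ρ τ :=
  (Φ.1 ⟨divisorOpen ρ τ, le_refl _⟩).eval _ d (form _ d β)

lemma DivisorDual.ext {ρ τ : Ξ.Cone} {Φ Ψ : DivisorDual d ρ τ} (h : ∀ β, Φ.eval β = Ψ.eval β) :
    Φ = Ψ :=
  dualForms_ext _ _ h

lemma DivisorDual.eval_smul {ρ τ : Ξ.Cone} (a : DivisorFn ρ τ) (Φ : DivisorDual d ρ τ) (β) :
    DivisorDual.eval (a • Φ) β = a * Φ.eval β :=
  congrArg (· * Φ.eval β) (fnRes_self _ a)

/-- The smaller chart is a localization of the larger one, so forms with entries from the larger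
chart suffice to identify a restricted section. -/
lemma DivisorDual.ext_res {ρ τ η : Ξ.Cone} (h : τ ≤ η) {Φ : DivisorDual d ρ η}
    {Ψ : DivisorDual d ρ τ}
    (hΦ : ∀ β, Ψ.eval (fun i => fnRes _ (divisorOpen_le ρ h) (β i)) =
      fnRes _ (divisorOpen_le ρ h) (Φ.eval β)) :
    dualFormsRes _ d (divisorOpen_le ρ h) Φ = Ψ := by
  refine DivisorDual.ext fun β => ?_
  let i1 := (fnRes ((Ξ.orbitIdeal ρ).subschemeι ≫ Ξ.structureMap) (divisorOpen_le ρ h)).toAlgebra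
  have : IsScalarTower ℂ (DivisorFn ρ η) (DivisorFn ρ τ) :=
    .of_algebraMap_eq fun c => (fnRes_algebraMap _ (divisorOpen_le ρ h) c).symm
  obtain ⟨f, hf⟩ := exists_isLocalization_fnRes
    ((Ξ.orbitIdeal ρ).subschemeι ≫ Ξ.structureMap) (divisorOpen_le ρ h)
  have := linearMap_ext_of_isLocalization (k := ℂ) (A := DivisorFn ρ η) (B := DivisorFn ρ τ)
    (d := d) (.powers f)
    (φ := show Forms _ d (divisorOpen ρ τ) →ₗ[DivisorFn ρ τ] DivisorFn ρ τ from
      (dualFormsRes _ d (divisorOpen_le ρ h) Φ).1 ⟨divisorOpen ρ τ, le_refl _⟩)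
    (ψ := show Forms _ d (divisorOpen ρ τ) →ₗ[DivisorFn ρ τ] DivisorFn ρ τ from
      Ψ.1 ⟨divisorOpen ρ τ, le_refl _⟩) fun a => by
    refine Eq.trans ?_ (hΦ a).symm
    exact Φ.2 ⟨divisorOpen ρ η, le_refl _⟩ ⟨divisorOpen ρ τ, divisorOpen_le ρ h⟩
      (divisorOpen_le ρ h) a
  exact congr($this (dform ℂ β))

/-- The adapted basis `b` varies with the chart but does not enter the formula for `F`, which
involves only `κ` and the fixed basis `c`. This is what lets the bijections of different charts
glue. -/
lemma exists_equiv_divisorDual {τ : Ξ.ConeAt v} {b : Module.Basis (Fin (d + 1)) ℝ V}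
    {s : Set (Fin (d + 1))} (hb : IsAdaptedBasis N τ.1.1 v b s) (hκN : κ ∈ dualLattice N)
    (hκ : ∀ i ∈ s, κ (b i) = 1) (hc : c 0 = v) :
    ∃ F : (idealAt (Ξ.orbitIdeal ρ) (Ξ.chartOpen τ.1)).Cotangent →+ DivisorDual d ρ τ.1,
      Function.Bijective F ∧ ∀ x β, divisorEval hN hρ τ ((F x).eval β) =
        chr (-κ) * conormalEval hN hρ τ x *
          jacobian (divisorEval hN hρ τ) (fun k => dirDeriv (c k.succ)) β := by
  obtain ⟨T, hT⟩ := exists_equiv_forms_chart hb (divisorEval hN hρ τ) hN τ.2 hκN hκ c hc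
    (Ξ.chartHom τ.1).hom (chartHom_bijective τ.1) (mem_idealAt_orbitIdeal hN hρ τ.2)
    (divisorHom ρ τ.1) (divisorHom_bijective ρ τ.1) (divisorEval_divisorHom hN hρ τ)
  obtain ⟨E, hE⟩ := exists_equiv_dualForms ((Ξ.orbitIdeal ρ).subschemeι ≫ Ξ.structureMap) d
    (divisorOpen ρ τ.1)
  exact ⟨(T.trans E).toAddMonoidHom, (T.trans E).bijective,
    fun x β => (congrArg _ (hE _ β)).trans (hT x β)⟩

-- This is adjunction: with `K_X` trivialized by means of `κ`, the normal bundle of the divisor is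
-- its canonical bundle.
include hN hρ in
lemma exists_tot_dualCanonical_iso
    (hb : ∀ τ : Ξ.ConeAt v, ∃ (b : Module.Basis (Fin (d + 1)) ℝ V) (s : Set (Fin (d + 1))),
      IsAdaptedBasis N τ.1.1 v b s ∧ ∀ i ∈ s, κ (b i) = 1)
    (hκN : κ ∈ dualLattice N) (hc : c 0 = v)
    (h : (conormal (Ξ.orbitIdeal ρ)).IsQuasiCoherent)
    (h' : (dualCanonical ((Ξ.orbitIdeal ρ).subschemeι ≫ Ξ.structureMap) d).IsQuasiCoherent) :
    ∃ ψ : ModuleOver.tot h' ≅ ModuleOver.tot h,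
      ψ.hom ≫ ModuleOver.totMap h = ModuleOver.totMap h' ≫ (Ξ.orbitIdeal ρ).subschemeι ∧
      ModuleOver.zeroSection h' ≫ ψ.hom = ModuleOver.zeroSection h := by
  choose b s hb hs using hb
  choose F hF hFe using fun τ => exists_equiv_divisorDual (ρ := ρ) hN hρ c κ (hb τ) hκN (hs τ) hc
  have hcov (x : (Ξ.orbitIdeal ρ).subscheme) : ∃ τ : Ξ.ConeAt v,
      (Ξ.orbitIdeal ρ).subschemeι x ∈ (Ξ.chartOpen τ.1).toOpens :=
    exists_coneAt_of_mem_support hN hρ (by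
      rw [← SetLike.mem_coe, ← Scheme.IdealSheafData.range_subschemeι]
      exact ⟨x, rfl⟩)
  have G' : IsGluing ((Ξ.openAt v ⋙ (preOpen_mono (Ξ.orbitIdeal ρ).subschemeι).functor) ⋙
      (dualCanonical ((Ξ.orbitIdeal ρ).subschemeι ≫ Ξ.structureMap) d).sym.rightOp ⋙ Scheme.Spec)
      (X := ModuleOver.tot h') (fun τ => ModuleOver.totChart h' (divisorOpen ρ τ.1)) :=
    isGluing_relSpec h' (Ξ.openAt v ⋙ (preOpen_mono (Ξ.orbitIdeal ρ).subschemeι).functor)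
      (fun p => hcov (ModuleOver.totMap h' p)) fun p τ η h1 h2 =>
        exists_coneAt_of_mem (x := (Ξ.orbitIdeal ρ).subschemeι (ModuleOver.totMap h' p)) h1 h2
  have hsmul (τ : Ξ.ConeAt v) (a : Γ(Ξ.toricVariety, (Ξ.chartOpen τ.1).toOpens) ⧸
      idealAt (Ξ.orbitIdeal ρ) (Ξ.chartOpen τ.1))
      (x : (idealAt (Ξ.orbitIdeal ρ) (Ξ.chartOpen τ.1)).Cotangent) :
      F τ (a • x) = divisorHom ρ τ.1 a • F τ x := DivisorDual.ext fun β => by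
    apply divisorEval_injective hN hρ τ
    rw [DivisorDual.eval_smul, map_mul, hFe, hFe, conormalEval_smul]
    ring
  -- Both sides have the same image in the group algebra, since the conormal element and the entries
  -- of the determinant keep theirs under restriction.
  have hres {τ η : Ξ.ConeAt v} (k : τ ≤ η)
      (x : (idealAt (Ξ.orbitIdeal ρ) (Ξ.chartOpen η.1)).Cotangent) :
      dualFormsRes _ d (divisorOpen_le ρ k) (F η x) =
        F τ (conormalRes (Ξ.orbitIdeal ρ) (Ξ.chartOpen_le k) x) :=
    DivisorDual.ext_res (show τ.1 ≤ η.1 from k) fun β => by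
      apply divisorEval_injective hN hρ τ
      rw [divisorEval_fnRes hN hρ k, hFe, hFe, conormalEval_conormalRes hN hρ k]
      congr 1
      simp only [jacobian, divisorEval_fnRes hN hρ k]
  exact exists_tot_iso (Ξ.openAt v) h h' (fun τ => divisorHom ρ τ.1)
    (fun τ => divisorHom_bijective ρ τ.1) (fun _ _ => rfl)
    (fun k x => fnRes_divisorHom ρ k.le x) (fun _ _ => rfl) hcov
    (isGluing_tot_conormal hN hρ h) G' F hF hsmul fun k x => hres k.le x

end CanonicalBundle

/-! ### Finiteness -/

section FiniteType

open Scheme.AffineZariskiSite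

variable {V : Type} [AddCommGroup V] [Module ℝ V] {N : Submodule ℤ V} {τ : PointedCone ℝ V}
  {v : V} {d : ℕ}

/-- The coordinates, with the negatives of those outside `s`, generate: first a multiple of the
coordinate of `v` is split off, then `mem_closure` applies to the rest. -/
lemma IsAdaptedBasis.fg_dualMonoid {b : Module.Basis (Fin (d + 1)) ℝ V} {s : Set (Fin (d + 1))}
    (hb : IsAdaptedBasis N τ v b s) : AddMonoid.FG (dualMonoid N τ) := by
  rw [AddMonoid.fg_iff_addSubmonoid_fg, AddSubmonoid.fg_iff]
  let S : Set (Module.Dual ℝ V) := (Set.range fun i : Fin d => b.coord i.succ) ∪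
      {x | ∃ i : Fin d, i.succ ∉ s ∧ x = -b.coord i.succ}
  have hS : S.Finite := (Set.finite_range _).union ((Set.finite_range fun i : Fin d =>
    -b.coord i.succ).subset (by rintro _ ⟨i, -, rfl⟩; exact ⟨i, rfl⟩))
  refine ⟨insert (b.coord 0) S, le_antisymm (AddSubmonoid.closure_le.2 ?_) fun m hm => ?_,
    hS.insert _⟩
  · rintro x (rfl | ⟨i, rfl⟩ | ⟨i, hi, rfl⟩)
    · exact hb.coord_mem 0
    · exact hb.coord_mem _
    · exact hb.neg_coord_mem hi
  · have h1 := hb.isRayCoordinate.rest_apply (hN := hb.mem_lattice) (hv := hb.mem_cone) ⟨m, hm⟩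
    have h2 := hb.isRayCoordinate.rest_add (hN := hb.mem_lattice) (hv := hb.mem_cone) ⟨m, hm⟩
    rw [← show _ = m from h2]
    exact add_mem (AddSubmonoid.closure_mono (Set.subset_insert _ _)
      (hb.mem_closure (Subtype.prop _) h1))
      (nsmul_mem (AddSubmonoid.subset_closure (Set.mem_insert _ _)) _)

/-- Being locally of finite type may be tested on one affine neighbourhood of each point and then
holds on every affine open set. -/
lemma finiteType_fn {Y : Scheme.{0}} (s : Y ⟶ Spec (.of ℂ))
    (h : ∀ y : Y, ∃ U : Y.AffineZariskiSite, y ∈ U.toOpens ∧ Algebra.FiniteType ℂ (Fn s U))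
    (U : Y.AffineZariskiSite) : Algebra.FiniteType ℂ (Fn s U) := by
  have h1 (U : Y.AffineZariskiSite) : Algebra.FiniteType ℂ (Fn s U) ↔
      (s.appLE ⊤ U.toOpens le_top).hom.FiniteType := by
    have hs : Function.Bijective (Scheme.ΓSpecIso (.of ℂ)).inv.hom :=
      ConcreteCategory.bijective_of_isIso (Scheme.ΓSpecIso (.of ℂ)).inv
    have e : Algebra.FiniteType ℂ (Fn s U) ↔ RingHom.FiniteType
        ((s.appLE ⊤ U.toOpens le_top).hom.comp (Scheme.ΓSpecIso (.of ℂ)).inv.hom) := Iff.rfl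
    rw [e]
    exact ⟨fun h => h.of_comp_finiteType, fun h => h.comp (.of_surjective _ hs.2)⟩
  have : LocallyOfFiniteType s := by
    rw [HasRingHomProperty.iff_exists_appLE (P := @LocallyOfFiniteType)
      (RingHom.finiteType_stableUnderComposition.stableUnderCompositionWithLocalizationAway
        RingHom.finiteType_holdsForLocalizationAway).left]
    intro y
    obtain ⟨U, hU, hft⟩ := h y
    exact ⟨⟨⊤, isAffineOpen_top _⟩, ⟨U.toOpens, U.2⟩, hU, le_top, (h1 U).1 hft⟩
  exact (h1 U).2 (s.finiteType_appLE (isAffineOpen_top _) U.2 le_top)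

variable {Ξ : Fan N} (hN : v ∈ N) {ρ : Ξ.Cone} (hρ : ρ.1 = PointedCone.hull ℝ {v})

-- On the charts that cover the orbit closure its functions are a quotient of a finitely generated
-- monoid algebra.
include hN hρ in
lemma isQuasiCoherent_dualCanonical_orbit (hb : ∀ τ : Ξ.ConeAt v,
      ∃ (b : Module.Basis (Fin (d + 1)) ℝ V) (s : Set (Fin (d + 1))),
        IsAdaptedBasis N τ.1.1 v b s) :
    (dualCanonical ((Ξ.orbitIdeal ρ).subschemeι ≫ Ξ.structureMap) d).IsQuasiCoherent := by
  refine isQuasiCoherent_dualCanonical _ _ (finiteType_fn _ fun y => ?_)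
  obtain ⟨τ, hτ⟩ := exists_coneAt_of_mem_support hN hρ
    (x := (Ξ.orbitIdeal ρ).subschemeι y) (by
      rw [← SetLike.mem_coe, ← Scheme.IdealSheafData.range_subschemeι]
      exact ⟨y, rfl⟩)
  obtain ⟨b, s, hb⟩ := hb τ
  refine ⟨divisorOpen ρ τ.1, hτ, ?_⟩
  have := hb.fg_dualMonoid
  have h1 : Algebra.FiniteType ℂ (coordRing N τ.1.1) := inferInstance
  let q : coordRing N τ.1.1 →+* DivisorFn ρ τ.1 := (divisorHom ρ τ.1).comp
    ((Ideal.Quotient.mk _).comp (inv (Ξ.chartHom τ.1)).hom)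
  have hq : Function.Surjective q := (divisorHom_bijective ρ τ.1).2.comp
    (Ideal.Quotient.mk_surjective.comp
      (ConcreteCategory.bijective_of_isIso (inv (Ξ.chartHom τ.1))).2)
  let q' : coordRing N τ.1.1 →ₐ[ℂ] DivisorFn ρ τ.1 :=
    { q with
      commutes' := fun z => by
        rw [← chartHom_structureMap τ.1 z, ← divisorHom_algebraMap]
        refine congrArg (fun a => divisorHom ρ τ.1 (Ideal.Quotient.mk _ a)) ?_
        change inv (Ξ.chartHom τ.1) (Ξ.chartHom τ.1 _) = _
        rw [← CommRingCat.comp_apply, IsIso.hom_inv_id]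
        rfl }
  exact h1.of_surjective q' hq

end FiniteType

/-! ### Cones generated by a part of a lattice basis -/

section LatticeBasis

variable {V : Type} [AddCommGroup V] [Module ℝ V] {N : Submodule ℤ V} {ι : Type} [Fintype ι]
  {b : Module.Basis ι ℝ V} {s t : Set ι}

lemma mem_hull_basis {x : V} : x ∈ PointedCone.hull ℝ (b '' s) ↔
    (∀ i ∈ s, 0 ≤ b.coord i x) ∧ ∀ i ∉ s, b.coord i x = 0 := by
  classical
  have hb (i j) : b.coord i (b j) = if j = i then 1 else 0 := by
    rw [Module.Basis.coord_apply, Module.Basis.repr_self, Finsupp.single_apply]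
  refine ⟨fun h => ⟨fun i _ => nonneg_of_mem_hull ?_ h, fun i hi => le_antisymm ?_
    (nonneg_of_mem_hull ?_ h)⟩, fun ⟨h1, h2⟩ => ?_⟩
  · rintro _ ⟨j, -, rfl⟩
    rw [hb]
    split_ifs <;> simp
  · refine neg_nonneg.1 (nonneg_of_mem_hull (m := -b.coord i) ?_ h)
    rintro _ ⟨j, hj, rfl⟩
    rw [LinearMap.neg_apply, hb, if_neg (fun e : j = i => hi (e ▸ hj)), neg_zero]
  · rintro _ ⟨j, -, rfl⟩
    rw [hb]
    split_ifs <;> simp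
  · rw [← b.sum_repr x]
    refine sum_mem fun i _ => ?_
    by_cases hi : i ∈ s
    · exact Submodule.smul_mem _ (⟨b.repr x i, h1 i hi⟩ : {c : ℝ // 0 ≤ c})
        (Submodule.subset_span ⟨i, hi, rfl⟩)
    · rw [show b.repr x i = 0 from h2 i hi, zero_smul]
      exact zero_mem _

/-- `b` is a `ℤ`-basis of the lattice `N`. -/
def IsLatticeBasis (N : Submodule ℤ V) (b : Module.Basis ι ℝ V) : Prop :=
  ∀ x, x ∈ N ↔ ∀ i, ∃ k : ℤ, b.coord i x = k

variable (hb : IsLatticeBasis N b)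

include hb

omit [Fintype ι] in
lemma IsLatticeBasis.basis_mem (i : ι) : b i ∈ N := by
  classical
  rw [hb]
  intro k
  rw [Module.Basis.coord_apply, Module.Basis.repr_self, Finsupp.single_apply]
  split_ifs
  · exact ⟨1, by simp⟩
  · exact ⟨0, by simp⟩

/-- A part of the generators generates a face. -/
lemma IsLatticeBasis.isFace (h : t ⊆ s) :
    IsFace N (PointedCone.hull ℝ (b '' t)) (PointedCone.hull ℝ (b '' s)) := by
  classical
  -- A sum of coordinates that are nonnegative on the cone; it vanishes exactly where each of them
  -- does.
  let m : Module.Dual ℝ V := ∑ i with i ∉ t, b.coord i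
  have hm (x) : m x = ∑ i with i ∉ t, b.coord i x := LinearMap.sum_apply ..
  have hnn {x} (hx : x ∈ PointedCone.hull ℝ (b '' s)) (i) : 0 ≤ b.coord i x := by
    by_cases hi : i ∈ s
    · exact (mem_hull_basis.1 hx).1 i hi
    · exact ((mem_hull_basis.1 hx).2 i hi).ge
  refine ⟨m, ⟨sum_mem fun i _ u hu => (hb u).1 hu i, fun x hx => ?_⟩, ?_⟩
  · rw [hm]
    exact Finset.sum_nonneg fun i _ => hnn hx i
  · refine SetLike.ext fun x => ?_
    rw [mem_slice]
    refine ⟨fun hx => ⟨Submodule.span_mono (Set.image_mono h) hx, ?_⟩, fun ⟨hx, h0⟩ => ?_⟩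
    · rw [hm]
      exact Finset.sum_eq_zero fun i hi => (mem_hull_basis.1 hx).2 i (Finset.mem_filter.1 hi).2
    · rw [hm, Finset.sum_eq_zero_iff_of_nonneg fun i _ => hnn hx i] at h0
      exact mem_hull_basis.2 ⟨fun i _ => hnn hx i,
        fun i hi => h0 i (Finset.mem_filter.2 ⟨Finset.mem_univ _, hi⟩)⟩

omit [Fintype ι] in
lemma IsLatticeBasis.isRayGenerator (i : ι) :
    IsRayGenerator N (PointedCone.hull ℝ {b i}) (b i) := by
  refine ⟨rfl, hb.basis_mem i, b.ne_zero i, fun t ht h => ?_⟩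
  obtain ⟨k, hk⟩ := (hb _).1 h i
  have hk' : t = k := by simpa using hk
  rw [hk'] at ht ⊢
  exact_mod_cast ht

lemma IsLatticeBasis.ray_isFace {i : ι} (hi : i ∈ s) :
    IsFace N (PointedCone.hull ℝ {b i}) (PointedCone.hull ℝ (b '' s)) := by
  rw [← Set.image_singleton]
  exact hb.isFace (Set.singleton_subset_iff.2 hi)

/-- The lattice points of height one in the cone are its generators. -/
lemma IsLatticeBasis.exists_eq_of_apply_eq_one {κ : Module.Dual ℝ V}
    (hκ : ∀ i ∈ s, κ (b i) = 1) {v : V} (hN : v ∈ N) (hv : v ∈ PointedCone.hull ℝ (b '' s))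
    (h1 : κ v = 1) : ∃ i ∈ s, b i = v := by
  classical
  choose k hk using (hb v).1 hN
  have hs (i) (hi : k i ≠ 0) : i ∈ s := by
    by_contra h
    have := (mem_hull_basis.1 hv).2 i h
    rw [hk] at this
    exact hi (by exact_mod_cast this)
  have hnn (i) : 0 ≤ k i := by
    by_cases hi : k i = 0
    · exact hi.ge
    · have := (mem_hull_basis.1 hv).1 i (hs i hi)
      rw [hk] at this
      exact_mod_cast this
  -- Each generator has height one, so the height of `v` is the sum of its coordinates. Nonnegative
  -- integers with sum one are a single `1` and zeros.
  have hsum : ∑ i, k i = 1 := by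
    have : κ v = ∑ i, (k i : ℝ) := by
      conv_lhs => rw [← b.sum_repr v]
      rw [map_sum]
      refine Finset.sum_congr rfl fun i _ => ?_
      rw [map_smul, smul_eq_mul, show b.repr v i = k i from hk i]
      by_cases hi : k i = 0
      · simp [hi]
      · rw [hκ i (hs i hi), mul_one]
    rw [h1] at this
    exact_mod_cast this.symm
  obtain ⟨i, hi⟩ : ∃ i, k i ≠ 0 := by
    by_contra! h
    simp [h] at hsum
  have h2 := Finset.add_sum_erase _ k (Finset.mem_univ i)
  have h3 : ∑ j ∈ Finset.univ.erase i, k j = 0 := by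
    have := Finset.sum_nonneg (s := Finset.univ.erase i) fun j _ => hnn j
    have := hnn i
    omega
  have h4 := (Finset.sum_eq_zero_iff_of_nonneg fun j _ => hnn j).1 h3
  have h5 : k i = 1 := by omega
  refine ⟨i, hs i hi, ?_⟩
  rw [← b.sum_repr v, Finset.sum_eq_single i]
  · rw [show b.repr v i = k i from hk i, h5]
    simp
  · intro j _ hj
    rw [show b.repr v j = k j from hk j, h4 j (Finset.mem_erase.2 ⟨hj, Finset.mem_univ _⟩)]
    simp
  · simp

omit hb in
/-- A cone of a fan that contains the sum of the generators contains the cone. -/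
lemma le_of_sum_mem {Ξ : Fan N} {η : PointedCone ℝ V} [DecidablePred (· ∈ s)]
    (hs : PointedCone.hull ℝ (b '' s) ∈ Ξ.cones)
    (hη : η ∈ Ξ.cones) (h : ∑ i with i ∈ s, b i ∈ η) : PointedCone.hull ℝ (b '' s) ≤ η := by
  -- The intersection with `η` is a face, cut out by `m`. As `m` is nonnegative on the generators
  -- and zero on their sum, it is zero on each of them.
  obtain ⟨m, hm, he⟩ := Ξ.inf_isFace η hη _ hs
  have hx : ∑ i with i ∈ s, b i ∈ PointedCone.hull ℝ (b '' s) := sum_mem fun i hi =>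
    Submodule.subset_span ⟨i, (Finset.mem_filter.1 hi).2, rfl⟩
  have h0 : m (∑ i with i ∈ s, b i) = 0 := by
    have : ∑ i with i ∈ s, b i ∈ slice (PointedCone.hull ℝ (b '' s)) m := he ▸ ⟨h, hx⟩
    exact this.2
  rw [map_sum, Finset.sum_eq_zero_iff_of_nonneg fun i hi => hm.2 _
    (Submodule.subset_span ⟨i, (Finset.mem_filter.1 hi).2, rfl⟩)] at h0
  refine Submodule.span_le.2 ?_
  rintro _ ⟨i, hi, rfl⟩
  have : b i ∈ slice (PointedCone.hull ℝ (b '' s)) m :=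
    ⟨Submodule.subset_span ⟨i, hi, rfl⟩, h0 i (Finset.mem_filter.2 ⟨Finset.mem_univ _, hi⟩)⟩
  rw [← he] at this
  exact this.1

omit hb in
lemma eq_univ_of_span_eq_top (h : Submodule.span ℝ (PointedCone.hull ℝ (b '' s) : Set V) = ⊤) :
    s = Set.univ := by
  refine Set.eq_univ_of_forall fun i => ?_
  by_contra hi
  have : Submodule.span ℝ (PointedCone.hull ℝ (b '' s) : Set V) ≤ LinearMap.ker (b.coord i) :=
    Submodule.span_le.2 fun x hx => (mem_hull_basis.1 hx).2 i hi
  rw [h, top_le_iff] at this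
  have h1 : b i ∈ LinearMap.ker (b.coord i) := this ▸ Submodule.mem_top
  simp at h1

end LatticeBasis

/-! ### Cones of full dimension and covering of the orthant -/

section FullDimensional

variable {n : ℕ} {N : Submodule ℤ (Fin n → ℝ)}

lemma isClosed_hull_basis {ι : Type} [Fintype ι] (b : Module.Basis ι ℝ (Fin n → ℝ)) (s : Set ι) :
    IsClosed (PointedCone.hull ℝ (b '' s) : Set (Fin n → ℝ)) := by
  have h1 (i) : Continuous (b.coord i) := LinearMap.continuous_of_finiteDimensional _
  have : (PointedCone.hull ℝ (b '' s) : Set (Fin n → ℝ)) =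
      (⋂ i ∈ s, {x | 0 ≤ b.coord i x}) ∩ ⋂ i ∈ sᶜ, {x | b.coord i x = 0} := by
    ext x
    simp only [SetLike.mem_coe, mem_hull_basis, Set.mem_inter_iff, Set.mem_iInter,
      Set.mem_ofPred_eq, Set.mem_compl_iff]
  rw [this]
  exact (isClosed_biInter fun i _ => isClosed_le continuous_const (h1 i)).inter
    (isClosed_biInter fun i _ => isClosed_eq (h1 i) continuous_const)

lemma mem_orthant {x : Fin n → ℝ} : x ∈ orthant n ↔ ∀ i, 0 ≤ x i := by
  have h : (Set.range fun i : Fin n => (Pi.single i 1 : Fin n → ℝ)) =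
      Pi.basisFun ℝ (Fin n) '' Set.univ := by
    rw [Set.image_univ]
    congr 1
    ext i
    simp
  rw [orthant, h, mem_hull_basis]
  simp

open Filter Topology in
lemma mem_of_eventually {U : Set (Fin n → ℝ)} (hU : IsClosed U) (x w : Fin n → ℝ)
    (h : ∀ᶠ t : ℝ in 𝓝[>] 0, x + t • w ∈ U) : x ∈ U := by
  have hc : Continuous fun t : ℝ => x + t • w := by fun_prop
  have : Tendsto (fun t : ℝ => x + t • w) (𝓝[>] 0) (𝓝 x) := by
    have := (hc.tendsto 0).mono_left (nhdsWithin_le_nhds (s := Set.Ioi 0))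
    simpa using this
  exact hU.mem_of_tendsto this h

-- A line whose direction is not in `W` meets `W` in at most one point, so small positive parameters
-- avoid it.
open Filter Topology in
lemma eventually_notMem (W : Submodule ℝ (Fin n → ℝ)) (x : Fin n → ℝ) {w : Fin n → ℝ}
    (hw : w ∉ W) : ∀ᶠ t : ℝ in 𝓝[>] 0, x + t • w ∉ W := by
  have hS : {t : ℝ | x + t • w ∈ W}.Subsingleton := by
    intro t ht t' ht'
    by_contra hne
    have h := W.sub_mem ht ht'
    rw [add_sub_add_left_eq_sub, ← sub_smul] at h
    exact hw ((W.smul_mem_iff (sub_ne_zero.2 hne)).1 h)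
  have h1 : ({t : ℝ | x + t • w ∈ W} \ {0})ᶜ ∈ 𝓝 (0 : ℝ) :=
    (hS.finite.subset Set.sdiff_subset).isClosed.compl_mem_nhds (by simp)
  filter_upwards [mem_nhdsWithin_of_mem_nhds h1, self_mem_nhdsWithin] with t ht ht0 hmem
  exact ht ⟨hmem, ne_of_gt ht0⟩

open Filter Topology in
/-- The cones of full dimension of a fan that subdivides the orthant cover it. -/
lemma exists_maxCone_of_mem {Ξ : Fan N}
    (hc : ∀ τ ∈ Ξ.cones, IsClosed (τ : Set (Fin n → ℝ)))
    (hr : Ξ.Refines (orthant n)) {x : Fin n → ℝ} (hx : x ∈ orthant n) :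
    ∃ η ∈ Ξ.maxCones, x ∈ η := by
  let U : Set (Fin n → ℝ) := ⋃ η ∈ Ξ.maxCones, (η : Set (Fin n → ℝ))
  have hU : IsClosed U := (Ξ.finite.subset fun η h => h.1).isClosed_biUnion fun η h => hc η h.1
  let S : Set (Submodule ℝ (Fin n → ℝ)) :=
    (fun τ : PointedCone ℝ (Fin n → ℝ) => Submodule.span ℝ (τ : Set (Fin n → ℝ))) ''
      (Ξ.cones \ Ξ.maxCones)
  have hS : S.Finite := (Ξ.finite.subset Set.sdiff_subset).image _
  have htop : ⊤ ∉ S := by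
    rintro ⟨τ, hτ, h⟩
    exact hτ.2 ⟨hτ.1, h⟩
  -- A real vector space is not a finite union of proper subspaces; here these are the spans of the
  -- cones of smaller dimension.
  obtain ⟨w, hw⟩ : ∃ w, w ∉ ⋃ p ∈ S, (p : Set (Fin n → ℝ)) := by
    by_contra! h
    exact Subspace.biUnion_ne_univ_of_top_notMem (s := hS.toFinset) (by simpa using htop) (by simpa using Set.eq_univ_of_forall h)
  simp only [Set.mem_iUnion, not_exists] at hw
  -- From a point with positive coordinates a small step along `w` stays in the orthant and leaves
  -- all the smaller spans, so it ends in a cone of full dimension. The union `U` is closed and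
  -- contains the limit.
  have hpos {y : Fin n → ℝ} (hy : ∀ i, 0 < y i) : y ∈ U := by
    refine mem_of_eventually hU y w ?_
    have h1 : ∀ᶠ t : ℝ in 𝓝[>] 0, ∀ p ∈ S, y + t • w ∉ p :=
      (Filter.eventually_all_finite hS).2 fun p hp => eventually_notMem p y (hw p hp)
    have h2 : ∀ᶠ t : ℝ in 𝓝[>] 0, ∀ i, 0 ≤ y i + t * w i := by
      refine Filter.eventually_all.2 fun i => ?_
      have hc : Continuous fun t : ℝ => y i + t * w i := by fun_prop
      have := (hc.tendsto 0).eventually_const_lt (u := 0) (by simpa using hy i)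
      filter_upwards [mem_nhdsWithin_of_mem_nhds this] with t ht using le_of_lt ht
    filter_upwards [h1, h2] with t ht1 ht2
    obtain ⟨τ, hτ, hmem⟩ := hr.2 (y + t • w) (mem_orthant.2 ht2)
    refine Set.mem_biUnion (x := τ) ?_ hmem
    by_contra hτ'
    exact ht1 _ ⟨τ, ⟨hτ, hτ'⟩, rfl⟩ (Submodule.subset_span hmem)
  have hxU : x ∈ U := by
    -- A boundary point is a limit of points with positive coordinates along the direction `(1, …,
    -- 1)`.
    refine mem_of_eventually hU x 1 ?_
    filter_upwards [self_mem_nhdsWithin] with t ht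
    refine hpos fun i => ?_
    have := mem_orthant.1 hx i
    have ht : 0 < t := ht
    simp only [Pi.add_apply, Pi.smul_apply, Pi.one_apply, smul_eq_mul]
    linarith
  obtain ⟨η, hη, h⟩ := Set.mem_iUnion₂.1 hxU
  exact ⟨η, hη, h⟩

end FullDimensional

/-! ### The lattice of a finite abelian group -/

section GroupLattice

variable {n : ℕ} {G : Subgroup (Matrix.SpecialLinearGroup (Fin n) ℂ)} {P : GL (Fin n) ℂ} {ε : ℂ}

lemma conj_one : conj P 1 = 1 := by
  simp [conj]

lemma conj_mul (g h : Matrix.SpecialLinearGroup (Fin n) ℂ) :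
    conj P (g * h) = conj P g * conj P h := by
  have : ((P⁻¹ : GL (Fin n) ℂ) : Matrix (Fin n) (Fin n) ℂ) * (P : Matrix (Fin n) (Fin n) ℂ) = 1 :=
    Units.inv_mul P
  simp only [conj, Matrix.SpecialLinearGroup.coe_mul, mul_assoc]
  rw [← mul_assoc (((P⁻¹ : GL (Fin n) ℂ) : Matrix (Fin n) (Fin n) ℂ)) (P : Matrix _ _ ℂ), this,
    one_mul]

lemma conj_injective : Function.Injective (conj P) := by
  intro g h hgh
  have h1 : ((P⁻¹ : GL (Fin n) ℂ) : Matrix (Fin n) (Fin n) ℂ) * (P : Matrix (Fin n) (Fin n) ℂ) = 1 :=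
    Units.inv_mul P
  have key (g : Matrix.SpecialLinearGroup (Fin n) ℂ) :
      ((P⁻¹ : GL (Fin n) ℂ) : Matrix (Fin n) (Fin n) ℂ) * conj P g * P = g := by
    simp only [conj, mul_assoc, h1, mul_one]
    rw [← mul_assoc, h1, one_mul]
  refine Subtype.ext ?_
  have := key h
  rw [← hgh, key g] at this
  exact this

lemma det_conj (g : Matrix.SpecialLinearGroup (Fin n) ℂ) : (conj P g).det = 1 := by
  have h2 : ((P : Matrix (Fin n) (Fin n) ℂ)) * ((P⁻¹ : GL (Fin n) ℂ) : Matrix (Fin n) (Fin n) ℂ) = 1 :=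
    Units.mul_inv P
  rw [conj, Matrix.det_mul, Matrix.det_mul, g.2, mul_one, ← Matrix.det_mul, h2, Matrix.det_one]

variable (hP : ∀ g ∈ G, (conj P g).IsDiag)

include hP in
lemma conj_mul_apply {g h : Matrix.SpecialLinearGroup (Fin n) ℂ} (hg : g ∈ G) (i : Fin n) :
    conj P (g * h) i i = conj P g i i * conj P h i i := by
  rw [conj_mul, ← (hP g hg).diagonal_diag, Matrix.diagonal_mul, Matrix.diagonal_apply_eq]

include hP in
lemma conj_pow_apply {g : Matrix.SpecialLinearGroup (Fin n) ℂ} (hg : g ∈ G) (i : Fin n) (k : ℕ) :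
    conj P (g ^ k) i i = conj P g i i ^ k := by
  induction k with
  | zero => simp [conj_one]
  | succ k ih => rw [pow_succ', conj_mul_apply hP hg, ih, pow_succ']

variable [Finite G] (hε : IsPrimitiveRoot ε (Nat.card G))

include hP hε

/-- The diagonal entries are roots of unity of order dividing `|G|`, hence powers of `ε` with an
exponent below `|G|`; so the infimum in `frac` is attained. -/
lemma exists_frac_eq {g : Matrix.SpecialLinearGroup (Fin n) ℂ} (hg : g ∈ G) (i : Fin n) :
    ∃ a < Nat.card G, ε ^ a = conj P g i i ∧ frac G P ε g i = a / Nat.card G := by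
  have h1 : g ^ Nat.card G = 1 := by
    have := congrArg Subtype.val (pow_card_eq_one' (x := (⟨g, hg⟩ : G)))
    rwa [SubmonoidClass.coe_pow] at this
  have : NeZero (Nat.card G) := ⟨Nat.card_pos.ne'⟩
  obtain ⟨a, ha, hεa⟩ := hε.eq_pow_of_pow_eq_one (ξ := conj P g i i)
    (by rw [← conj_pow_apply hP hg, h1, conj_one, Matrix.one_apply_eq])
  exact ⟨sInf {a : ℕ | ε ^ a = conj P g i i}, (Nat.sInf_le hεa).trans_lt ha,
    Nat.sInf_mem (s := {a : ℕ | ε ^ a = conj P g i i}) ⟨a, hεa⟩, rfl⟩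

lemma frac_nonneg {g : Matrix.SpecialLinearGroup (Fin n) ℂ} (hg : g ∈ G) (i : Fin n) :
    0 ≤ frac G P ε g i := by
  obtain ⟨a, -, -, h⟩ := exists_frac_eq hP hε hg i
  rw [h]
  positivity

lemma frac_lt_one {g : Matrix.SpecialLinearGroup (Fin n) ℂ} (hg : g ∈ G) (i : Fin n) :
    frac G P ε g i < 1 := by
  obtain ⟨a, ha, -, h⟩ := exists_frac_eq hP hε hg i
  rw [h, div_lt_one (by exact_mod_cast Nat.card_pos)]
  exact_mod_cast ha

lemma frac_one (i : Fin n) : frac G P ε 1 i = 0 := by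
  obtain ⟨a, ha, h1, h⟩ := exists_frac_eq hP hε (one_mem G) i
  rw [conj_one, Matrix.one_apply_eq, hε.pow_eq_one_iff_dvd] at h1
  rw [h, Nat.eq_zero_of_dvd_of_lt h1 ha]
  simp

/-- Exponents add modulo `|G|`, and the integer is the carry. -/
lemma frac_mul {g h : Matrix.SpecialLinearGroup (Fin n) ℂ} (hg : g ∈ G) (hh : h ∈ G) (i : Fin n) :
    ∃ k : ℤ, frac G P ε g i + frac G P ε h i - frac G P ε (g * h) i = k := by
  obtain ⟨a, ha, ha1, ha2⟩ := exists_frac_eq hP hε hg i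
  obtain ⟨b, hb, hb1, hb2⟩ := exists_frac_eq hP hε hh i
  obtain ⟨c, hc, hc1, hc2⟩ := exists_frac_eq hP hε (mul_mem hg hh) i
  have hmod : (a + b) % Nat.card G = c := by
    refine hε.pow_inj (Nat.mod_lt _ Nat.card_pos) hc ?_
    conv_lhs => rw [hε.eq_orderOf, pow_mod_orderOf]
    rw [pow_add, ha1, hb1, hc1, conj_mul_apply hP hg]
  have hr : (Nat.card G : ℝ) ≠ 0 := by exact_mod_cast Nat.card_pos.ne'
  refine ⟨((a + b) / Nat.card G : ℕ), ?_⟩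
  have h := Nat.mod_add_div (a + b) (Nat.card G)
  rw [hmod] at h
  have h' : (c : ℝ) + Nat.card G * ((a + b) / Nat.card G : ℕ) = a + b := by exact_mod_cast h
  rw [ha2, hb2, hc2, Int.cast_natCast, ← add_div, ← sub_div, div_eq_iff hr]
  linarith

/-- The determinant is `ε` to the sum of the exponents. It equals one, so `|G|` divides that sum. -/
lemma exists_age_eq {g : Matrix.SpecialLinearGroup (Fin n) ℂ} (hg : g ∈ G) :
    ∃ k : ℤ, age G P ε g = k := by
  choose a ha ha1 ha2 using exists_frac_eq hP hε hg
  have h1 : ε ^ (∑ i, a i) = 1 := by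
    rw [← Finset.prod_pow_eq_pow_sum, ← det_conj (P := P) g, ← (hP g hg).diagonal_diag,
      Matrix.det_diagonal]
    exact Finset.prod_congr rfl fun i _ => ha1 i
  obtain ⟨k, hk⟩ := (hε.pow_eq_one_iff_dvd _).1 h1
  have hr : (Nat.card G : ℝ) ≠ 0 := by exact_mod_cast Nat.card_pos.ne'
  refine ⟨k, ?_⟩
  simp only [age, ha2]
  rw [← Finset.sum_div, div_eq_iff hr]
  have : ((∑ i, a i : ℕ) : ℝ) = Nat.card G * k := by exact_mod_cast hk
  push_cast at this ⊢
  linarith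

/-- The elements of the lattice are congruent to the `ĝ`. -/
lemma exists_frac_of_mem_lattice {x : Fin n → ℝ} (hx : x ∈ lattice G P ε) :
    ∃ g ∈ G, ∀ i, ∃ k : ℤ, x i - frac G P ε g i = k := by
  rw [lattice, ← Submodule.mem_toAddSubgroup, Submodule.span_int_eq_addSubgroupClosure] at hx
  induction hx using AddSubgroup.closure_induction with
  | mem x hx =>
    rcases hx with ⟨j, rfl⟩ | ⟨g, hg, rfl⟩
    · refine ⟨1, one_mem G, fun i => ?_⟩
      rw [frac_one hP hε, sub_zero]
      change ∃ k : ℤ, (Pi.single j 1 : Fin n → ℝ) i = k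
      rw [Pi.single_apply]
      split_ifs
      · exact ⟨1, by simp⟩
      · exact ⟨0, by simp⟩
    · exact ⟨g, hg, fun i => ⟨0, by simp⟩⟩
  | zero => exact ⟨1, one_mem G, fun i => ⟨0, by simp [frac_one hP hε]⟩⟩
  | add x y _ _ hx hy =>
    obtain ⟨g, hg, h1⟩ := hx
    obtain ⟨h, hh, h2⟩ := hy
    refine ⟨g * h, mul_mem hg hh, fun i => ?_⟩
    obtain ⟨k, hk⟩ := h1 i
    obtain ⟨l, hl⟩ := h2 i
    obtain ⟨m, hm⟩ := frac_mul hP hε hg hh i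
    refine ⟨k + l + m, ?_⟩
    push_cast
    rw [← hk, ← hl, ← hm, Pi.add_apply]
    ring
  | neg x _ hx =>
    obtain ⟨g, hg, h1⟩ := hx
    refine ⟨g⁻¹, inv_mem hg, fun i => ?_⟩
    obtain ⟨k, hk⟩ := h1 i
    obtain ⟨m, hm⟩ := frac_mul hP hε hg (inv_mem hg) i
    rw [mul_inv_cancel, frac_one hP hε, sub_zero] at hm
    refine ⟨-k - m, ?_⟩
    push_cast
    rw [← hk, ← hm, Pi.neg_apply]
    ring

/-- The sum of the coordinates. -/
def coordSum (n : ℕ) : Module.Dual ℝ (Fin n → ℝ) := ∑ i, LinearMap.proj i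

omit hP hε in
lemma coordSum_apply (x : Fin n → ℝ) : coordSum n x = ∑ i, x i := by
  simp [coordSum]

/-- A lattice point differs from some `ĝ` by an integral vector, so its coordinate sum differs from
an age by an integer. -/
lemma coordSum_mem_dualLattice : coordSum n ∈ dualLattice (lattice G P ε) := by
  intro x hx
  obtain ⟨g, hg, h⟩ := exists_frac_of_mem_lattice hP hε hx
  obtain ⟨l, hl⟩ := exists_age_eq hP hε hg
  choose k hk using h
  refine ⟨∑ i, k i + l, ?_⟩
  rw [coordSum_apply]
  push_cast
  rw [← hl, age, ← Finset.sum_add_distrib]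
  exact Finset.sum_congr rfl fun i _ => by rw [← hk]; ring

lemma exists_card_mul_eq {x : Fin n → ℝ} (hx : x ∈ lattice G P ε) (i : Fin n) :
    ∃ k : ℤ, Nat.card G * x i = k := by
  obtain ⟨g, hg, h⟩ := exists_frac_of_mem_lattice hP hε hx
  obtain ⟨k, hk⟩ := h i
  obtain ⟨a, -, -, ha⟩ := exists_frac_eq hP hε hg i
  have hr : (Nat.card G : ℝ) ≠ 0 := by exact_mod_cast Nat.card_pos.ne'
  refine ⟨Nat.card G * k + a, ?_⟩
  push_cast
  rw [← hk, ha]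
  field_simp
  ring

omit hP hε [Finite G] in
lemma single_mem_lattice (i : Fin n) : (Pi.single i 1 : Fin n → ℝ) ∈ lattice G P ε :=
  Submodule.subset_span (Or.inl ⟨i, rfl⟩)

omit hP hε [Finite G] in
lemma frac_mem_lattice {g : Matrix.SpecialLinearGroup (Fin n) ℂ} (hg : g ∈ G) :
    frac G P ε g ∈ lattice G P ε :=
  Submodule.subset_span (Or.inr ⟨g, hg, rfl⟩)

/-- A lattice point of the orthant with coordinate sum `1` is a unit vector or a junior `ĝ`. -/
lemma exists_junior_of_mem {x : Fin n → ℝ} (hx : x ∈ lattice G P ε) (h0 : ∀ i, 0 ≤ x i)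
    (h1 : ∑ i, x i = 1) (hne : ∀ i, x ≠ Pi.single i 1) :
    ∃ g ∈ G, age G P ε g = 1 ∧ frac G P ε g = x := by
  -- A coordinate that reaches one exhausts the sum and makes `x` a unit vector.
  have hlt (i : Fin n) : x i < 1 := by
    by_contra! hi
    refine hne i (funext fun j => ?_)
    have h2 := Finset.add_sum_erase _ x (Finset.mem_univ i)
    have h3 : ∑ j ∈ Finset.univ.erase i, x j = 0 :=
      le_antisymm (by linarith) (Finset.sum_nonneg fun j _ => h0 j)
    have h4 := (Finset.sum_eq_zero_iff_of_nonneg fun j _ => h0 j).1 h3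
    by_cases hj : j = i
    · subst hj
      rw [Pi.single_eq_same]
      linarith
    · rw [Pi.single_eq_of_ne hj]
      exact h4 j (Finset.mem_erase.2 ⟨hj, Finset.mem_univ _⟩)
  obtain ⟨g, hg, h⟩ := exists_frac_of_mem_lattice hP hε hx
  -- Both vectors have entries in `[0, 1)` and they differ by integers.
  have hgx : frac G P ε g = x := by
    funext i
    obtain ⟨k, hk⟩ := h i
    have a1 := frac_nonneg hP hε hg i
    have a2 := frac_lt_one hP hε hg i
    have a3 := h0 i
    have a4 := hlt i
    have b1 : (-1 : ℝ) < k := by linarith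
    have b2 : (k : ℝ) < 1 := by linarith
    have b3 : -1 < k := by exact_mod_cast b1
    have b4 : k < 1 := by exact_mod_cast b2
    obtain rfl : k = 0 := by omega
    simp only [Int.cast_zero] at hk
    linarith
  exact ⟨g, hg, by rw [age, hgx, h1], hgx⟩

lemma eq_one_of_frac_eq_zero {g : Matrix.SpecialLinearGroup (Fin n) ℂ} (hg : g ∈ G)
    (h : ∀ i, frac G P ε g i = 0) : g = 1 := by
  apply conj_injective (P := P)
  rw [conj_one, ← (hP g hg).diagonal_diag, ← Matrix.diagonal_one]
  congr 1
  funext i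
  obtain ⟨a, -, h1, h2⟩ := exists_frac_eq hP hε hg i
  have hr : (Nat.card G : ℝ) ≠ 0 := by exact_mod_cast Nat.card_pos.ne'
  rw [h i, eq_div_iff hr, zero_mul] at h2
  have : a = 0 := by exact_mod_cast h2.symm
  rw [Matrix.diag_apply, ← h1, this, pow_zero]

/-- The lattice lies in `|G|⁻¹ ℤⁿ`, which is discrete. -/
lemma discreteTopology_lattice : DiscreteTopology (lattice G P ε) := by
  have hr : (Nat.card G : ℝ) ≠ 0 := by exact_mod_cast Nat.card_pos.ne'
  let b := (Pi.basisFun ℝ (Fin n)).isUnitSMul (w := fun _ => (Nat.card G : ℝ)⁻¹)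
    fun _ => (inv_ne_zero hr).isUnit
  have hd : DiscreteTopology (Submodule.span ℤ (Set.range b)) := inferInstance
  refine DiscreteTopology.of_subset (s := (Submodule.span ℤ (Set.range b) : Set (Fin n → ℝ)))
    hd fun x hx => ?_
  rw [SetLike.mem_coe, b.mem_span_iff_repr_mem ℤ]
  intro i
  obtain ⟨k, hk⟩ := exists_card_mul_eq hP hε hx i
  refine ⟨k, ?_⟩
  rw [Module.Basis.repr_isUnitSMul]
  simp [Units.smul_def, hk]

omit hP hε [Finite G] in
lemma span_lattice : Submodule.span ℝ (lattice G P ε : Set (Fin n → ℝ)) = ⊤ := by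
  rw [eq_top_iff, ← (Pi.basisFun ℝ (Fin n)).span_eq]
  refine Submodule.span_mono ?_
  rintro _ ⟨i, rfl⟩
  rw [Pi.basisFun_apply]
  exact single_mem_lattice i

end GroupLattice

/-! ### Real bases from lattice bases -/

section SmoothCone

variable {n : ℕ}

/-- A smooth cone is generated by a part of a lattice basis. -/
lemma IsSmoothCone.exists_basis {N : Submodule ℤ (Fin n → ℝ)} [DiscreteTopology N]
    (hN : Submodule.span ℝ (N : Set (Fin n → ℝ)) = ⊤) {τ : PointedCone ℝ (Fin n → ℝ)}
    (h : IsSmoothCone N τ) : ∃ (b : Module.Basis (Fin n) ℝ (Fin n → ℝ)) (s : Set (Fin n)),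
      IsLatticeBasis N b ∧ τ = PointedCone.hull ℝ (b '' s) := by
  obtain ⟨ι, b₀, s₀, h0⟩ := h
  have : IsZLattice ℝ N := ⟨hN⟩
  let b₁ := b₀.ofZLatticeBasis ℝ N
  let e : ι ≃ Fin n := b₁.indexEquiv (Pi.basisFun ℝ (Fin n))
  refine ⟨b₁.reindex e, e '' s₀, fun x => ⟨fun hx i => ⟨b₀.repr ⟨x, hx⟩ (e.symm i), ?_⟩,
    fun hx => ?_⟩, ?_⟩
  · rw [Module.Basis.coord_apply, Module.Basis.repr_reindex_apply]
    exact b₀.ofZLatticeBasis_repr_apply ℝ N ⟨x, hx⟩ (e.symm i)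
  · rw [← (b₁.reindex e).sum_repr x]
    refine sum_mem fun i _ => ?_
    obtain ⟨k, hk⟩ := hx i
    rw [show (b₁.reindex e).repr x i = k from hk, Int.cast_smul_eq_zsmul]
    refine N.smul_mem _ ?_
    rw [Module.Basis.reindex_apply, Module.Basis.ofZLatticeBasis_apply]
    exact Subtype.prop _
  · rw [h0, Set.image_image]
    congr 1
    refine Set.image_congr fun i _ => ?_
    rw [Module.Basis.reindex_apply, e.symm_apply_apply, Module.Basis.ofZLatticeBasis_apply]

end SmoothCone

/-! ### Crepant resolutions -/

section CrepantResolution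

/-- Interchanging the indices `0` and `i` puts the chosen generator first. -/
lemma IsLatticeBasis.exists_isAdaptedBasis {V : Type} [AddCommGroup V] [Module ℝ V]
    {N : Submodule ℤ V} {d : ℕ} {b : Module.Basis (Fin (d + 1)) ℝ V} {s : Set (Fin (d + 1))}
    (hb : IsLatticeBasis N b) {i : Fin (d + 1)} (hi : i ∈ s) {κ : Module.Dual ℝ V}
    (hκ : ∀ i ∈ s, κ (b i) = 1) :
    ∃ (b' : Module.Basis (Fin (d + 1)) ℝ V) (s' : Set (Fin (d + 1))),
      IsAdaptedBasis N (PointedCone.hull ℝ (b '' s)) (b i) b' s' ∧ ∀ i ∈ s', κ (b' i) = 1 := by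
  let e : Fin (d + 1) ≃ Fin (d + 1) := Equiv.swap 0 i
  have hr (j) : b.reindex e (e j) = b j := by
    rw [Module.Basis.reindex_apply, e.symm_apply_apply]
  have h0 : e i = 0 := Equiv.swap_apply_right _ _
  refine ⟨b.reindex e, e '' s, ⟨fun x => ?_, ?_, ⟨i, hi, h0⟩, ?_⟩, ?_⟩
  · rw [hb x]
    refine ⟨fun h j => ?_, fun h j => ?_⟩
    · obtain ⟨k, hk⟩ := h (e.symm j)
      exact ⟨k, by rw [← hk, Module.Basis.coord_apply, Module.Basis.repr_reindex_apply]; rfl⟩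
    · obtain ⟨k, hk⟩ := h (e j)
      refine ⟨k, ?_⟩
      rw [← hk, Module.Basis.coord_apply, Module.Basis.coord_apply,
        Module.Basis.repr_reindex_apply, e.symm_apply_apply]
  · rw [Set.image_image]
    congr 1
    exact Set.image_congr fun j _ => (hr j).symm
  · rw [← h0, hr]
  · rintro _ ⟨j, hj, rfl⟩
    rw [hr]
    exact hκ j hj

variable {n : ℕ} {G : Subgroup (Matrix.SpecialLinearGroup (Fin n) ℂ)} {P : GL (Fin n) ℂ} {ε : ℂ}
  (hP : ∀ g ∈ G, (conj P g).IsDiag) [Finite G] (hε : IsPrimitiveRoot ε (Nat.card G))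

include hP hε

/-- The sum of the other coordinates cuts out the ray. Its multiple by `|G|` is integral on `N`. -/
lemma isFace_single_orthant (i : Fin n) :
    IsFace (lattice G P ε) (PointedCone.hull ℝ {(Pi.single i 1 : Fin n → ℝ)}) (orthant n) := by
  classical
  let m : Module.Dual ℝ (Fin n → ℝ) :=
    (Nat.card G : ℝ) • ∑ j with j ≠ i, LinearMap.proj j
  have hr : (Nat.card G : ℝ) ≠ 0 := by exact_mod_cast Nat.card_pos.ne'
  have hm (x : Fin n → ℝ) : m x = Nat.card G * ∑ j with j ≠ i, x j := by
    simp [m]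
  refine ⟨m, ⟨fun x hx => ?_, fun x hx => ?_⟩, SetLike.ext fun x => ?_⟩
  · choose k hk using exists_card_mul_eq hP hε hx
    refine ⟨∑ j with j ≠ i, k j, ?_⟩
    rw [hm, Finset.mul_sum]
    push_cast
    exact Finset.sum_congr rfl fun j _ => hk j
  · rw [hm]
    exact mul_nonneg (Nat.cast_nonneg _) (Finset.sum_nonneg fun j _ => mem_orthant.1 hx j)
  · have h1 : ({(Pi.single i 1 : Fin n → ℝ)} : Set (Fin n → ℝ)) =
        Pi.basisFun ℝ (Fin n) '' {i} := by
      simp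
    rw [mem_slice, h1, mem_hull_basis, hm, mem_orthant]
    simp only [Module.Basis.coord_apply, Pi.basisFun_repr, Set.mem_singleton_iff, forall_eq]
    refine ⟨fun ⟨h2, h3⟩ => ⟨fun j => ?_, ?_⟩, fun ⟨h2, h3⟩ => ⟨h2 i, fun j hj => ?_⟩⟩
    · by_cases hj : j = i
      · rwa [hj]
      · rw [h3 j hj]
    · rw [Finset.sum_eq_zero fun j hj => h3 j (Finset.mem_filter.1 hj).2, mul_zero]
    · have h4 := (mul_eq_zero.1 h3).resolve_left hr
      rw [Finset.sum_eq_zero_iff_of_nonneg fun j _ => h2 j] at h4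
      exact h4 j (Finset.mem_filter.2 ⟨Finset.mem_univ _, hj⟩)

/-- The coordinate sum is integral on `N` and equals one on the unit vector, which is therefore
primitive in `N` too. -/
lemma isRayGenerator_single (i : Fin n) : IsRayGenerator (lattice G P ε)
    (PointedCone.hull ℝ {(Pi.single i 1 : Fin n → ℝ)}) (Pi.single i 1) := by
  refine ⟨rfl, single_mem_lattice i, fun h => ?_, fun t ht h => ?_⟩
  · have := congrFun h i
    simp at this
  · obtain ⟨k, hk⟩ := coordSum_mem_dualLattice hP hε _ h
    have hk' : t = k := by
      rw [← hk, map_smul, coordSum_apply]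
      simp
    rw [hk'] at ht ⊢
    exact_mod_cast ht

omit hP hε [Finite G] in
lemma apply_eq_one_of_canonicalDivisor {S : Set (PointedCone ℝ (Fin n → ℝ))}
    {m : Module.Dual ℝ (Fin n → ℝ)} (hm : m ∈ dualLattice (lattice G P ε))
    (h : canonicalDivisor (lattice G P ε) S = charDivisor (lattice G P ε) S (-m))
    {ρ : PointedCone ℝ (Fin n → ℝ)} (hρ : ρ ∈ S) {u : Fin n → ℝ}
    (hu : IsRayGenerator (lattice G P ε) ρ u) : m u = 1 := by
  have h1 : (-1 : ℤ) = ⌊(-m) u⌋ := congrFun h ⟨u, ρ, hρ, hu⟩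
  obtain ⟨k, hk⟩ := hm u hu.2.1
  rw [LinearMap.neg_apply, hk, ← Int.cast_neg, Int.floor_intCast] at h1
  rw [hk]
  exact_mod_cast (neg_injective h1).symm

variable {Ξ : Fan (lattice G P ε)} (hΞ : IsCrepantResolution G P ε Ξ)

include hΞ

/-- The `m` provided by crepancy is one on the rays of the orthant, which forces it to be the
coordinate sum; the condition on `Ξ` then gives the same value on its rays. -/
lemma coordSum_eq_one {ρ : PointedCone ℝ (Fin n → ℝ)} (hρ : ρ ∈ Ξ.cones) {u : Fin n → ℝ}
    (hu : IsRayGenerator (lattice G P ε) ρ u) : coordSum n u = 1 := by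
  obtain ⟨m, hm, h1, h2⟩ := hΞ.2.2
  have : m = coordSum n := by
    refine (Pi.basisFun ℝ (Fin n)).ext fun i => ?_
    rw [Pi.basisFun_apply, apply_eq_one_of_canonicalDivisor hm h1
      (isFace_single_orthant hP hε i) (isRayGenerator_single hP hε i), coordSum_apply]
    simp
  rw [← this]
  exact apply_eq_one_of_canonicalDivisor hm h2 hρ hu

lemma exists_basis_of_mem_cones {τ : PointedCone ℝ (Fin n → ℝ)} (hτ : τ ∈ Ξ.cones) :
    ∃ (b : Module.Basis (Fin n) ℝ (Fin n → ℝ)) (s : Set (Fin n)),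
      IsLatticeBasis (lattice G P ε) b ∧ τ = PointedCone.hull ℝ (b '' s) ∧
        ∀ i ∈ s, coordSum n (b i) = 1 := by
  have := discreteTopology_lattice hP hε
  obtain ⟨b, s, hb, rfl⟩ := (hΞ.1 τ hτ).exists_basis span_lattice
  exact ⟨b, s, hb, rfl, fun i hi => coordSum_eq_one hP hε hΞ
    (Ξ.face_mem _ hτ _ (hb.ray_isFace hi)) (hb.isRayGenerator i)⟩

/-- A cone of full dimension that contains the sum of the generators contains the whole cone. -/
lemma exists_maxCone_ge {τ : PointedCone ℝ (Fin n → ℝ)} (hτ : τ ∈ Ξ.cones) :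
    ∃ η ∈ Ξ.maxCones, τ ≤ η := by
  classical
  obtain ⟨b, s, hb, rfl, -⟩ := exists_basis_of_mem_cones hP hε hΞ hτ
  obtain ⟨η, hη, h⟩ := exists_maxCone_of_mem (Ξ := Ξ) (fun τ' hτ' => by
    obtain ⟨b', s', -, rfl, -⟩ := exists_basis_of_mem_cones hP hε hΞ hτ'
    exact isClosed_hull_basis b' s') hΞ.2.1 (x := ∑ i with i ∈ s, b i) (hΞ.2.1.1 _ hτ
      (sum_mem fun i hi => Submodule.subset_span ⟨i, (Finset.mem_filter.1 hi).2, rfl⟩))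
  exact ⟨η, hη, le_of_sum_mem hτ hη.1 h⟩

variable {g : Matrix.SpecialLinearGroup (Fin n) ℂ} (hg : g ∈ G) (hage : age G P ε g = 1)

include hg hage

/-- Being junior means height one, and the only lattice points of height one in a cone of `Ξ` are
its generators. -/
lemma exists_basis_eq_frac {τ : PointedCone ℝ (Fin n → ℝ)} (hτ : τ ∈ Ξ.cones)
    (hv : frac G P ε g ∈ τ) :
    ∃ (b : Module.Basis (Fin n) ℝ (Fin n → ℝ)) (s : Set (Fin n)),
      IsLatticeBasis (lattice G P ε) b ∧ τ = PointedCone.hull ℝ (b '' s) ∧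
        (∀ i ∈ s, coordSum n (b i) = 1) ∧ ∃ i ∈ s, b i = frac G P ε g := by
  obtain ⟨b, s, hb, rfl, h1⟩ := exists_basis_of_mem_cones hP hε hΞ hτ
  exact ⟨b, s, hb, rfl, h1, hb.exists_eq_of_apply_eq_one h1 (frac_mem_lattice hg) hv
    (by rw [coordSum_apply]; exact hage)⟩

/-- The ray of a junior element belongs to the fan. -/
lemma ray_mem_cones : ray G P ε g ∈ Ξ.cones := by
  obtain ⟨τ, hτ, hv⟩ := hΞ.2.1.2 (frac G P ε g) (mem_orthant.2 (frac_nonneg hP hε hg))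
  obtain ⟨b, s, hb, rfl, -, i, hi, h⟩ := exists_basis_eq_frac hP hε hΞ hg hage hτ hv
  rw [ray, ← h]
  exact Ξ.face_mem _ hτ _ (hb.ray_isFace hi)

lemma mem_starFan_of_mem {τ : PointedCone ℝ (Fin n → ℝ)} (hτ : τ ∈ Ξ.cones)
    (hv : frac G P ε g ∈ τ) : τ ∈ (Ξ.starFan (ray G P ε g)).cones := by
  obtain ⟨η, hη, hle⟩ := exists_maxCone_ge hP hε hΞ hτ
  refine ⟨η, hη, Ξ.isFace_of_le (ray_mem_cones hP hε hΞ hg hage) hη.1 ?_,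
    Ξ.isFace_of_le hτ hη.1 hle⟩
  exact Submodule.span_le.2 (Set.singleton_subset_iff.2 (hle hv))

end CrepantResolution

/-! ### Covering by the stars of the junior rays -/

section Covering

variable {n : ℕ} {G : Subgroup (Matrix.SpecialLinearGroup (Fin n) ℂ)} {P : GL (Fin n) ℂ} {ε : ℂ}
  (hP : ∀ g ∈ G, (conj P g).IsDiag) [Finite G] (hε : IsPrimitiveRoot ε (Nat.card G))
  {Ξ : Fan (lattice G P ε)} (hΞ : IsCrepantResolution G P ε Ξ)

include hP hε hΞ

/-- Every cone of full dimension has a junior generator. -/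
lemma exists_junior_mem_maxCone (hG : G ≠ ⊥) {η : PointedCone ℝ (Fin n → ℝ)}
    (hη : η ∈ Ξ.maxCones) : ∃ g ∈ G, age G P ε g = 1 ∧ frac G P ε g ∈ η := by
  obtain ⟨b, s, hb, rfl, h1⟩ := exists_basis_of_mem_cones hP hε hΞ hη.1
  obtain rfl := eq_univ_of_span_eq_top hη.2
  have hmem (i) : b i ∈ PointedCone.hull ℝ (b '' Set.univ) :=
    Submodule.subset_span ⟨i, trivial, rfl⟩
  by_cases h : ∃ i, ∀ j, b i ≠ Pi.single j 1
  · obtain ⟨i, hi⟩ := h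
    obtain ⟨g, hg, hage, hgi⟩ := exists_junior_of_mem hP hε (hb.basis_mem i)
      (mem_orthant.1 (hΞ.2.1.1 _ hη.1 (hmem i)))
      (by rw [← coordSum_apply]; exact h1 i trivial) hi
    exact ⟨g, hg, hage, hgi ▸ hmem i⟩
  -- If all the generators are unit vectors, then every `ĝ` is an integral vector with entries in
  -- `[0, 1)`, hence zero, and `G` is trivial.
  · push Not at h
    choose e he using h
    refine absurd ((Subgroup.eq_bot_iff_forall G).2 fun g hg => ?_) hG
    refine eq_one_of_frac_eq_zero hP hε hg fun j => ?_
    choose k hk using (hb _).1 (frac_mem_lattice hg)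
    obtain ⟨l, hl⟩ : ∃ l : ℤ, frac G P ε g j = l := by
      refine ⟨∑ i, k i * (Pi.single (e i) 1 : Fin n → ℤ) j, ?_⟩
      conv_lhs => rw [← b.sum_repr (frac G P ε g)]
      rw [Finset.sum_apply]
      push_cast
      refine Finset.sum_congr rfl fun i _ => ?_
      rw [Pi.smul_apply, smul_eq_mul, show b.repr (frac G P ε g) i = k i from hk i, he]
      simp [Pi.single_apply]
    have a1 := frac_nonneg hP hε hg j
    have a2 := frac_lt_one hP hε hg j
    rw [hl] at a1 a2 ⊢
    have a3 : 0 ≤ l := by exact_mod_cast a1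
    have a4 : l < 1 := by exact_mod_cast a2
    obtain rfl : l = 0 := by omega
    simp

/-- The varieties of the stars of the junior rays cover the resolution. -/
lemma exists_mem_range_fanAtι (hG : G ≠ ⊥) (x : Ξ.toricVariety) :
    ∃ g ∈ G, age G P ε g = 1 ∧ x ∈ Set.range (fanAtι Ξ g) := by
  obtain ⟨τ, hτ⟩ := Ξ.exists_mem_range_chart x
  obtain ⟨η, hη, hle⟩ := exists_maxCone_ge hP hε hΞ τ.2
  obtain ⟨g, hg, hage, hv⟩ := exists_junior_mem_maxCone hP hε hΞ hG hη
  refine ⟨g, hg, hage, ?_⟩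
  have hmem := mem_starFan_of_mem hP hε hΞ hg hage hη.1 hv
  obtain ⟨y, rfl⟩ := Ξ.range_chart_subset (η := ⟨η, hη.1⟩) hle hτ
  refine ⟨(fanAt Ξ g).chart ⟨η, hmem⟩ y, ?_⟩
  rw [← Scheme.Hom.comp_apply]
  exact congr($(Fan.chart_subfanMap (Ξ.starFan_subset (ray G P ε g)) ⟨η, hmem⟩) y)

end Covering

/-! ### From an isomorphism of total spaces to a normal embedding -/

section NormallyEmbedded

/-- The neighbourhood `U₀` can be the entire normal bundle. -/
lemma isNormallyEmbedded_of_iso {X Y : Scheme.{0}} {s : X ⟶ Spec (.of ℂ)} {I : X.IdealSheafData}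
    (h : (conormal I).IsQuasiCoherent) (e : ModuleOver.tot h ≅ Y) (j : Y ⟶ X) [IsOpenImmersion j]
    (hz : ModuleOver.zeroSection h ≫ e.hom ≫ j = I.subschemeι)
    (hs : e.hom ≫ j ≫ s = ModuleOver.totMap h ≫ s) : IsNormallyEmbedded s I := by
  refine ⟨h, ⊤, ModuleOver.zeroSection h ≫ (Scheme.topIso _).inv,
    (Scheme.topIso _).hom ≫ e.hom ≫ j, ?_, inferInstance, ?_, ?_⟩
  · rw [Category.assoc]
    have : (Scheme.topIso (ModuleOver.tot h)).inv ≫ (⊤ : (ModuleOver.tot h).Opens).ι = 𝟙 _ :=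
      (Scheme.topIso (ModuleOver.tot h)).inv_hom_id
    rw [this, Category.comp_id]
  · rw [Category.assoc, Iso.inv_hom_id_assoc, hz]
  · rw [Category.assoc, Category.assoc, hs]
    rfl

end NormallyEmbedded

end Toric

end

open CategoryTheory AlgebraicGeometry Toric in
theorem theorem3p4 {n : ℕ} (G : Subgroup (Matrix.SpecialLinearGroup (Fin n) ℂ)) [Finite G]
    (hG : ∀ g ∈ G, ∀ h ∈ G, g * h = h * g)
    (P : GL (Fin n) ℂ) (hP : ∀ g ∈ G, (Toric.conj P g).IsDiag)
    (ε : ℂ) (hε : IsPrimitiveRoot ε (Nat.card G))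
    (Ξ : Fan (Toric.lattice G P ε)) (hΞ : IsCrepantResolution G P ε Ξ) :
    (∀ g ∈ G, age G P ε g = 1 →
      ∃ hg : ray G P ε g ∈ Ξ.cones,
        IsNormallyEmbedded Ξ.structureMap (excIdeal Ξ g hg) ∧
        IsOpenImmersion (fanAtι Ξ g) ∧
        ∃ (hω : (excDualCanonical Ξ g hg).IsQuasiCoherent)
          (hN : (conormal (excIdeal Ξ g hg)).IsQuasiCoherent),
          (∃ φ : ModuleOver.tot hω ≅ (fanAt Ξ g).toricVariety,
            φ.hom ≫ (fanAt Ξ g).structureMap =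
              ModuleOver.totMap hω ≫ excι Ξ g hg ≫ Ξ.structureMap ∧
            ModuleOver.zeroSection hω ≫ φ.hom ≫ fanAtι Ξ g = excι Ξ g hg) ∧
          (∃ ψ : ModuleOver.tot hω ≅ ModuleOver.tot hN,
            ψ.hom ≫ ModuleOver.totMap hN = ModuleOver.totMap hω ≫ excι Ξ g hg ∧
            ModuleOver.zeroSection hω ≫ ψ.hom = ModuleOver.zeroSection hN)) ∧
    (G ≠ ⊥ → ∀ x : Ξ.toricVariety, ∃ g ∈ G, age G P ε g = 1 ∧ x ∈ Set.range (fanAtι Ξ g)) := by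
  refine ⟨fun g hg hage => ?_, exists_mem_range_fanAtι hP hε hΞ⟩
  -- For `n = 0` the age is an empty sum, so nothing is junior. With `n = d + 1` the degree `n - 1`
  -- of the forms is `d`.
  obtain ⟨d, rfl⟩ : ∃ d, n = d + 1 := by
    rcases n with _ | d
    · simp [age] at hage
    · exact ⟨d, rfl⟩
  have hρ := ray_mem_cones hP hε hΞ hg hage
  have hv := frac_mem_lattice (P := P) (ε := ε) hg
  have hb (τ : Ξ.ConeAt (frac G P ε g)) :
      ∃ (b : Module.Basis (Fin (d + 1)) ℝ (Fin (d + 1) → ℝ)) (s : Set (Fin (d + 1))),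
        IsAdaptedBasis (Toric.lattice G P ε) τ.1.1 (frac G P ε g) b s ∧
          ∀ i ∈ s, coordSum (d + 1) (b i) = 1 := by
    obtain ⟨b, s, h1, h2, h3, i, hi, h4⟩ := exists_basis_eq_frac hP hε hΞ hg hage τ.1.2 τ.2
    rw [h2, ← h4]
    exact h1.exists_isAdaptedBasis hi h3
  -- One basis starting with `ĝ`, taken from the ray itself, defines the derivations on all charts.
  obtain ⟨c, _, hc, -⟩ := hb ⟨⟨ray G P ε g, hρ⟩, Submodule.subset_span rfl⟩
  have hN := isQuasiCoherent_conormal (excIdeal Ξ g hρ)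
  have hω : (excDualCanonical Ξ g hρ).IsQuasiCoherent :=
    isQuasiCoherent_dualCanonical_orbit (ρ := ⟨ray G P ε g, hρ⟩) hv rfl fun τ => by
      obtain ⟨b, s, h, -⟩ := hb τ
      exact ⟨b, s, h⟩
  have himm : IsOpenImmersion (fanAtι Ξ g) := Fan.isOpenImmersion_subfanMap _
  obtain ⟨e, he, hez⟩ : ∃ e : ModuleOver.tot hN ≅ (fanAt Ξ g).toricVariety,
      e.hom ≫ (fanAt Ξ g).structureMap = ModuleOver.totMap hN ≫ Ξ.structureMap ∧
      ModuleOver.zeroSection hN ≫ e.hom ≫ fanAtι Ξ g = excι Ξ g hρ :=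
    exists_tot_conormal_iso (ρ := ⟨ray G P ε g, hρ⟩) hv rfl
      (fun τ => by
        obtain ⟨b, s, h, -⟩ := hb τ
        exact ⟨_, h.isRayCoordinate⟩)
      (fun τ hτ hmem => mem_starFan_of_mem hP hε hΞ hg hage hτ hmem) hN
  obtain ⟨ψ, hψ, hψz⟩ : ∃ ψ : ModuleOver.tot hω ≅ ModuleOver.tot hN,
      ψ.hom ≫ ModuleOver.totMap hN = ModuleOver.totMap hω ≫ excι Ξ g hρ ∧
      ModuleOver.zeroSection hω ≫ ψ.hom = ModuleOver.zeroSection hN :=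
    exists_tot_dualCanonical_iso (ρ := ⟨ray G P ε g, hρ⟩) hv rfl c (coordSum (d + 1)) hb
      (coordSum_mem_dualLattice hP hε) hc.apply_zero hN hω
  refine ⟨hρ, isNormallyEmbedded_of_iso hN e (fanAtι Ξ g) hez ?_, himm, hω, hN,
    ⟨ψ ≪≫ e, ?_, ?_⟩, ψ, hψ, hψz⟩
  · rw [Fan.subfanMap_structureMap, he]
  · rw [Iso.trans_hom, Category.assoc, he, reassoc_of% hψ]
  · rw [Iso.trans_hom, Category.assoc, reassoc_of% hψz, hez]
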